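/- Let $I\subset\mathbb R$ be a bounded interval of positive length. For a real $2\times 2$ matrix $A=\begin{pmatrix}a&b\\c&d\end{pmatrix}$ with $\det A\neq 0$ write $A\cdot x=\frac{ax+b}{cx+d}$, and let $R=\begin{pmatrix}0&-1\\1&0\end{pmatrix}$. Let $T:I\to I$ be a piecewise Möbius map: $I$ is partitioned into countably many intervals $K_\beta$ (possibly including one-point intervals), taken as large as possible, and called cylinders, and there are invertible real $2\times2$ matrices $M_\beta$ with $T(x)=M_\beta\cdot x$ for $x\in K_\beta$. A cylinder $K_\beta$ is *full* if $T(K_\beta)=I$ up to the endpoints of $I$. Let $\mathcal T(x,y)=(M_\beta\cdot x,\ RM_\beta R^{-1}\cdot y)$ for $x\in K_\beta$ (and $y$ not the pole of $RM_\beta R^{-1}$), and let $\mu$ be the measure $d\mu=\frac{dx\,dy}{(1+xy)^2}$ on $\mathbb R^2$. Let $\Omega\subset\mathbb R^2$ be a planar extension for $T$: a Borel set that projects onto $I$ under $(x,y)\mapsto x$ and on which $\mathcal T$ is bijective up to $\mu$-null sets. For $x\in I$ let $\Omega_x=\{y:(x,y)\in\Omega\}$ be the vertical fiber, and let $|\cdot|$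 denote one-dimensional Lebesgue measure. Suppose that (a) there are constants $0<a\le b<\infty$ with $a\le|\Omega_x|\le b$ for all $x\in I$; (b) $\Omega$ has positive distance in the plane from the curve $y=-1/x$; (c) there is a full cylinder $K_\beta$ for which the ratios $|RM_\beta R^{-1}\cdot\Omega_x|\,/\,|\Omega_{T(x)}|$, $x\in K_\beta$, are bounded away from $0$ and from $1$; (d) $T$ has bounded non-full range: there is a full cylinder whose interior is avoided by the orbits of the endpoints of all non-full cylinders of positive length; here the orbit of an endpoint $e$ of $K_\beta$ consists of those one-sided limits $\lim_{x\to e,\,x\in \mathrm{int}\,K_\beta}T^k(x)$, $k\ge0$, that exist. Then: (i) $0<\mu(\Omega)<\infty$. Let $\mu'=\mu|_\Omega/\mu(\Omega)$, and let $\nu$ be its marginal, that is, its image under $(x,y)\mapsto x$. (ii) $T$ is eventually expansive: there are $r\ge1$ and $c>1$ with $|(T^r)'(x)|\ge c$ for all $x$ in the interior of any cylinder of rank $r$, that is, for all $x\in I$ such that each of $x,T(x),\dots,T^{r-1}(x)$ is interior to a cylinder. (iii) $\nu$ is $T$-invariant and $T$ is ergodic with respect to $\nu$. (iv) With the projection $(x,y)\mapsto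 x$, the system $(\mathcal T,\Omega,\mu')$ is the natural extension of $(T,I,\nu)$; that is, $\mu'$ is $\mathcal T$-invariant, and the system is isomorphic modulo null sets, over $(T,I,\nu)$, to the inverse limit of $(T,I,\nu)$. In particular, $\mathcal T$ is ergodic with respect to $\mu'$. -/

import Mathlib

open MeasureTheory Set Filter Topology
open scoped ENNReal

/-- The Möbius action of a real `2 × 2` matrix on the real line (used only off the pole). -/
noncomputable def mobius (A : Matrix (Fin 2) (Fin 2) ℝ) (x : ℝ) : ℝ :=
  (A 0 0 * x + A 0 1) / (A 1 0 * x + A 1 1)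

/-- The matrix `R`, acting by `R · y = -1 / y`. -/
def rotMatrix : Matrix (Fin 2) (Fin 2) ℝ := !![0, -1; 1, 0]

/-- The planar map `𝒯_A (x, y) = (A · x, R A R⁻¹ · y)`. -/
noncomputable def planarMobius (A : Matrix (Fin 2) (Fin 2) ℝ) (p : ℝ × ℝ) : ℝ × ℝ :=
  (mobius A p.1, mobius (rotMatrix * A * rotMatrix⁻¹) p.2)

/-- The measure `dμ = dx dy / (1 + x y)²` on the plane. -/
noncomputable def planarMeasure : Measure (ℝ × ℝ) :=
  (volume : Measure (ℝ × ℝ)).withDensity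
    fun p => ENNReal.ofReal (1 / (1 + p.1 * p.2) ^ 2)

/-- The vertical fiber of `Ω` above `x`. -/
def verticalFiber (Ω : Set (ℝ × ℝ)) (x : ℝ) : Set ℝ := {y | (x, y) ∈ Ω}

/-- The data of a piecewise Möbius interval map: a nondegenerate interval `I`, a partition of `I`
into intervals `K β` (the rank one cylinders), and invertible matrices `M β` such that the map
given on each `K β` by `x ↦ M β · x` takes its values in `I`.  One-point cylinders are allowed. -/
structure PiecewiseMobius (ι : Type*) where
  /-- the interval of definition -/
  I : Set ℝ
  /-- the rank one cylinders -/
  K : ι → Set ℝ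
  /-- the matrix by which the map acts on a cylinder -/
  M : ι → Matrix (Fin 2) (Fin 2) ℝ
  ordConnected_I : I.OrdConnected
  nondegenerate_I : (interior I).Nonempty
  ordConnected_K : ∀ β, (K β).OrdConnected
  nonempty_K : ∀ β, (K β).Nonempty
  disjoint_K : Pairwise fun β γ => Disjoint (K β) (K γ)
  iUnion_K : ⋃ β, K β = I
  det_ne_zero : ∀ β, (M β).det ≠ 0
  denom_ne_zero : ∀ β, ∀ x ∈ K β, M β 1 0 * x + M β 1 1 ≠ 0
  mapsTo_I : ∀ β, MapsTo (mobius (M β)) (K β) I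
  /-- Cylinders are as large as possible: an interval on which the map is given by one single
  Möbius transformation lies, up to its endpoints, in one cylinder. -/
  maximal_K : ∀ (J : Set ℝ) (A : Matrix (Fin 2) (Fin 2) ℝ), J ⊆ I → J.OrdConnected →
    A.det ≠ 0 → (∀ x ∈ J, A 1 0 * x + A 1 1 ≠ 0) →
    (∀ β, ∀ x ∈ J ∩ K β, mobius (M β) x = mobius A x) → ∃ β, interior J ⊆ K β

namespace PiecewiseMobius

variable {ι : Type*} (S : PiecewiseMobius ι)

open Classical in
/-- The interval map `T`, with `T x = M β · x` for `x ∈ K β`.  (Points outside `I` are fixed; this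
is irrelevant.) -/
noncomputable def map (x : ℝ) : ℝ :=
  if h : ∃ β, x ∈ S.K β then mobius (S.M h.choose) x else x

open Classical in
/-- The planar map `𝒯`, with `𝒯 (x, y) = 𝒯_{M β} (x, y)` for `x ∈ K β`. -/
noncomputable def planarMap (p : ℝ × ℝ) : ℝ × ℝ :=
  if h : ∃ β, p.1 ∈ S.K β then planarMobius (S.M h.choose) p else p

/-- `Ω` is (the domain of) a planar extension: a Borel set that projects onto `I` and on which `𝒯`
is bijective up to `μ`-null sets. -/
structure IsPlanarExtension (Ω : Set (ℝ × ℝ)) : Prop where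
  measurableSet : MeasurableSet Ω
  image_fst : Prod.fst '' Ω = S.I
  bijective : ∃ Ω₀ Ω₁ : Set (ℝ × ℝ), Ω₀ ⊆ Ω ∧ Ω₁ ⊆ Ω ∧
    planarMeasure (Ω \ Ω₀) = 0 ∧ planarMeasure (Ω \ Ω₁) = 0 ∧ BijOn S.planarMap Ω₀ Ω₁

/-- A cylinder is full if its image is `I`, up to endpoints of `I`. -/
def IsFull (β : ι) : Prop := interior S.I ⊆ S.map '' S.K β

/-- Bounded non-full range: some full cylinder `K γ` has an interior that is avoided by the orbits
of the endpoints `e` of all non-full cylinders `K β` (other than one-point cylinders).  As `e` need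
not belong to `K β`, nor to `I`, the points of its orbit are the limits of `T^k (x)` as `x` tends
to `e` inside `K β`. -/
def BoundedNonFullRange : Prop :=
  ∃ γ, S.IsFull γ ∧ ∀ β, ¬ S.IsFull β → (interior (S.K β)).Nonempty →
    ∀ e ∈ frontier (S.K β), ∀ (k : ℕ) (v : ℝ),
      Tendsto (S.map^[k]) (𝓝[interior (S.K β)] e) (𝓝 v) → v ∉ interior (S.K γ)

/-- Eventual expansivity: for some `r ≥ 1` the modulus of the derivative of `T^r` is at least some
`c > 1` on the interior of every cylinder of rank `r` (the points `x` for which `x`, `T x`, …,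
`T^(r-1) x` are all interior to rank one cylinders). -/
def EventuallyExpansive : Prop :=
  ∃ r : ℕ, 1 ≤ r ∧ ∃ c : ℝ, 1 < c ∧
    ∀ x : ℝ, (∀ i < r, ∃ β, S.map^[i] x ∈ interior (S.K β)) → c ≤ |deriv (S.map^[r]) x|

end PiecewiseMobius

/-- The normalization `μ'` of `μ` to a probability measure on `Ω`. -/
noncomputable def normalizedMeasure (Ω : Set (ℝ × ℝ)) : Measure (ℝ × ℝ) :=
  (planarMeasure Ω)⁻¹ • planarMeasure.restrict Ω

/-- The marginal measure `ν` of `μ'` on the line. -/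
noncomputable def marginalMeasure (Ω : Set (ℝ × ℝ)) : Measure ℝ :=
  (normalizedMeasure Ω).map Prod.fst

/-- The invertible map `(s₀, s₁, s₂, …) ↦ (S s₀, s₀, s₁, …)` on sequences with `S sₙ₊₁ = sₙ`. -/
def pastShift {Y : Type*} (S : Y → Y) (s : ℕ → Y) : ℕ → Y
  | 0 => S (s 0)
  | n + 1 => s n

/-- `m` is the measure of the inverse limit of the system `(Y, S, ν)`: it is concentrated on the
sequences with `S sₙ₊₁ = sₙ` and all of its coordinate marginals are `ν`. -/
structure IsInverseLimitMeasure {Y : Type*} [MeasurableSpace Y] (S : Y → Y) (ν : Measure Y)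
    (m : Measure (ℕ → Y)) : Prop where
  backward : ∀ᵐ s ∂m, ∀ n, S (s (n + 1)) = s n
  marginal : ∀ n, m.map (fun s => s n) = ν

/-- The system `(X, F, μ)` with the factor map `π : X → Y` is the natural extension of `(Y, S, ν)`:
it is isomorphic modulo null sets, by an isomorphism `φ` with inverse `ψ`, to the inverse limit of
`(Y, S, ν)`, in such a way that `π` corresponds to the projection to the coordinate `0`. -/
def IsNaturalExtension {X Y : Type*} [MeasurableSpace X] [MeasurableSpace Y]
    (F : X → X) (μ : Measure X) (π : X → Y) (S : Y → Y) (ν : Measure Y) : Prop :=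
  ∃ m : Measure (ℕ → Y), IsInverseLimitMeasure S ν m ∧
    ∃ (φ : X → ℕ → Y) (ψ : (ℕ → Y) → X),
      MeasurePreserving φ μ m ∧ MeasurePreserving ψ m μ ∧
      (∀ᵐ x ∂μ, ψ (φ x) = x) ∧ (∀ᵐ s ∂m, φ (ψ s) = s) ∧
      (∀ᵐ x ∂μ, φ (F x) = pastShift S (φ x)) ∧ ∀ᵐ x ∂μ, φ x 0 = π x

/-! The matrix `R A R⁻¹` is the transpose of the adjugate of `A`, so `1 + x y` is multiplied by `det
A` over the two denominators. Hence `𝒯` preserves `μ`, and the marginal `ν` is `T`-invariant with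
density `h(x)` proportional to the integral of `(1 + x y)⁻²` over the fiber of `Ω`. Hypotheses (a)
and (b) make `h` positive on `I` and bounded above, but a positive lower bound is not immediate,
since fibers may reach far out.

Invariance says that `h(u)` is the sum of `h(x) / |T'(x)|` over the preimages `x` of `u`. No single
cylinder can supply the whole sum: a cylinder other than the full one of (c) leaves out the preimage
in that full one, and the full one of (c) contracts fibers, so its image cannot fill `Ω`
(`exists_isInvariantDensity`). Thus `h < |T'| · h ∘ T` almost everywhere, and Poincaré recurrence
upgrades this strict inequality to `|(T^n)'| → ∞` along almost every orbit (`ae_tendsto_jacIter`).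

By (d) the image of any cylinder of rank `n` contains the interior of the avoided full cylinder `K
γ` or misses it. Each visit to `K γ` therefore gives a branch onto the interior of `I`
(`exists_full_branch`). Möbius maps have bounded distortion away from their poles, so a Lebesgue
density point argument yields ergodicity (`volume_diff_eq_zero_of_invariant`).

Ergodicity then makes the gain uniform. The preimages of `A ⊆ K γ` outside `K γ` have Lebesgue
measure at least a constant times `|A|` at every time (`measure_mul_volume_le`); averaging over time
transfers this bound to `ν` (`Ergodic.le_measureReal_mul`). It follows that `h` is bounded below and
that two steps expand by a definite factor relative to `h` (`exists_ae_le_mul_jacIter_two`), hence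
eventual expansivity.

For the natural extension, in the fiber coordinate `z = y / (1 + x y)` the map `𝒯` is affine with
slope `± 1 / |T'(x)|`, and `z` is bounded on `Ω` by (b). Two points with the same past in the first
coordinate have `z`-distances that grow geometrically backwards yet stay bounded, so they coincide
(`eq_of_history_eq`). The history map is thus injective off a null set, and ergodicity passes to the
extension by approximation with cylinder sets (`ergodic_of_history`). -/

/-- The denominator of the Möbius action. -/
def mobiusDenom (A : Matrix (Fin 2) (Fin 2) ℝ) (x : ℝ) : ℝ := A 1 0 * x + A 1 1

/-- The modulus of the derivative of the Möbius action. -/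
noncomputable def mobiusJac (A : Matrix (Fin 2) (Fin 2) ℝ) (x : ℝ) : ℝ :=
  |A.det| / mobiusDenom A x ^ 2

/-! ### Möbius maps of the line: composition, inverse, distortion -/

section Mobius

variable {A B : Matrix (Fin 2) (Fin 2) ℝ} {x y : ℝ}

theorem mobius_eq (A : Matrix (Fin 2) (Fin 2) ℝ) (x : ℝ) :
    mobius A x = (A 0 0 * x + A 0 1) / mobiusDenom A x := rfl

theorem continuous_mobiusDenom (A : Matrix (Fin 2) (Fin 2) ℝ) : Continuous (mobiusDenom A) := by
  unfold mobiusDenom; fun_prop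

theorem measurable_mobius (A : Matrix (Fin 2) (Fin 2) ℝ) : Measurable (mobius A) := by
  unfold mobius; fun_prop

theorem measurable_mobiusJac (A : Matrix (Fin 2) (Fin 2) ℝ) : Measurable (mobiusJac A) := by
  unfold mobiusJac mobiusDenom; fun_prop

theorem mobiusJac_pos (hA : A.det ≠ 0) (hx : mobiusDenom A x ≠ 0) : 0 < mobiusJac A x := by
  unfold mobiusJac; positivity

theorem mobius_mul_denom (hx : mobiusDenom A x ≠ 0) :
    mobius A x * mobiusDenom A x = A 0 0 * x + A 0 1 := by
  rw [mobius_eq, div_mul_cancel₀ _ hx]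

theorem hasDerivAt_mobius (hx : mobiusDenom A x ≠ 0) :
    HasDerivAt (mobius A) (A.det / mobiusDenom A x ^ 2) x := by
  have h1 : HasDerivAt (fun x => A 0 0 * x + A 0 1) (A 0 0) x := by
    simpa using ((hasDerivAt_id x).const_mul (A 0 0)).add_const (A 0 1)
  have h2 : HasDerivAt (fun x => A 1 0 * x + A 1 1) (A 1 0) x := by
    simpa using ((hasDerivAt_id x).const_mul (A 1 0)).add_const (A 1 1)
  refine (h1.div h2 hx).congr_deriv ?_
  rw [Matrix.det_fin_two, mobiusDenom]
  congr 1
  ring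

theorem abs_deriv_mobius (hx : mobiusDenom A x ≠ 0) : |deriv (mobius A) x| = mobiusJac A x := by
  rw [(hasDerivAt_mobius hx).deriv, abs_div, mobiusJac, abs_of_nonneg (sq_nonneg (mobiusDenom A x))]

theorem continuousAt_mobius (hx : mobiusDenom A x ≠ 0) : ContinuousAt (mobius A) x :=
  (hasDerivAt_mobius hx).continuousAt

theorem continuousOn_mobius {s : Set ℝ} (hs : ∀ x ∈ s, mobiusDenom A x ≠ 0) :
    ContinuousOn (mobius A) s :=
  fun x hx => (continuousAt_mobius (hs x hx)).continuousWithinAt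

theorem mobiusDenom_mul (hx : mobiusDenom B x ≠ 0) :
    mobiusDenom (A * B) x = mobiusDenom A (mobius B x) * mobiusDenom B x := by
  have := mobius_mul_denom hx
  simp only [mobiusDenom, Matrix.mul_apply, Fin.sum_univ_two] at *
  linear_combination (-A 1 0) * this

theorem mobius_mul (hx : mobiusDenom B x ≠ 0) :
    mobius (A * B) x = mobius A (mobius B x) := by
  rw [mobius_eq, mobiusDenom_mul hx, mobius_eq A]
  have := mobius_mul_denom hx
  rw [show (A * B) 0 0 * x + (A * B) 0 1 = (A 0 0 * mobius B x + A 0 1) * mobiusDenom B x by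
    simp only [mobiusDenom, Matrix.mul_apply, Fin.sum_univ_two] at *
    linear_combination (-A 0 0) * this]
  rw [mul_div_mul_right _ _ hx]

theorem mobiusJac_mul (hx : mobiusDenom B x ≠ 0) :
    mobiusJac (A * B) x = mobiusJac A (mobius B x) * mobiusJac B x := by
  rw [mobiusJac, mobiusDenom_mul hx, Matrix.det_mul, abs_mul, mobiusJac, mobiusJac, mul_pow,
    mul_div_mul_comm]

theorem mobiusDenom_adjugate (hx : mobiusDenom A x ≠ 0) :
    mobiusDenom A.adjugate (mobius A x) = A.det / mobiusDenom A x := by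
  rw [eq_div_iff hx]
  have := mobius_mul_denom hx
  simp only [mobiusDenom, Matrix.adjugate_fin_two, Matrix.det_fin_two, Matrix.of_apply,
    Matrix.cons_val', Matrix.cons_val_zero, Matrix.cons_val_one] at *
  linear_combination (-A 1 0) * this

theorem mobiusDenom_adjugate_ne (hA : A.det ≠ 0) (hx : mobiusDenom A x ≠ 0) :
    mobiusDenom A.adjugate (mobius A x) ≠ 0 := by
  rw [mobiusDenom_adjugate hx]; exact div_ne_zero hA hx

theorem mobius_adjugate (hA : A.det ≠ 0) (hx : mobiusDenom A x ≠ 0) :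
    mobius A.adjugate (mobius A x) = x := by
  rw [mobius_eq, mobiusDenom_adjugate hx, div_eq_iff (div_ne_zero hA hx), mul_div_assoc',
    eq_div_iff hx]
  have := mobius_mul_denom hx
  simp only [mobiusDenom, Matrix.adjugate_fin_two, Matrix.det_fin_two, Matrix.of_apply,
    Matrix.cons_val', Matrix.cons_val_zero, Matrix.cons_val_one] at *
  linear_combination (A 1 1) * this

theorem mobius_injective_of_denom (hA : A.det ≠ 0) (hx : mobiusDenom A x ≠ 0)
    (hy : mobiusDenom A y ≠ 0) (h : mobius A x = mobius A y) : x = y := by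
  rw [← mobius_adjugate hA hx, h, mobius_adjugate hA hy]

theorem injOn_mobius {s : Set ℝ} (hA : A.det ≠ 0) (hs : ∀ x ∈ s, mobiusDenom A x ≠ 0) :
    InjOn (mobius A) s :=
  fun _ hx _ hy h => mobius_injective_of_denom hA (hs _ hx) (hs _ hy) h

theorem det_adjugate_fin_two (A : Matrix (Fin 2) (Fin 2) ℝ) : A.adjugate.det = A.det := by
  simp [Matrix.adjugate_fin_two, Matrix.det_fin_two]; ring

theorem adjugate_adjugate_fin_two (A : Matrix (Fin 2) (Fin 2) ℝ) : A.adjugate.adjugate = A := by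
  ext i j
  fin_cases i <;> fin_cases j <;> simp [Matrix.adjugate_fin_two]

/-- The image of an open set under a Möbius map is open. -/
theorem isOpen_mobius_image {s : Set ℝ} (hA : A.det ≠ 0) (ho : IsOpen s)
    (hs : ∀ x ∈ s, mobiusDenom A x ≠ 0) : IsOpen (mobius A '' s) := by
  rw [isOpen_iff_mem_nhds]
  rintro _ ⟨x, hx, rfl⟩
  have h1 := continuousAt_mobius (mobiusDenom_adjugate_ne hA (hs x hx))
  have h2 : {u | mobiusDenom A.adjugate u ≠ 0} ∈ 𝓝 (mobius A x) :=
    (isOpen_ne_fun (continuous_mobiusDenom _) continuous_const).mem_nhds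
      (mobiusDenom_adjugate_ne hA (hs x hx))
  have h3 := h1.preimage_mem_nhds (t := s)
    (by rw [mobius_adjugate hA (hs x hx)]; exact ho.mem_nhds hx)
  filter_upwards [h2, h3] with u hu1 hu2
  refine ⟨_, hu2, ?_⟩
  have hA' : A.adjugate.det ≠ 0 := by rwa [det_adjugate_fin_two]
  have := mobius_adjugate hA' hu1
  rwa [adjugate_adjugate_fin_two] at this

theorem map_nhds_mobius (hA : A.det ≠ 0) (hx : mobiusDenom A x ≠ 0) {s : Set ℝ} (hs : s ∈ 𝓝 x) :
    mobius A '' s ∈ 𝓝 (mobius A x) := by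
  obtain ⟨t, hts, hto, hxt⟩ := mem_nhds_iff.1 hs
  have hd : IsOpen {u | mobiusDenom A u ≠ 0} :=
    isOpen_ne_fun (continuous_mobiusDenom _) continuous_const
  refine mem_of_superset ((isOpen_mobius_image (s := t ∩ {u | mobiusDenom A u ≠ 0}) hA
    (hto.inter hd) fun u hu => hu.2).mem_nhds ⟨x, ⟨hxt, hx⟩, rfl⟩) ?_
  exact image_mono (inter_subset_left.trans hts)

/-- A Möbius map which stays bounded near a point has no pole there. -/
theorem mobiusDenom_ne_of_bounded (hA : A.det ≠ 0) {l : Filter ℝ} [NeBot l] (hl : l ≤ 𝓝 x) {C : ℝ}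
    (hC : ∀ᶠ u in l, mobiusDenom A u ≠ 0 ∧ |mobius A u| ≤ C) : mobiusDenom A x ≠ 0 := by
  intro h0
  have h1 : Tendsto (fun u => |A 0 0 * u + A 0 1|) l (𝓝 |A 0 0 * x + A 0 1|) := by
    have : Continuous fun u : ℝ => |A 0 0 * u + A 0 1| := by fun_prop
    exact (this.tendsto x).mono_left hl
  have h2 : Tendsto (fun u => C * |mobiusDenom A u|) l (𝓝 (C * |mobiusDenom A x|)) := by
    have : Continuous fun u : ℝ => C * |mobiusDenom A u| := by
      unfold mobiusDenom; fun_prop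
    exact (this.tendsto x).mono_left hl
  have h3 : |A 0 0 * x + A 0 1| ≤ C * |mobiusDenom A x| := by
    refine le_of_tendsto_of_tendsto h1 h2 ?_
    filter_upwards [hC] with u hu
    rw [← mobius_mul_denom hu.1, abs_mul]
    gcongr
    exact hu.2
  rw [h0, abs_zero, mul_zero] at h3
  -- Numerator and denominator now vanish together, so `(x, 1)` lies in the kernel of `A`, against
  -- `det A ≠ 0`.
  have h4 : A 0 0 * x + A 0 1 = 0 := abs_nonpos_iff.1 h3
  rw [mobiusDenom] at h0
  apply hA
  rw [Matrix.det_fin_two]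
  by_cases h00 : A 0 0 = 0 ∧ A 1 0 = 0
  · rw [h00.1, h00.2]; ring
  · rw [not_and_or] at h00
    rcases h00 with h | h
    · apply mul_left_cancel₀ h
      linear_combination (A 0 0) * (A 0 0) * h0 - (A 0 0) * (A 1 0) * h4
    · apply mul_left_cancel₀ h
      linear_combination (A 0 0) * (A 1 0) * h0 - (A 1 0) * (A 1 0) * h4

theorem lintegral_mobius_image {s : Set ℝ} (hA : A.det ≠ 0) (hm : MeasurableSet s)
    (hs : ∀ x ∈ s, mobiusDenom A x ≠ 0) (f : ℝ → ℝ≥0∞) :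
    ∫⁻ u in mobius A '' s, f u = ∫⁻ x in s, ENNReal.ofReal (mobiusJac A x) * f (mobius A x) := by
  rw [lintegral_image_eq_lintegral_abs_deriv_mul hm
    (fun x hx => (hasDerivAt_mobius (hs x hx)).hasDerivWithinAt) (injOn_mobius hA hs)]
  refine setLIntegral_congr_fun hm fun x hx => ?_
  simp only [mobiusJac, abs_div, abs_of_nonneg (sq_nonneg (mobiusDenom A x))]

theorem volume_mobius_image {s : Set ℝ} (hA : A.det ≠ 0) (hm : MeasurableSet s)
    (hs : ∀ x ∈ s, mobiusDenom A x ≠ 0) :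
    volume (mobius A '' s) = ∫⁻ x in s, ENNReal.ofReal (mobiusJac A x) := by
  have := lintegral_mobius_image hA hm hs 1
  simpa using this

theorem measurableSet_mobius_image {s : Set ℝ} (hA : A.det ≠ 0) (hm : MeasurableSet s)
    (hs : ∀ x ∈ s, mobiusDenom A x ≠ 0) : MeasurableSet (mobius A '' s) :=
  hm.image_of_continuousOn_injOn (continuousOn_mobius hs) (injOn_mobius hA hs)

theorem volume_mobius_image_eq_zero {s : Set ℝ} (hA : A.det ≠ 0) (hm : MeasurableSet s)
    (hs : ∀ x ∈ s, mobiusDenom A x ≠ 0) : volume (mobius A '' s) = 0 ↔ volume s = 0 := by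
  rw [volume_mobius_image hA hm hs, lintegral_eq_zero_iff
    (measurable_mobiusJac A).ennreal_ofReal]
  constructor
  · intro h
    rw [EventuallyEq, ae_restrict_iff' hm] at h
    refine measure_mono_null (fun x hx => ?_) h
    simp only [mem_compl_iff, mem_ofPred_eq, Pi.zero_apply, ENNReal.ofReal_eq_zero, not_le,
      not_forall]
    exact ⟨hx, mobiusJac_pos hA (hs x hx)⟩
  · intro h
    rw [Measure.restrict_eq_zero.2 h]
    exact ae_zero.symm ▸ eventually_bot

/-- The denominator is affine and vanishes only at the pole. A pole at distance at least `d` from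
`x` bounds its slope by `|mobiusDenom A x| / d`. -/
theorem abs_mobiusDenom_le {d Λ : ℝ} (hd : 0 < d)
    (hx : ∀ t ∈ Ioo (x - d) (x + d), mobiusDenom A t ≠ 0) (hxy : |y - x| ≤ Λ) :
    |mobiusDenom A y| ≤ (1 + Λ / d) * |mobiusDenom A x| := by
  have h1 : |A 1 0| * d ≤ |mobiusDenom A x| := by
    by_contra! h
    have hc : A 1 0 ≠ 0 := by
      intro h0
      rw [h0, abs_zero, zero_mul] at h
      exact absurd h (not_lt.2 (abs_nonneg _))
    have hc' : 0 < |A 1 0| := abs_pos.2 hc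
    have h2 : |mobiusDenom A x / A 1 0| < d := by
      rw [abs_div, div_lt_iff₀ hc']; linarith
    rw [abs_lt] at h2
    refine hx (x - mobiusDenom A x / A 1 0) ⟨by linarith, by linarith⟩ ?_
    rw [mobiusDenom, mobiusDenom]
    field_simp
    ring
  have h2 : mobiusDenom A y = mobiusDenom A x + A 1 0 * (y - x) := by
    rw [mobiusDenom, mobiusDenom]; ring
  have h3 : |A 1 0| ≤ |mobiusDenom A x| / d := by rwa [le_div_iff₀ hd]
  calc |mobiusDenom A y| ≤ |mobiusDenom A x| + |A 1 0| * |y - x| := by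
        rw [h2, ← abs_mul]; exact abs_add_le _ _
    _ ≤ |mobiusDenom A x| + |mobiusDenom A x| / d * Λ := by gcongr
    _ = (1 + Λ / d) * |mobiusDenom A x| := by ring

/-- The estimate is one-sided: only `x` must keep away from the pole. As `y` approaches the pole its
derivative grows, which helps. -/
theorem mobiusJac_le_mul {d Λ : ℝ} (hd : 0 < d)
    (hx : ∀ t ∈ Ioo (x - d) (x + d), mobiusDenom A t ≠ 0) (hy : mobiusDenom A y ≠ 0)
    (hxy : |y - x| ≤ Λ) : mobiusJac A x ≤ (1 + Λ / d) ^ 2 * mobiusJac A y := by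
  have h1 := abs_mobiusDenom_le hd hx hxy
  have h2 : mobiusDenom A x ≠ 0 := hx x ⟨by linarith, by linarith⟩
  have h3 : mobiusDenom A y ^ 2 ≤ (1 + Λ / d) ^ 2 * mobiusDenom A x ^ 2 := by
    rw [← mul_pow, ← sq_abs, ← sq_abs ((1 + Λ / d) * _), abs_mul]
    gcongr
    exact h1.trans (by gcongr; exact le_abs_self _)
  rw [mobiusJac, mobiusJac, mul_div_assoc', div_le_div_iff₀ (by positivity) (by positivity)]
  calc |A.det| * mobiusDenom A y ^ 2
      ≤ |A.det| * ((1 + Λ / d) ^ 2 * mobiusDenom A x ^ 2) := by gcongr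
    _ = _ := by ring

/-- Bounded distortion of Möbius maps, for a set `s` which stays at distance `d` from the pole. -/
theorem volume_mobius_image_mul_le {d Λ : ℝ} {s t : Set ℝ} (hA : A.det ≠ 0) (hd : 0 < d)
    (hs : MeasurableSet s) (ht : MeasurableSet t)
    (hsA : ∀ v ∈ s, ∀ w ∈ Ioo (v - d) (v + d), mobiusDenom A w ≠ 0)
    (htA : ∀ u ∈ t, mobiusDenom A u ≠ 0) (hst : ∀ v ∈ s, ∀ u ∈ t, |u - v| ≤ Λ) :
    volume (mobius A '' s) * volume t ≤
      ENNReal.ofReal ((1 + Λ / d) ^ 2) * volume (mobius A '' t) * volume s := by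
  rw [volume_mobius_image hA hs fun v hv => hsA v hv v ⟨by linarith, by linarith⟩,
    volume_mobius_image hA ht htA,
    ← lintegral_mul_const _ (measurable_mobiusJac A).ennreal_ofReal, ← setLIntegral_const]
  refine setLIntegral_mono measurable_const fun v hv => ?_
  rw [← setLIntegral_const, ← lintegral_const_mul _ (measurable_mobiusJac A).ennreal_ofReal]
  refine setLIntegral_mono ((measurable_mobiusJac A).ennreal_ofReal.const_mul _) fun u hu => ?_
  rw [← ENNReal.ofReal_mul (by positivity)]
  exact ENNReal.ofReal_le_ofReal (mobiusJac_le_mul hd (hsA v hv) (htA u hu) (hst v hv u hu))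

end Mobius

/-! ### Elementary properties of the interval map -/

namespace PiecewiseMobius

variable {ι : Type*} (S : PiecewiseMobius ι)

open Classical in
/-- The modulus of the derivative of the interval map. -/
noncomputable def jac (x : ℝ) : ℝ :=
  if h : ∃ β, x ∈ S.K β then mobiusJac (S.M h.choose) x else 1

variable {S} {β γ : ι} {x : ℝ}

theorem eq_of_mem (hβ : x ∈ S.K β) (hγ : x ∈ S.K γ) : β = γ := by
  by_contra h
  exact (S.disjoint_K h).le_bot ⟨hβ, hγ⟩

theorem choose_eq (h : ∃ β, x ∈ S.K β) (hβ : x ∈ S.K β) : h.choose = β :=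
  eq_of_mem h.choose_spec hβ

theorem map_eq (hx : x ∈ S.K β) : S.map x = mobius (S.M β) x := by
  have h : ∃ β, x ∈ S.K β := ⟨β, hx⟩
  rw [map, dif_pos h, choose_eq h hx]

theorem jac_eq (hx : x ∈ S.K β) : S.jac x = mobiusJac (S.M β) x := by
  have h : ∃ β, x ∈ S.K β := ⟨β, hx⟩
  rw [jac, dif_pos h, choose_eq h hx]

theorem planarMap_eq {p : ℝ × ℝ} (hp : p.1 ∈ S.K β) : S.planarMap p = planarMobius (S.M β) p := by
  have h : ∃ β, p.1 ∈ S.K β := ⟨β, hp⟩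
  rw [planarMap, dif_pos h, choose_eq h hp]

theorem fst_planarMap (p : ℝ × ℝ) : (S.planarMap p).1 = S.map p.1 := by
  by_cases h : ∃ β, p.1 ∈ S.K β
  · obtain ⟨β, hβ⟩ := h
    rw [planarMap_eq hβ, map_eq hβ, planarMobius]
  · rw [planarMap, dif_neg h, map, dif_neg h]

theorem mobiusDenom_ne (hx : x ∈ S.K β) : mobiusDenom (S.M β) x ≠ 0 := S.denom_ne_zero β x hx

theorem K_subset_I (β : ι) : S.K β ⊆ S.I := by
  rw [← S.iUnion_K]; exact subset_iUnion _ β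

theorem exists_mem_K (hx : x ∈ S.I) : ∃ β, x ∈ S.K β := by
  rw [← S.iUnion_K] at hx; exact mem_iUnion.1 hx

theorem map_mem_I (hx : x ∈ S.I) : S.map x ∈ S.I := by
  obtain ⟨β, hβ⟩ := exists_mem_K hx
  rw [map_eq hβ]; exact S.mapsTo_I β hβ

theorem jac_pos (x : ℝ) : 0 < S.jac x := by
  by_cases h : ∃ β, x ∈ S.K β
  · obtain ⟨β, hβ⟩ := h
    rw [jac_eq hβ]; exact mobiusJac_pos (S.det_ne_zero β) (mobiusDenom_ne hβ)
  · rw [jac, dif_neg h]; exact one_pos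

theorem measurableSet_K (β : ι) : MeasurableSet (S.K β) := (S.ordConnected_K β).measurableSet

theorem measurableSet_I (S : PiecewiseMobius ι) : MeasurableSet S.I := S.ordConnected_I.measurableSet

theorem map_image {s : Set ℝ} (hs : s ⊆ S.K β) : S.map '' s = mobius (S.M β) '' s :=
  image_congr fun _ hx => map_eq (hs hx)

theorem injOn_map (β : ι) : InjOn S.map (S.K β) := fun x hx y hy h => by
  rw [map_eq hx, map_eq hy] at h
  exact mobius_injective_of_denom (S.det_ne_zero β) (mobiusDenom_ne hx) (mobiusDenom_ne hy) h

theorem measurableSet_map_image {s : Set ℝ} (hs : s ⊆ S.K β) (hm : MeasurableSet s) :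
    MeasurableSet (S.map '' s) := by
  rw [map_image hs]
  exact measurableSet_mobius_image (S.det_ne_zero β) hm fun x hx => mobiusDenom_ne (hs hx)

theorem volume_map_image_eq_zero {s : Set ℝ} (hs : s ⊆ S.K β) (hm : MeasurableSet s) :
    volume (S.map '' s) = 0 ↔ volume s = 0 := by
  rw [map_image hs]
  exact volume_mobius_image_eq_zero (S.det_ne_zero β) hm fun x hx => mobiusDenom_ne (hs hx)

theorem lintegral_map_image {s : Set ℝ} (hs : s ⊆ S.K β) (hm : MeasurableSet s)
    (f : ℝ → ℝ≥0∞) :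
    ∫⁻ u in S.map '' s, f u = ∫⁻ x in s, ENNReal.ofReal (S.jac x) * f (S.map x) := by
  rw [map_image hs,
    lintegral_mobius_image (S.det_ne_zero β) hm (fun x hx => mobiusDenom_ne (hs hx))]
  refine setLIntegral_congr_fun hm fun x hx => ?_
  simp only [map_eq (hs hx), jac_eq (hs hx)]

/-- A function which is measurable on each cylinder and off the interval is measurable. -/
theorem measurable_of_cylinders [Countable ι] {X Y : Type*} [MeasurableSpace X] [MeasurableSpace Y]
    {f g : X → Y} {k : X → ℝ} {F : ι → X → Y} (hk : Measurable k) (hg : Measurable g)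
    (hF : ∀ β, Measurable (F β))
    (h1 : ∀ β x, k x ∈ S.K β → f x = F β x) (h2 : ∀ x, (¬ ∃ β, k x ∈ S.K β) → f x = g x) :
    Measurable f := by
  intro E hE
  have : f ⁻¹' E = (⋃ β, (k ⁻¹' S.K β) ∩ F β ⁻¹' E) ∪ ((k ⁻¹' S.I)ᶜ ∩ g ⁻¹' E) := by
    ext x
    by_cases h : ∃ β, k x ∈ S.K β
    · obtain ⟨β, hβ⟩ := h
      have hI := K_subset_I β hβ
      simp only [mem_preimage, mem_union, mem_iUnion, mem_inter_iff, mem_compl_iff, hI,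
        not_true_eq_false, false_and, or_false]
      constructor
      · intro hx
        exact ⟨β, hβ, by rwa [← h1 β x hβ]⟩
      · rintro ⟨γ, hγ, hx⟩
        rwa [h1 γ x hγ]
    · have hI : k x ∉ S.I := fun hx => h (exists_mem_K hx)
      simp only [mem_preimage, mem_union, mem_iUnion, mem_inter_iff, mem_compl_iff, hI,
        not_false_eq_true, true_and, h2 x h]
      constructor
      · exact Or.inr
      · rintro (⟨γ, hγ, -⟩ | hx)
        · exact absurd ⟨γ, hγ⟩ h
        · exact hx
  rw [this]
  refine (MeasurableSet.iUnion fun β => ?_).union ?_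
  · exact (hk (measurableSet_K β)).inter (hF β hE)
  · exact (hk (measurableSet_I S)).compl.inter (hg hE)

theorem measurable_map [Countable ι] (S : PiecewiseMobius ι) : Measurable S.map :=
  measurable_of_cylinders (S := S) (k := id) (g := id) (F := fun β => mobius (S.M β)) measurable_id
    measurable_id (fun _ => measurable_mobius _) (fun _ _ h => map_eq h)
    fun _ h => dif_neg h

theorem measurable_jac [Countable ι] (S : PiecewiseMobius ι) : Measurable S.jac :=
  measurable_of_cylinders (S := S) (k := id) (g := fun _ => 1) (F := fun β => mobiusJac (S.M β))
    measurable_id measurable_const (fun _ => measurable_mobiusJac _) (fun _ _ h => jac_eq h)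
    fun _ h => dif_neg h

theorem measurable_planarMap [Countable ι] (S : PiecewiseMobius ι) : Measurable S.planarMap := by
  refine measurable_of_cylinders (S := S) (k := Prod.fst) (g := id)
    (F := fun β => planarMobius (S.M β)) measurable_fst measurable_id (fun β => ?_)
    (fun _ _ h => planarMap_eq h) fun x h => by rw [planarMap, dif_neg h]; rfl
  exact ((measurable_mobius _).comp measurable_fst).prodMk
    ((measurable_mobius _).comp measurable_snd)

theorem volume_frontier_eq_zero {s : Set ℝ} (hs : s.OrdConnected) : volume (frontier s) = 0 :=
  hs.convex.addHaar_frontier _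

/-- Almost every point of the interval is interior to a cylinder. -/
theorem volume_I_diff_interior [Countable ι] (S : PiecewiseMobius ι) :
    volume (S.I \ ⋃ β, interior (S.K β)) = 0 := by
  refine measure_mono_null (t := ⋃ β, frontier (S.K β)) ?_
    (measure_iUnion_null fun β => volume_frontier_eq_zero (S.ordConnected_K β))
  rintro x ⟨hx, hx'⟩
  obtain ⟨β, hβ⟩ := exists_mem_K hx
  exact mem_iUnion.2 ⟨β, subset_closure hβ, fun h => hx' (mem_iUnion.2 ⟨β, h⟩)⟩

theorem map_mem_interior_I (hx : x ∈ interior (S.K β)) : S.map x ∈ interior S.I := by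
  rw [mem_interior_iff_mem_nhds, map_eq (interior_subset hx)]
  refine mem_of_superset (map_nhds_mobius (S.det_ne_zero β) (mobiusDenom_ne (interior_subset hx))
    (mem_interior_iff_mem_nhds.1 hx)) ?_
  exact (S.mapsTo_I β).image_subset

/-- A point whose image under the Möbius map of a full cylinder is interior to `I` is interior to
the cylinder. -/
theorem mem_interior_of_isFull (hβ : S.IsFull β) (hd : mobiusDenom (S.M β) x ≠ 0)
    (hx : mobius (S.M β) x ∈ interior S.I) : x ∈ interior (S.K β) := by
  rw [mem_interior_iff_mem_nhds]
  have h1 := (continuousAt_mobius hd).preimage_mem_nhds (isOpen_interior.mem_nhds hx)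
  have h2 : {u | mobiusDenom (S.M β) u ≠ 0} ∈ 𝓝 x :=
    (isOpen_ne_fun (continuous_mobiusDenom _) continuous_const).mem_nhds hd
  filter_upwards [h1, h2] with u hu1 hu2
  obtain ⟨t, ht, htu⟩ := hβ hu1
  rw [map_eq ht] at htu
  rwa [← mobius_injective_of_denom (S.det_ne_zero β) (mobiusDenom_ne ht) hu2 htu]

theorem image_interior_of_isFull (hβ : S.IsFull β) :
    S.map '' interior (S.K β) = interior S.I := by
  refine subset_antisymm (image_subset_iff.2 fun x hx => map_mem_interior_I hx) fun u hu => ?_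
  obtain ⟨t, ht, rfl⟩ := hβ hu
  refine ⟨t, mem_interior_of_isFull hβ (mobiusDenom_ne ht) ?_, rfl⟩
  rwa [map_eq ht] at hu

theorem nonempty_interior_of_isFull (hβ : S.IsFull β) : (interior (S.K β)).Nonempty := by
  have := S.nondegenerate_I
  rw [← image_interior_of_isFull hβ] at this
  exact this.of_image

theorem bounded_I (hI : volume S.I < ⊤) : ∃ C : ℝ, 0 < C ∧ ∀ x ∈ S.I, |x| ≤ C := by
  obtain ⟨x₀, hx₀⟩ := S.nondegenerate_I
  have hx₀ := interior_subset hx₀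
  have key : ∀ x ∈ S.I, |x - x₀| ≤ (volume S.I).toReal := by
    intro x hx
    have h : uIcc x₀ x ⊆ S.I := S.ordConnected_I.uIcc_subset hx₀ hx
    have h2 := measure_mono (μ := volume) h
    rw [Real.volume_interval] at h2
    exact (ENNReal.ofReal_le_iff_le_toReal hI.ne).1 h2
  refine ⟨(volume S.I).toReal + |x₀| + 1, by positivity, fun x hx => ?_⟩
  have := abs_add_le (x - x₀) x₀
  rw [sub_add_cancel] at this
  linarith [key x hx]

end PiecewiseMobius

/-! ### Branches of the iterates and the endpoints of their images -/

namespace PiecewiseMobius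

variable {ι : Type*} (S : PiecewiseMobius ι)

/-- The modulus of the derivative of the `n`-th iterate, by the chain rule. -/
noncomputable def jacIter (n : ℕ) (x : ℝ) : ℝ := ∏ i ∈ Finset.range n, S.jac (S.map^[i] x)

/-- The open cylinder of rank `n` with itinerary `w`. -/
def openCylinder {n : ℕ} (w : Fin n → ι) : Set ℝ :=
  {x | x ∈ interior S.I ∧ ∀ i : Fin n, S.map^[i] x ∈ interior (S.K (w i))}

/-- On the open interval `J` the `n`-th iterate of the map is the Möbius map of `A`. -/
structure IsBranch (n : ℕ) (J : Set ℝ) (A : Matrix (Fin 2) (Fin 2) ℝ) : Prop where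
  isOpen : IsOpen J
  ordConnected : J.OrdConnected
  subset : J ⊆ interior S.I
  det_ne : A.det ≠ 0
  denom_ne : ∀ x ∈ J, mobiusDenom A x ≠ 0
  iterate_eq : ∀ x ∈ J, S.map^[n] x = mobius A x
  jacIter_eq : ∀ x ∈ J, S.jacIter n x = mobiusJac A x

/-- The points in the orbits of the endpoints of non-full cylinders, and the endpoints of `I`. -/
def IsExceptional (v : ℝ) : Prop :=
  v ∈ frontier S.I ∨ ∃ β, ¬ S.IsFull β ∧ (interior (S.K β)).Nonempty ∧
    ∃ e ∈ frontier (S.K β), ∃ k : ℕ, Tendsto (S.map^[k]) (𝓝[interior (S.K β)] e) (𝓝 v)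

variable {S} {β γ : ι} {x : ℝ} {n : ℕ} {J : Set ℝ} {A : Matrix (Fin 2) (Fin 2) ℝ}

theorem jacIter_pos (n : ℕ) (x : ℝ) : 0 < S.jacIter n x := Finset.prod_pos fun _ _ => jac_pos _

theorem jacIter_succ (n : ℕ) (x : ℝ) :
    S.jacIter (n + 1) x = S.jac (S.map^[n] x) * S.jacIter n x := by
  rw [jacIter, Finset.prod_range_succ, mul_comm]; rfl

theorem jacIter_add (m n : ℕ) (x : ℝ) :
    S.jacIter (m + n) x = S.jacIter m x * S.jacIter n (S.map^[m] x) := by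
  rw [jacIter, Finset.prod_range_add]
  congr 1
  refine Finset.prod_congr rfl fun i _ => ?_
  rw [add_comm, Function.iterate_add_apply]

theorem ordConnected_interior {s : Set ℝ} (hs : s.OrdConnected) : (interior s).OrdConnected :=
  hs.convex.interior.ordConnected

theorem isBranch_zero : S.IsBranch 0 (interior S.I) 1 where
  isOpen := isOpen_interior
  ordConnected := ordConnected_interior S.ordConnected_I
  subset := subset_rfl
  det_ne := by simp
  denom_ne := by simp [mobiusDenom]
  iterate_eq := by simp [mobius]
  jacIter_eq := by simp [mobiusJac, mobiusDenom, jacIter]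

namespace IsBranch

theorem isOpen_image (h : S.IsBranch n J A) : IsOpen (mobius A '' J) :=
  isOpen_mobius_image h.det_ne h.isOpen h.denom_ne

theorem ordConnected_image (h : S.IsBranch n J A) : (mobius A '' J).OrdConnected :=
  (h.ordConnected.isPreconnected.image _ (continuousOn_mobius h.denom_ne)).ordConnected

theorem denom_adjugate_ne (h : S.IsBranch n J A) :
    ∀ u ∈ mobius A '' J, mobiusDenom A.adjugate u ≠ 0 := by
  rintro _ ⟨x, hx, rfl⟩
  exact mobiusDenom_adjugate_ne h.det_ne (h.denom_ne x hx)

theorem inter_preimage_eq (h : S.IsBranch n J A) (U : Set ℝ) :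
    J ∩ S.map^[n] ⁻¹' U = mobius A.adjugate '' (mobius A '' J ∩ U) := by
  ext x
  constructor
  · rintro ⟨hx, hxU⟩
    rw [mem_preimage, h.iterate_eq x hx] at hxU
    exact ⟨_, ⟨⟨x, hx, rfl⟩, hxU⟩, mobius_adjugate h.det_ne (h.denom_ne x hx)⟩
  · rintro ⟨_, ⟨⟨x, hx, rfl⟩, hxU⟩, rfl⟩
    rw [mobius_adjugate h.det_ne (h.denom_ne x hx)]
    refine ⟨hx, ?_⟩
    rwa [mem_preimage, h.iterate_eq x hx]

/-- The inverse branch, on a part of the image. -/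
theorem inter_preimage_eq_image (h : S.IsBranch n J A) {U : Set ℝ} (hU : U ⊆ mobius A '' J) :
    J ∩ S.map^[n] ⁻¹' U = mobius A.adjugate '' U := by
  rw [h.inter_preimage_eq, inter_eq_right.2 hU]

theorem restrict (h : S.IsBranch n J A) {U : Set ℝ} (hU : IsOpen U) (hU' : U.OrdConnected) :
    S.IsBranch n (J ∩ S.map^[n] ⁻¹' U) A where
  isOpen := by
    rw [h.inter_preimage_eq]
    refine isOpen_mobius_image ?_ (h.isOpen_image.inter hU) fun u hu => h.denom_adjugate_ne u hu.1
    rw [det_adjugate_fin_two]; exact h.det_ne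
  ordConnected := by
    rw [h.inter_preimage_eq]
    exact ((h.ordConnected_image.inter hU').isPreconnected.image _
      (continuousOn_mobius fun u hu => h.denom_adjugate_ne u hu.1)).ordConnected
  subset := inter_subset_left.trans h.subset
  det_ne := h.det_ne
  denom_ne x hx := h.denom_ne x hx.1
  iterate_eq x hx := h.iterate_eq x hx.1
  jacIter_eq x hx := h.jacIter_eq x hx.1

theorem succ (h : S.IsBranch n J A) (β : ι) :
    S.IsBranch (n + 1) (J ∩ S.map^[n] ⁻¹' interior (S.K β)) (S.M β * A) := by
  have h' := h.restrict isOpen_interior (ordConnected_interior (S.ordConnected_K β))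
  have hK : ∀ x ∈ J ∩ S.map^[n] ⁻¹' interior (S.K β), S.map^[n] x ∈ S.K β :=
    fun x hx => interior_subset hx.2
  refine ⟨h'.isOpen, h'.ordConnected, h'.subset, ?_, ?_, ?_, ?_⟩
  · rw [Matrix.det_mul]; exact mul_ne_zero (S.det_ne_zero β) h.det_ne
  · intro x hx
    rw [mobiusDenom_mul (h'.denom_ne x hx), ← h'.iterate_eq x hx]
    exact mul_ne_zero (mobiusDenom_ne (hK x hx)) (h'.denom_ne x hx)
  · intro x hx
    rw [mobius_mul (h'.denom_ne x hx), ← h'.iterate_eq x hx, Function.iterate_succ_apply',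
      map_eq (hK x hx)]
  · intro x hx
    rw [mobiusJac_mul (h'.denom_ne x hx), ← h'.iterate_eq x hx, jacIter_succ, jac_eq (hK x hx),
      h'.jacIter_eq x hx]

theorem image_succ (h : S.IsBranch n J A) (β : ι) :
    mobius (S.M β * A) '' (J ∩ S.map^[n] ⁻¹' interior (S.K β)) =
      mobius (S.M β) '' (mobius A '' J ∩ interior (S.K β)) := by
  ext u
  constructor
  · rintro ⟨x, hx, rfl⟩
    have := h.iterate_eq x hx.1
    refine ⟨mobius A x, ⟨⟨x, hx.1, rfl⟩, ?_⟩, (mobius_mul (h.denom_ne x hx.1)).symm⟩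
    rw [← this]; exact hx.2
  · rintro ⟨_, ⟨⟨x, hx, rfl⟩, hxK⟩, rfl⟩
    refine ⟨x, ⟨hx, ?_⟩, mobius_mul (h.denom_ne x hx)⟩
    rwa [mem_preimage, h.iterate_eq x hx]

end IsBranch

/-- The endpoints of the image of an open cylinder are exceptional. -/
theorem isExceptional_of_mem_frontier (hI : volume S.I < ⊤) {V : Set ℝ} (hV : IsOpen V)
    (hE : ∀ v ∈ frontier V, S.IsExceptional v) (β : ι) :
    ∀ u ∈ frontier (mobius (S.M β) '' (V ∩ interior (S.K β))), S.IsExceptional u := by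
  intro u hu
  obtain ⟨C, -, hC⟩ := bounded_I hI
  set W := V ∩ interior (S.K β) with hW
  have hWK : W ⊆ S.K β := inter_subset_right.trans interior_subset
  have hopen : IsOpen (mobius (S.M β) '' W) :=
    isOpen_mobius_image (S.det_ne_zero β) (hV.inter isOpen_interior)
      fun x hx => mobiusDenom_ne (hWK hx)
  rw [hopen.frontier_eq] at hu
  obtain ⟨t, ht, htu⟩ := mem_closure_iff_seq_limit.1 hu.1
  choose s hs hst using ht
  have hcomp : IsCompact (Icc (-C) C) := isCompact_Icc
  obtain ⟨a, -, φ, hφ, hsa⟩ := hcomp.tendsto_subseq (x := s)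
    fun n => abs_le.1 (hC _ (K_subset_I β (hWK (hs n))))
  -- The values stay in the bounded interval `I`, which excludes a pole at the limit point `a`.
  have hden : mobiusDenom (S.M β) a ≠ 0 := by
    refine mobiusDenom_ne_of_bounded (S.det_ne_zero β) (l := Filter.map (s ∘ φ) atTop) hsa
      (C := C) ?_
    rw [eventually_map]
    refine Eventually.of_forall fun n => ⟨mobiusDenom_ne (hWK (hs _)), ?_⟩
    exact hC _ (S.mapsTo_I β (hWK (hs _)))
  have hau : mobius (S.M β) a = u := by
    refine tendsto_nhds_unique ((continuousAt_mobius hden).tendsto.comp hsa) ?_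
    refine (htu.comp hφ.tendsto_atTop).congr fun n => ?_
    exact (hst (φ n)).symm
  have haW : a ∉ W := fun h => hu.2 ⟨a, h, hau⟩
  have hacl : a ∈ closure W := mem_closure_of_tendsto hsa (Eventually.of_forall fun n => hs _)
  by_cases haK : a ∈ interior (S.K β)
  · have haV : a ∈ frontier V := by
      rw [hV.frontier_eq]
      exact ⟨closure_mono inter_subset_left hacl, fun h => haW ⟨h, haK⟩⟩
    rcases hE a haV with h | ⟨γ, h1, h2, e, he, k, hk⟩
    · exact absurd (interior_mono (K_subset_I β) haK) h.2
    · refine Or.inr ⟨γ, h1, h2, e, he, k + 1, ?_⟩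
      rw [Function.iterate_succ']
      refine Tendsto.comp ?_ hk
      rw [← hau]
      refine (continuousAt_mobius hden).tendsto.congr' ?_
      filter_upwards [isOpen_interior.mem_nhds haK] with t ht
      exact (map_eq (interior_subset ht)).symm
  · have haK' : a ∈ frontier (S.K β) :=
      ⟨closure_mono hWK hacl, haK⟩
    -- Here `a` is an endpoint of `K β`. If the cylinder is full, `a` is sent to an endpoint of `I`;
    -- otherwise `u` is the first iterate of an endpoint of a non-full cylinder.
    by_cases hfull : S.IsFull β
    · refine Or.inl ⟨closure_mono ?_ hu.1, fun h => haK ?_⟩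
      · exact ((S.mapsTo_I β).mono_left hWK).image_subset
      · exact mem_interior_of_isFull hfull hden (hau ▸ h)
    · refine Or.inr ⟨β, hfull, ⟨s 0, (hs 0).2⟩, a, haK', 1, ?_⟩
      rw [Function.iterate_one, ← hau]
      refine ((continuousAt_mobius hden).tendsto.mono_left nhdsWithin_le_nhds).congr' ?_
      filter_upwards [self_mem_nhdsWithin] with t ht
      exact (map_eq (interior_subset ht)).symm

theorem openCylinder_succ {n : ℕ} (w : Fin (n + 1) → ι) :
    S.openCylinder w = S.openCylinder (fun i : Fin n => w i.castSucc) ∩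
      S.map^[n] ⁻¹' interior (S.K (w (Fin.last n))) := by
  ext x
  simp only [openCylinder, mem_ofPred_eq, mem_inter_iff, mem_preimage, Fin.forall_fin_succ',
    Fin.val_castSucc, Fin.val_last, and_assoc]

/-- Passing from rank `n` to `n + 1` cuts the image with `K β` and applies `M β`. Each new endpoint
comes from an old one or from an endpoint of `K β`, so exceptionality is inherited. -/
theorem exists_isBranch_openCylinder (hI : volume S.I < ⊤) :
    ∀ {n : ℕ} (w : Fin n → ι), ∃ A, S.IsBranch n (S.openCylinder w) A ∧
      ∀ v ∈ frontier (mobius A '' S.openCylinder w), S.IsExceptional v := by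
  intro n
  induction n with
  | zero =>
    intro w
    have : S.openCylinder w = interior S.I := by
      ext x; simp [openCylinder]
    refine ⟨1, by rw [this]; exact isBranch_zero, fun v hv => Or.inl ?_⟩
    have h1 : mobius 1 '' interior S.I = interior S.I := by
      have : mobius (1 : Matrix (Fin 2) (Fin 2) ℝ) = id := by ext; simp [mobius]
      rw [this, image_id]
    rw [this, h1] at hv
    exact frontier_interior_subset hv
  | succ n ih =>
    intro w
    obtain ⟨A, hA, hE⟩ := ih fun i : Fin n => w i.castSucc
    rw [openCylinder_succ]
    refine ⟨_, hA.succ _, ?_⟩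
    rw [hA.image_succ]
    exact isExceptional_of_mem_frontier hI hA.isOpen_image hE _

/-- A cylinder whose interior is avoided by the orbits of the endpoints of non-full cylinders. -/
def IsAvoided (S : PiecewiseMobius ι) (γ : ι) : Prop :=
  ∀ v, S.IsExceptional v → v ∉ interior (S.K γ)

theorem BoundedNonFullRange.exists_isAvoided (h : S.BoundedNonFullRange) :
    ∃ γ, S.IsFull γ ∧ S.IsAvoided γ := by
  obtain ⟨γ, h1, h2⟩ := h
  refine ⟨γ, h1, ?_⟩
  rintro v (hv | ⟨β, h3, h4, e, he, k, hk⟩) hvK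
  · exact hv.2 (interior_mono (K_subset_I γ) hvK)
  · exact h2 β h3 h4 e he k v hk hvK

/-- The image of a cylinder either contains an avoided cylinder or is disjoint from it. -/
theorem subset_or_disjoint_of_isAvoided (hγ : S.IsAvoided γ) {V : Set ℝ} (hV : IsOpen V)
    (hE : ∀ v ∈ frontier V, S.IsExceptional v) :
    interior (S.K γ) ⊆ V ∨ Disjoint (interior (S.K γ)) V := by
  have hpre : IsPreconnected (interior (S.K γ)) :=
    (ordConnected_interior (S.ordConnected_K γ)).isPreconnected
  -- No boundary point of `V` lies in the interior of `K γ`, so connectedness leaves it wholly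
  -- inside or wholly outside `V`.
  have hsub : interior (S.K γ) ⊆ V ∪ (closure V)ᶜ := by
    intro v hv
    by_cases h : v ∈ V
    · exact Or.inl h
    · refine Or.inr fun h' => hγ v (hE v ?_) hv
      rw [hV.frontier_eq]; exact ⟨h', h⟩
  have hdis : Disjoint V (closure V)ᶜ := disjoint_compl_right_iff_subset.2 subset_closure
  rcases hpre.subset_or_subset hV isClosed_closure.isOpen_compl hdis hsub with h | h
  · exact Or.inl h
  · exact Or.inr (disjoint_left.2 fun v hv hvV => h hv (subset_closure hvV))

end PiecewiseMobius

/-! ### Invariant densities, growth of derivatives, full branches -/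

namespace PiecewiseMobius

variable {ι : Type*}

/-- The probability measure `ν` is invariant and has a bounded density `h` which is positive on `I`;
moreover no single cylinder carries the whole preimage of a set of positive measure. -/
structure IsInvariantDensity (S : PiecewiseMobius ι) (ν : Measure ℝ) (h : ℝ → ℝ) (C : ℝ) :
    Prop where
  isProbabilityMeasure : IsProbabilityMeasure ν
  measurable : Measurable h
  pos : ∀ x ∈ S.I, 0 < h x
  eq_zero : ∀ x, x ∉ S.I → h x = 0
  le : ∀ x, h x ≤ C
  eq_withDensity : ν = volume.withDensity fun x => ENNReal.ofReal (h x)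
  measurePreserving : MeasurePreserving S.map ν ν
  preimage_diff_ne_zero : ∀ β A, MeasurableSet A → A ⊆ S.I → volume A ≠ 0 →
    ν (S.map ⁻¹' A \ S.K β) ≠ 0

namespace IsInvariantDensity

variable {S : PiecewiseMobius ι} {ν : Measure ℝ} {h : ℝ → ℝ} {C : ℝ} {β γ : ι}

theorem measurable_ofReal (H : S.IsInvariantDensity ν h C) :
    Measurable fun x => ENNReal.ofReal (h x) := H.measurable.ennreal_ofReal

theorem bound_pos (H : S.IsInvariantDensity ν h C) : 0 < C := by
  obtain ⟨x, hx⟩ := S.nondegenerate_I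
  exact (H.pos x (interior_subset hx)).trans_le (H.le x)

theorem nonneg (H : S.IsInvariantDensity ν h C) (x : ℝ) : 0 ≤ h x := by
  by_cases hx : x ∈ S.I
  · exact (H.pos x hx).le
  · exact (H.eq_zero x hx).ge

theorem apply (H : S.IsInvariantDensity ν h C) {A : Set ℝ} (hA : MeasurableSet A) :
    ν A = ∫⁻ x in A, ENNReal.ofReal (h x) := by
  rw [H.eq_withDensity, withDensity_apply _ hA]

theorem absolutelyContinuous (H : S.IsInvariantDensity ν h C) : ν ≪ volume := by
  rw [H.eq_withDensity]; exact withDensity_absolutelyContinuous _ _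

theorem ae_iff (H : S.IsInvariantDensity ν h C) {p : ℝ → Prop} :
    (∀ᵐ x ∂ν, p x) ↔ ∀ᵐ x, x ∈ S.I → p x := by
  rw [H.eq_withDensity, ae_withDensity_iff H.measurable_ofReal]
  refine eventually_congr (Eventually.of_forall fun x => ?_)
  by_cases hx : x ∈ S.I
  · simp [hx, H.pos x hx]
  · simp [hx, H.eq_zero x hx]

theorem apply_eq_zero (H : S.IsInvariantDensity ν h C) {A : Set ℝ} (hA : A ⊆ S.I) :
    ν A = 0 ↔ volume A = 0 := by
  rw [measure_eq_zero_iff_ae_notMem, H.ae_iff, measure_eq_zero_iff_ae_notMem]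
  exact eventually_congr (Eventually.of_forall fun x =>
    ⟨fun hx hxA => hx (hA hxA) hxA, fun hx _ => hx⟩)

theorem ae_mem (H : S.IsInvariantDensity ν h C) : ∀ᵐ x ∂ν, x ∈ S.I :=
  H.ae_iff.2 (Eventually.of_forall fun _ => id)

theorem ae_mem_interior [Countable ι] (H : S.IsInvariantDensity ν h C) :
    ∀ᵐ x ∂ν, ∃ β, x ∈ interior (S.K β) := by
  rw [H.ae_iff]
  filter_upwards [measure_eq_zero_iff_ae_notMem.1 S.volume_I_diff_interior] with x hx hxI
  by_contra h
  exact hx ⟨hxI, fun h' => h (mem_iUnion.1 h')⟩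

theorem apply_le (H : S.IsInvariantDensity ν h C) (A : Set ℝ) :
    ν A ≤ ENNReal.ofReal C * volume A := by
  rw [H.eq_withDensity, withDensity_apply' _ A, ← setLIntegral_const]
  exact lintegral_mono fun x => ENNReal.ofReal_le_ofReal (H.le x)

theorem ae_iterate (H : S.IsInvariantDensity ν h C) {p : ℝ → Prop} (hp : ∀ᵐ x ∂ν, p x) :
    ∀ᵐ x ∂ν, ∀ n, p (S.map^[n] x) :=
  ae_all_iff.2 fun n => (H.measurePreserving.iterate n).quasiMeasurePreserving.ae hp

/-- If the part in `K β` of the preimages of subsets of `D` has small measure, then the derivative of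
the map is large on `K β ∩ T⁻¹ D`. -/
theorem ae_lt_mul_of_preimage [Countable ι] (H : S.IsInvariantDensity ν h C) {D : Set ℝ}
    (hD : MeasurableSet D) {τ : ℝ} (hτ : 0 ≤ τ)
    (hsmall : ∀ A, MeasurableSet A → A ⊆ D → A ⊆ S.I → volume A ≠ 0 →
      ν (S.map ⁻¹' A ∩ S.K β) < ENNReal.ofReal τ * ν A) :
    ∀ᵐ x ∂ν, x ∈ S.K β → S.map x ∈ D → h x < τ * (S.jac x * h (S.map x)) := by
  -- `E` is the set where the claim fails. If it had positive measure, a change of variables would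
  -- give `τ ν(T E) ≤ ν(E)`, against `hsmall` for `A = T E`.
  set E : Set ℝ := S.K β ∩ S.map ⁻¹' D ∩ {x | τ * (S.jac x * h (S.map x)) ≤ h x} with hE
  have hEm : MeasurableSet E := by
    refine ((measurableSet_K β).inter (S.measurable_map hD)).inter (measurableSet_le ?_ H.measurable)
    exact (S.measurable_jac.mul (H.measurable.comp S.measurable_map)).const_mul τ
  have hEK : E ⊆ S.K β := fun x hx => hx.1.1
  have hE0 : ν E = 0 := by
    by_contra hne
    have hvol : volume E ≠ 0 := by rwa [Ne, ← H.apply_eq_zero (hEK.trans (K_subset_I β))]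
    have hAm := measurableSet_map_image hEK hEm
    have hlt := hsmall (S.map '' E) hAm (by rintro _ ⟨x, hx, rfl⟩; exact hx.1.2)
      (by rintro _ ⟨x, hx, rfl⟩; exact map_mem_I (K_subset_I β (hEK hx)))
      (by rwa [Ne, volume_map_image_eq_zero hEK hEm])
    refine absurd hlt (not_lt.2 ?_)
    calc ENNReal.ofReal τ * ν (S.map '' E)
        = ENNReal.ofReal τ * ∫⁻ x in E, ENNReal.ofReal (S.jac x) * ENNReal.ofReal (h (S.map x)) := by
          rw [H.apply hAm, lintegral_map_image hEK hEm]
      _ = ∫⁻ x in E, ENNReal.ofReal (τ * (S.jac x * h (S.map x))) := by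
          rw [← lintegral_const_mul]
          · refine lintegral_congr fun x => ?_
            rw [ENNReal.ofReal_mul hτ, ENNReal.ofReal_mul (jac_pos x).le]
          · exact S.measurable_jac.ennreal_ofReal.mul
              (H.measurable.comp S.measurable_map).ennreal_ofReal
      _ ≤ ∫⁻ x in E, ENNReal.ofReal (h x) :=
          setLIntegral_mono H.measurable_ofReal fun x hx => ENNReal.ofReal_le_ofReal hx.2
      _ = ν E := (H.apply hEm).symm
      _ ≤ ν (S.map ⁻¹' (S.map '' E) ∩ S.K β) :=
          measure_mono (subset_inter (subset_preimage_image _ _) hEK)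
  filter_upwards [measure_eq_zero_iff_ae_notMem.1 hE0] with x hx h1 h2
  by_contra h3
  exact hx ⟨⟨h1, h2⟩, not_lt.1 h3⟩

theorem preimage_inter_add_diff (H : S.IsInvariantDensity ν h C) {A : Set ℝ}
    (hA : MeasurableSet A) (β : ι) :
    ν (S.map ⁻¹' A ∩ S.K β) + ν (S.map ⁻¹' A \ S.K β) = ν A := by
  rw [measure_inter_add_sdiff _ (measurableSet_K β),
    H.measurePreserving.measure_preimage hA.nullMeasurableSet]

/-- In the transfer equation for `h (T x)`, the term `h x / jac x` is never the whole sum, because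
other cylinders contribute a positive amount. -/
theorem ae_lt_jac_mul [Countable ι] (H : S.IsInvariantDensity ν h C) :
    ∀ᵐ x ∂ν, h x < S.jac x * h (S.map x) := by
  have := H.isProbabilityMeasure
  have key : ∀ β, ∀ᵐ x ∂ν, x ∈ S.K β → S.map x ∈ univ → h x < 1 * (S.jac x * h (S.map x)) := by
    intro β
    refine H.ae_lt_mul_of_preimage MeasurableSet.univ zero_le_one fun A hA _ hAI hA0 => ?_
    rw [ENNReal.ofReal_one, one_mul, ← H.preimage_inter_add_diff hA β]
    exact ENNReal.lt_add_right (measure_ne_top _ _) (H.preimage_diff_ne_zero β A hA hAI hA0)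
  filter_upwards [ae_all_iff.2 key, H.ae_mem] with x hx hxI
  obtain ⟨β, hβ⟩ := exists_mem_K hxI
  simpa using hx β hβ (mem_univ _)

/-- Along almost every orbit the derivatives of the iterates tend to infinity. -/
theorem ae_tendsto_jacIter [Countable ι] (H : S.IsInvariantDensity ν h C) :
    ∀ᵐ x ∂ν, Tendsto (fun n => S.jacIter n x) atTop atTop := by
  have := H.isProbabilityMeasure
  -- The sets `E k` quantify the strict inequality: almost every point lies in some `E k`, and by
  -- Poincaré recurrence returns to it infinitely often.
  set E : ℕ → Set ℝ := fun k => {x | (1 + 1 / ((k : ℝ) + 1)) * h x ≤ S.jac x * h (S.map x)} with hE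
  have hEm : ∀ k, MeasurableSet (E k) := fun k =>
    measurableSet_le (H.measurable.const_mul _)
      (S.measurable_jac.mul (H.measurable.comp S.measurable_map))
  have hrec : ∀ᵐ x ∂ν, ∀ k, x ∈ E k → ∃ᶠ n in atTop, S.map^[n] x ∈ E k :=
    ae_all_iff.2 fun k => H.measurePreserving.conservative.ae_mem_imp_frequently_image_mem
      (hEm k).nullMeasurableSet
  filter_upwards [hrec, H.ae_iterate H.ae_lt_jac_mul, H.ae_mem] with x hx hlt hxI
  -- `Q` increases along the orbit, and by a fixed factor above `1` at each visit to `E k`. So it is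
  -- unbounded; as `h ≤ C`, the derivatives tend to infinity.
  set Q : ℕ → ℝ := fun n => S.jacIter n x * h (S.map^[n] x) with hQ
  have hQs : ∀ n, Q (n + 1) =
      S.jacIter n x * (S.jac (S.map^[n] x) * h (S.map (S.map^[n] x))) := by
    intro n
    simp only [hQ, jacIter_succ, Function.iterate_succ_apply']
    ring
  have hmono : Monotone Q := by
    refine monotone_nat_of_le_succ fun n => ?_
    rw [hQs]
    exact mul_le_mul_of_nonneg_left (hlt n).le (jacIter_pos n x).le
  have hQ0 : 0 < Q 0 := by simpa [hQ, jacIter] using H.pos x hxI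
  obtain ⟨k, hk⟩ : ∃ k, x ∈ E k := by
    have h0 := H.pos x hxI
    have h1 : 0 < S.jac x * h (S.map x) / h x - 1 := by
      rw [sub_pos, one_lt_div h0]; simpa using hlt 0
    obtain ⟨k, hk⟩ := exists_nat_one_div_lt h1
    refine ⟨k, ?_⟩
    rw [hE, mem_ofPred_eq, ← le_div_iff₀ h0]
    linarith
  have hQtop : Tendsto Q atTop atTop := by
    rcases tendsto_atTop_of_monotone hmono with h | ⟨l, hl⟩
    · exact h
    · exfalso
      have hle : ∀ n, Q n ≤ l := hmono.ge_of_tendsto hl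
      have hl0 : 0 < l := hQ0.trans_le (hle 0)
      set c : ℝ := 1 + 1 / ((k : ℝ) + 1) with hc
      have hc1 : 1 < c := by rw [hc]; exact lt_add_of_pos_right _ (by positivity)
      have hev : ∀ᶠ n in atTop, l / c < Q n :=
        hl.eventually (lt_mem_nhds (div_lt_self hl0 hc1))
      obtain ⟨n, hn1, hn2⟩ := ((hx k hk).and_eventually hev).exists
      have h3 : c * Q n ≤ Q (n + 1) := by
        rw [hQs, hQ]
        calc c * (S.jacIter n x * h (S.map^[n] x)) = S.jacIter n x * (c * h (S.map^[n] x)) := by ring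
          _ ≤ _ := mul_le_mul_of_nonneg_left hn1 (jacIter_pos n x).le
      rw [div_lt_iff₀ (by linarith)] at hn2
      linarith [hle (n + 1)]
  refine tendsto_atTop_mono (fun n => ?_) (hQtop.atTop_div_const H.bound_pos)
  rw [div_le_iff₀ H.bound_pos]
  exact mul_le_mul_of_nonneg_left (H.le _) (jacIter_pos n x).le

end IsInvariantDensity

variable {S : PiecewiseMobius ι} {γ : ι}

/-- A branch whose orbit ends in an avoided full cylinder extends to a full branch. -/
theorem exists_full_branch (hI : volume S.I < ⊤) (hfull : S.IsFull γ) (hγ : S.IsAvoided γ) {x : ℝ}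
    (hxI : x ∈ interior S.I) {n : ℕ} (hx : ∀ i < n, ∃ β, S.map^[i] x ∈ interior (S.K β))
    (hxγ : S.map^[n] x ∈ interior (S.K γ)) :
    ∃ J A, S.IsBranch (n + 1) J A ∧ x ∈ J ∧ mobius A '' J = interior S.I := by
  choose w hw using fun i : Fin n => hx i i.2
  obtain ⟨A, hA, hE⟩ := exists_isBranch_openCylinder hI w
  have hxJ : x ∈ S.openCylinder w := ⟨hxI, hw⟩
  refine ⟨_, _, hA.succ γ, ⟨hxJ, hxγ⟩, ?_⟩
  rw [hA.image_succ, inter_eq_right.2, ← map_image interior_subset,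
    image_interior_of_isFull hfull]
  -- The image of the rank `n` cylinder meets the interior of `K γ` at `T^n x`, hence contains it;
  -- one more step by the full cylinder covers the interior of `I`.
  refine (subset_or_disjoint_of_isAvoided hγ hA.isOpen_image hE).resolve_right fun h => ?_
  refine disjoint_left.1 h hxγ ⟨x, hxJ, ?_⟩
  rw [hA.iterate_eq x hxJ]

theorem IsBranch.jac_adjugate {n : ℕ} {J : Set ℝ} {A : Matrix (Fin 2) (Fin 2) ℝ}
    (h : S.IsBranch n J A) {x : ℝ} (hx : x ∈ J) :
    mobiusJac A.adjugate (S.map^[n] x) = (S.jacIter n x)⁻¹ := by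
  have hd := h.denom_ne x hx
  have hdet := h.det_ne
  rw [h.iterate_eq x hx, h.jacIter_eq x hx, mobiusJac, mobiusJac, mobiusDenom_adjugate hd,
    det_adjugate_fin_two, inv_div, div_pow, ← sq_abs A.det]
  have : |A.det| ≠ 0 := abs_ne_zero.2 hdet
  field_simp

/-- Under the inverse of a full branch, compact intervals become intervals of controlled length. -/
theorem IsBranch.exists_closedBall {n : ℕ} {J : Set ℝ} {A : Matrix (Fin 2) (Fin 2) ℝ}
    (h : S.IsBranch n J A) (hfull : mobius A '' J = interior S.I) {a b d Λ : ℝ} (hab : a < b)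
    (hd : 0 < d) (hin : ∀ v ∈ Icc a b, Ioo (v - d) (v + d) ⊆ interior S.I) (hΛ : b - a ≤ Λ)
    {x : ℝ} (hx : x ∈ J) (hxn : S.map^[n] x ∈ Icc a b) :
    ∃ w δ, 0 < δ ∧ x ∈ Metric.closedBall w δ ∧
      Metric.closedBall w δ = mobius A.adjugate '' Icc a b ∧
      2 * δ ≤ (1 + Λ / d) ^ 2 * (b - a) * (S.jacIter n x)⁻¹ := by
  have hden : ∀ v ∈ interior S.I, mobiusDenom A.adjugate v ≠ 0 := by
    rw [← hfull]; exact h.denom_adjugate_ne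
  have hIcc : Icc a b ⊆ interior S.I := fun v hv => hin v hv ⟨by linarith, by linarith⟩
  have hdet : A.adjugate.det ≠ 0 := by rw [det_adjugate_fin_two]; exact h.det_ne
  have himg := ContinuousOn.image_Icc hab.le
    (continuousOn_mobius fun v hv => hden v (hIcc hv))
  have hvolpos : volume (mobius A.adjugate '' Icc a b) ≠ 0 := by
    rw [Ne, volume_mobius_image_eq_zero hdet measurableSet_Icc fun v hv => hden v (hIcc hv)]
    simpa using hab
  set p := sInf (mobius A.adjugate '' Icc a b)
  set q := sSup (mobius A.adjugate '' Icc a b)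
  have hpq : p < q := by
    by_contra hle
    rw [himg, Real.volume_Icc] at hvolpos
    exact hvolpos (ENNReal.ofReal_eq_zero.2 (by linarith))
  refine ⟨(p + q) / 2, (q - p) / 2, by linarith, ?_, ?_, ?_⟩
  · rw [← Real.Icc_eq_closedBall, ← himg]
    refine ⟨_, hxn, ?_⟩
    rw [h.iterate_eq x hx, mobius_adjugate h.det_ne (h.denom_ne x hx)]
  · rw [himg, ← Real.Icc_eq_closedBall]
  · have h1 : volume (mobius A.adjugate '' Icc a b) ≤
        ENNReal.ofReal ((1 + Λ / d) ^ 2 * (b - a) * (S.jacIter n x)⁻¹) := by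
      rw [volume_mobius_image hdet measurableSet_Icc fun v hv => hden v (hIcc hv)]
      calc ∫⁻ v in Icc a b, ENNReal.ofReal (mobiusJac A.adjugate v)
          ≤ ∫⁻ v in Icc a b, ENNReal.ofReal ((1 + Λ / d) ^ 2 * (S.jacIter n x)⁻¹) := by
            -- The inverse branch has no pole in the interior of `I`, so on `[a, b]` its derivative
            -- is comparable with its value at `T^n x`, the reciprocal of `jacIter n x`.
            refine setLIntegral_mono measurable_const fun v hv => ENNReal.ofReal_le_ofReal ?_
            rw [← h.jac_adjugate hx]
            refine mobiusJac_le_mul hd (fun t ht => hden t (hin v hv ht)) (hden _ (hIcc hxn)) ?_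
            rw [abs_le]
            constructor <;> linarith [hv.1, hv.2, hxn.1, hxn.2]
        _ = _ := by
            rw [setLIntegral_const, Real.volume_Icc, ← ENNReal.ofReal_mul]
            · congr 1; ring
            · have := (S.jacIter_pos n x).le; positivity
    rw [himg, Real.volume_Icc, ENNReal.ofReal_le_ofReal_iff] at h1
    · linarith
    · have := (S.jacIter_pos n x).le
      have : 0 < b - a := by linarith
      positivity

end PiecewiseMobius

/-! ### Ergodicity of the interval map -/

namespace PiecewiseMobius

variable {ι : Type*} {S : PiecewiseMobius ι} {γ : ι} {ν : Measure ℝ} {h : ℝ → ℝ} {C : ℝ}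

theorem exists_thickening_Icc {U : Set ℝ} (hU : IsOpen U) {a b : ℝ} (hab : Icc a b ⊆ U) :
    ∃ d, 0 < d ∧ ∀ v ∈ Icc a b, Ioo (v - d) (v + d) ⊆ U := by
  obtain ⟨d, hd, hsub⟩ := isCompact_Icc.exists_thickening_subset_open hU hab
  refine ⟨d, hd, fun v hv => ?_⟩
  rw [← Real.ball_eq_Ioo]
  exact (Metric.ball_subset_thickening hv d).trans hsub

theorem iterate_mem_iff {s : Set ℝ} (hs : S.map ⁻¹' s = s) (n : ℕ) (x : ℝ) :
    S.map^[n] x ∈ s ↔ x ∈ s := by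
  induction n with
  | zero => rfl
  | succ n ih =>
    rw [Function.iterate_succ_apply', ← mem_preimage, hs, ih]

namespace IsInvariantDensity

/-- The density point argument: an invariant set which has positive measure in some compact
interval fills every larger one. -/
theorem volume_diff_eq_zero_of_invariant [Countable ι] (H : S.IsInvariantDensity ν h C)
    (hI : volume S.I < ⊤) (hfull : S.IsFull γ) (hγ : S.IsAvoided γ) {s : Set ℝ}
    (hs : MeasurableSet s) (hinv : S.map ⁻¹' s = s) {a b : ℝ} {t : Set ℝ} (htm : MeasurableSet t)
    (ht : t ⊆ Icc a b) (hab : Icc a b ⊆ interior S.I) (hpos : volume (s ∩ t) ≠ 0) :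
    volume (Icc a b \ s) = 0 := by
  by_contra hne
  have := H.isProbabilityMeasure
  obtain ⟨d, hd, hin⟩ := exists_thickening_Icc isOpen_interior hab
  have hab' : a < b := by
    by_contra hle
    refine hne (measure_mono_null sdiff_subset ?_)
    rw [Real.volume_Icc, ENNReal.ofReal_eq_zero]; linarith
  set Λ := b - a
  obtain ⟨R, hR, hRI⟩ := bounded_I hI
  -- A visit to `B` at time `n` gives a full branch of rank `n + 1` whose endpoint `T^(n+1) x` lies
  -- in `[a, b]`.
  set B : Set ℝ := interior (S.K γ) ∩ S.map ⁻¹' (s ∩ t) with hB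
  have hBK : B ⊆ S.K γ := inter_subset_left.trans interior_subset
  have hBm : MeasurableSet B := isOpen_interior.measurableSet.inter (S.measurable_map (hs.inter htm))
  have himg : S.map '' B = s ∩ t := by
    rw [hB, image_inter_preimage, image_interior_of_isFull hfull, inter_eq_right]
    exact inter_subset_right.trans (ht.trans hab)
  have hBν : ν B ≠ 0 := by
    rwa [Ne, H.apply_eq_zero (hBK.trans (K_subset_I γ)), ← volume_map_image_eq_zero hBK hBm, himg]
  -- The density theorem is needed for balls that contain the point without being centered there;
  -- the constant `1` allows exactly these.
  have hdens := IsUnifLocDoublingMeasure.ae_tendsto_measure_inter_div (μ := volume) s 1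
  rw [ae_restrict_iff' hs] at hdens
  obtain ⟨x, hxB, hrec, hint, hjac, hxd⟩ := ((frequently_ae_mem_iff.2 hBν).and_eventually
    ((H.measurePreserving.conservative.ae_mem_imp_frequently_image_mem hBm.nullMeasurableSet).and
    ((H.ae_iterate H.ae_mem_interior).and (H.ae_tendsto_jacIter.and
      (H.absolutelyContinuous hdens))))).exists
  have hxI : x ∈ interior S.I := interior_mono (K_subset_I γ) hxB.1
  have hxs : x ∈ s := by
    have := hxB.2.1
    rwa [← mem_preimage, hinv] at this
  set m := volume (Icc a b \ s) with hm
  set c := ENNReal.ofReal ((1 + (2 * R) / d) ^ 2) with hc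
  set M := volume (Icc a b) with hM
  have key : ∀ n, ∃ w δ : ℝ, S.map^[n] x ∈ B → 0 < δ ∧ x ∈ Metric.closedBall w δ ∧
      2 * δ ≤ (1 + Λ / d) ^ 2 * (b - a) * (S.jacIter (n + 1) x)⁻¹ ∧
      volume (Metric.closedBall w δ) * m ≤ c * volume (Metric.closedBall w δ \ s) * M := by
    intro n
    by_cases hn : S.map^[n] x ∈ B
    · obtain ⟨J, A, hA, hxJ, hAJ⟩ := exists_full_branch hI hfull hγ hxI (fun i _ => hint i) hn.1
      have hxn : S.map^[n + 1] x ∈ Icc a b := by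
        rw [Function.iterate_succ_apply']; exact ht hn.2.2
      obtain ⟨w, δ, h1, h2, h3, h4⟩ := hA.exists_closedBall hAJ hab' hd hin le_rfl hxJ hxn
      refine ⟨w, δ, fun _ => ⟨h1, h2, h4, ?_⟩⟩
      have hden : ∀ v ∈ interior S.I, mobiusDenom A.adjugate v ≠ 0 := by
        rw [← hAJ]; exact hA.denom_adjugate_ne
      have hdet : A.adjugate.det ≠ 0 := by rw [det_adjugate_fin_two]; exact hA.det_ne
      -- By invariance of `s`, the inverse branch carries the gap in `[a, b]` to the gap in the
      -- ball. Bounded distortion then keeps the proportion of the gap bounded below.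
      have h5 : Metric.closedBall w δ \ s = mobius A.adjugate '' (Icc a b \ s) := by
        have hsub : ∀ v ∈ Icc a b, (mobius A.adjugate v ∈ s ↔ v ∈ s) := by
          intro v hv
          obtain ⟨y, hy, rfl⟩ : v ∈ mobius A '' J := hAJ ▸ hab hv
          rw [mobius_adjugate hA.det_ne (hA.denom_ne y hy), ← hA.iterate_eq y hy,
            iterate_mem_iff hinv]
        rw [h3]
        ext y
        constructor
        · rintro ⟨⟨v, hv, rfl⟩, hy⟩
          exact ⟨v, ⟨hv, fun hvs => hy ((hsub v hv).2 hvs)⟩, rfl⟩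
        · rintro ⟨v, ⟨hv, hvs⟩, rfl⟩
          exact ⟨⟨v, hv, rfl⟩, fun hy => hvs ((hsub v hv).1 hy)⟩
      rw [h5, h3]
      refine volume_mobius_image_mul_le hdet hd measurableSet_Icc (measurableSet_Icc.diff hs)
        (fun v hv u hu => hden u (hin v hv hu)) (fun u hu => hden u (hab hu.1)) ?_
      intro v hv u hu
      have h6 := hRI v (interior_subset (hab hv))
      have h7 := hRI u (interior_subset (hab hu.1))
      calc |u - v| ≤ |u| + |v| := abs_sub _ _
        _ ≤ 2 * R := by linarith
    · exact ⟨0, 0, fun hn' => absurd hn' hn⟩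
  choose w δ hwδ using key
  -- Limits are taken along the return times to `B`; the balls chosen at other times carry no
  -- information.
  set l : Filter ℕ := atTop ⊓ 𝓟 {n | S.map^[n] x ∈ B} with hl
  have hlne : NeBot l := by
    rw [hl]; exact frequently_mem_iff_neBot.1 (hrec hxB)
  have hlB : ∀ᶠ n in l, S.map^[n] x ∈ B := mem_inf_of_right (mem_principal_self _)
  have hδ : Tendsto δ l (𝓝[>] 0) := by
    rw [tendsto_nhdsWithin_iff]
    refine ⟨?_, hlB.mono fun n hn => (hwδ n hn).1⟩
    have h1 : Tendsto (fun n => (1 + Λ / d) ^ 2 * (b - a) * (S.jacIter (n + 1) x)⁻¹ / 2) l (𝓝 0) := by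
      have h2 := (hjac.comp (tendsto_add_atTop_nat 1)).inv_tendsto_atTop
      have h3 := (h2.const_mul ((1 + Λ / d) ^ 2 * (b - a))).div_const 2
      rw [mul_zero, zero_div] at h3
      exact h3.mono_left inf_le_left
    refine tendsto_of_tendsto_of_tendsto_of_le_of_le' tendsto_const_nhds h1
      (hlB.mono fun n hn => (hwδ n hn).1.le) (hlB.mono fun n hn => ?_)
    have := (hwδ n hn).2.2.1
    linarith
  have hlim := hxd hxs w δ hδ (hlB.mono fun n hn => by rw [one_mul]; exact (hwδ n hn).2.1)
  -- the complement of `s` has density at least `m / (c * M)` in the balls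
  have hM0 : M ≠ 0 := fun h0 => hne (measure_mono_null sdiff_subset h0)
  have hMt : M ≠ ⊤ := measure_Icc_lt_top.ne
  have hc0 : c ≠ 0 := by
    rw [hc, Ne, ENNReal.ofReal_eq_zero, not_le]; positivity
  have hm0 : m / (c * M) ≠ 0 :=
    ENNReal.div_ne_zero.2 ⟨hne, ENNReal.mul_ne_top ENNReal.ofReal_ne_top hMt⟩
  have hbound : ∀ᶠ n in l, volume (s ∩ Metric.closedBall (w n) (δ n)) /
      volume (Metric.closedBall (w n) (δ n)) + m / (c * M) ≤ 1 := by
    filter_upwards [hlB] with n hn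
    obtain ⟨h1, -, -, h4⟩ := hwδ n hn
    set V := Metric.closedBall (w n) (δ n) with hV
    have hV0 : volume V ≠ 0 := (Metric.measure_closedBall_pos volume _ h1).ne'
    have hVt : volume V ≠ ⊤ := measure_closedBall_lt_top.ne
    have h5 : m / (c * M) ≤ volume (V \ s) / volume V := by
      rw [ENNReal.le_div_iff_mul_le (Or.inl hV0) (Or.inl hVt), mul_comm, ← mul_div_assoc]
      refine ENNReal.div_le_of_le_mul ?_
      calc _ ≤ _ := h4
        _ = _ := by ring
    calc _ ≤ volume (s ∩ V) / volume V + volume (V \ s) / volume V := by gcongr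
      _ = 1 := by
        rw [inter_comm, ← ENNReal.add_div, measure_inter_add_sdiff _ hs, ENNReal.div_self hV0 hVt]
  -- In the shrinking balls `s` has density tending to `1` while its complement keeps density at
  -- least `m / (c * M) > 0`.
  have hfin : 1 + m / (c * M) ≤ 1 := le_of_tendsto (hlim.add_const _) hbound
  exact absurd hfin (not_le.2 (ENNReal.lt_add_right ENNReal.one_ne_top hm0))

/-- Every open set is covered by countably many compact intervals. -/
theorem volume_inter_eq_zero_of_Icc {U : Set ℝ} (hU : IsOpen U) {s : Set ℝ}
    (hs : ∀ a b : ℝ, Icc a b ⊆ U → volume (s ∩ Icc a b) = 0) : volume (s ∩ U) = 0 := by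
  have h1 : s ∩ U ⊆ ⋃ q : {q : ℚ × ℚ // Icc (q.1 : ℝ) q.2 ⊆ U}, s ∩ Icc (q.1.1 : ℝ) q.1.2 := by
    rintro x ⟨hxs, hxU⟩
    obtain ⟨ε, hε, hsub⟩ := Metric.isOpen_iff.1 hU x hxU
    obtain ⟨p, hp1, hp2⟩ := exists_rat_btwn (show x - ε < x by linarith)
    obtain ⟨q, hq1, hq2⟩ := exists_rat_btwn (show x < x + ε by linarith)
    refine mem_iUnion.2 ⟨⟨(p, q), fun u hu => hsub ?_⟩, hxs, hp2.le, hq1.le⟩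
    rw [Real.ball_eq_Ioo]
    exact ⟨hp1.trans_le hu.1, hu.2.trans_lt hq2⟩
  exact measure_mono_null h1 (measure_iUnion_null fun q => hs _ _ q.2)

/-- An invariant set that is not null has positive measure in some compact interval. It then fills
the hull of that interval with any other compact interval, and these exhaust the interior of `I`. -/
theorem ergodic [Countable ι] (H : S.IsInvariantDensity ν h C) (hI : volume S.I < ⊤)
    (hfull : S.IsFull γ) (hγ : S.IsAvoided γ) : Ergodic S.map ν := by
  refine ⟨H.measurePreserving, ⟨fun s hs hinv => ?_⟩⟩
  have hfr : volume (S.I \ interior S.I) = 0 :=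
    measure_mono_null (t := frontier S.I) (fun x hx => ⟨subset_closure hx.1, hx.2⟩)
      (volume_frontier_eq_zero S.ordConnected_I)
  have hnull : ∀ A : Set ℝ, volume (A ∩ interior S.I) = 0 → ν A = 0 := by
    intro A hA
    rw [measure_eq_zero_iff_ae_notMem, H.ae_iff]
    filter_upwards [measure_eq_zero_iff_ae_notMem.1 hfr, measure_eq_zero_iff_ae_notMem.1 hA]
      with x h1 h2 h3 h4
    exact h2 ⟨h4, by_contra fun h5 => h1 ⟨h3, h5⟩⟩
  rw [eventuallyConst_set']
  by_cases h0 : volume (s ∩ interior S.I) = 0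
  · exact Or.inl (ae_eq_empty.2 (hnull s h0))
  · refine Or.inr (ae_eq_univ.2 (hnull _ ?_))
    obtain ⟨a, b, hab, hpos⟩ : ∃ a b : ℝ, Icc a b ⊆ interior S.I ∧ volume (s ∩ Icc a b) ≠ 0 := by
      by_contra! hcon
      exact h0 (volume_inter_eq_zero_of_Icc isOpen_interior hcon)
    refine volume_inter_eq_zero_of_Icc isOpen_interior fun a' b' hab' => ?_
    by_cases hle : a' ≤ b'
    · have hle2 : a ≤ b := by
        by_contra hlt
        rw [Icc_eq_empty hlt, inter_empty] at hpos
        exact hpos measure_empty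
      have hhull : Icc (min a a') (max b b') ⊆ interior S.I := by
        refine (ordConnected_interior S.ordConnected_I).out ?_ ?_
        · rcases min_choice a a' with h | h <;> rw [h]
          exacts [hab ⟨le_rfl, hle2⟩, hab' ⟨le_rfl, hle⟩]
        · rcases max_choice b b' with h | h <;> rw [h]
          exacts [hab ⟨hle2, le_rfl⟩, hab' ⟨hle, le_rfl⟩]
      have := H.volume_diff_eq_zero_of_invariant hI hfull hγ hs hinv measurableSet_Icc
        (Icc_subset_Icc (min_le_left _ _) (le_max_left _ _)) hhull hpos
      refine measure_mono_null ?_ this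
      rintro x ⟨hx1, hx2⟩
      exact ⟨Icc_subset_Icc (min_le_right _ _) (le_max_right _ _) hx2, hx1⟩
    · rw [Icc_eq_empty hle, inter_empty, measure_empty]

end IsInvariantDensity

end PiecewiseMobius

/-! ### Mean ergodic theorem and transfer of lower bounds to the ergodic measure -/

section MeanErgodic

theorem birkhoffAverage_indicator_mem_Icc {X : Type*} (T : X → X) (Q : Set X) (N : ℕ) (x : X) :
    birkhoffAverage ℝ T (Q.indicator fun _ => (1 : ℝ)) N x ∈ Icc (0 : ℝ) 1 := by
  have h0 : ∀ y, 0 ≤ Q.indicator (fun _ => (1 : ℝ)) y := fun y =>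
    indicator_nonneg (fun _ _ => zero_le_one) y
  have h1 : ∀ y, Q.indicator (fun _ => (1 : ℝ)) y ≤ 1 := fun y =>
    indicator_le_self' (fun _ _ => zero_le_one) y
  rw [birkhoffAverage, birkhoffSum, smul_eq_mul]
  refine ⟨mul_nonneg (by positivity) (Finset.sum_nonneg fun _ _ => h0 _), ?_⟩
  rcases N.eq_zero_or_pos with rfl | hN
  · simp
  · rw [inv_mul_le_iff₀ (by exact_mod_cast hN), mul_one]
    calc _ ≤ ∑ _k ∈ Finset.range N, (1 : ℝ) := Finset.sum_le_sum fun _ _ => h1 _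
      _ = N := by simp

variable {X : Type*} [MeasurableSpace X] {ν κ : Measure X} {T : X → X} {Q : Set X}

theorem measurable_birkhoffAverage_indicator (hT : Measurable T) (hQ : MeasurableSet Q) (N : ℕ) :
    Measurable (birkhoffAverage ℝ T (Q.indicator fun _ => (1 : ℝ)) N) := by
  have : Measurable fun x => (N : ℝ)⁻¹ •
      ∑ k ∈ Finset.range N, Q.indicator (fun _ => (1 : ℝ)) (T^[k] x) :=
    Measurable.const_smul (Finset.measurable_sum _ fun k _ =>
      (measurable_const.indicator hQ : Measurable (Q.indicator fun _ => (1 : ℝ))).comp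
        (hT.iterate k)) (N : ℝ)⁻¹
  exact this

theorem integral_birkhoffAverage_indicator [IsFiniteMeasure κ] (hT : Measurable T)
    (hQ : MeasurableSet Q) (N : ℕ) :
    ∫ x, birkhoffAverage ℝ T (Q.indicator fun _ => (1 : ℝ)) N x ∂κ =
      (N : ℝ)⁻¹ * ∑ k ∈ Finset.range N, κ.real (T^[k] ⁻¹' Q) := by
  simp only [birkhoffAverage, birkhoffSum, smul_eq_mul]
  rw [integral_const_mul, integral_finsetSum]
  · congr 1
    refine Finset.sum_congr rfl fun k _ => ?_
    have : (fun x => Q.indicator (fun _ => (1 : ℝ)) (T^[k] x)) =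
        (T^[k] ⁻¹' Q).indicator fun _ => 1 := rfl
    rw [this, integral_indicator (hT.iterate k hQ)]
    simp
  · intro k _
    exact (integrable_const (1 : ℝ)).indicator (hT.iterate k hQ)

/-- Along a subsequence, the Birkhoff averages of a set converge almost everywhere to a constant. -/
theorem Ergodic.exists_seq_tendsto_birkhoffAverage_indicator [IsProbabilityMeasure ν]
    (hT : Ergodic T ν) (hQ : MeasurableSet Q) :
    ∃ ns : ℕ → ℕ, StrictMono ns ∧ ∃ k : ℝ, ∀ᵐ x ∂ν,
      Tendsto (fun j => birkhoffAverage ℝ T (Q.indicator fun _ => (1 : ℝ)) (ns j) x) atTop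
        (𝓝 k) := by
  have hmp := hT.toMeasurePreserving
  let U : Lp ℝ 2 ν →ₗᵢ[ℝ] Lp ℝ 2 ν := Lp.compMeasurePreservingₗᵢ ℝ T hmp
  let f : Lp ℝ 2 ν := indicatorConstLp 2 hQ (measure_ne_top ν Q) (1 : ℝ)
  -- Von Neumann's theorem for the Koopman isometry `U` on `L²`: the averages converge to the
  -- projection on the fixed vectors, which are constants by ergodicity. Norm convergence gives an
  -- almost everywhere convergent subsequence.
  have hlim := ContinuousLinearMap.tendsto_birkhoffAverage_orthogonalProjection (𝕜 := ℝ)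
    U.toContinuousLinearMap U.norm_toContinuousLinearMap_le f
  set g := (U.toContinuousLinearMap.eqLocus
    (1 : Lp ℝ 2 ν →L[ℝ] Lp ℝ 2 ν)).orthogonalProjectionOnto f with hg
  have hgfix : Lp.compMeasurePreserving T hmp (g : Lp ℝ 2 ν) = g := by
    have := LinearMap.mem_eqLocus.1 g.2
    exact this
  obtain ⟨k, hk⟩ := hT.ae_eq_const_of_ae_eq_comp_ae
    (Lp.aestronglyMeasurable (g : Lp ℝ 2 ν)) (by
      have h1 := Lp.coeFn_compMeasurePreserving (g : Lp ℝ 2 ν) hmp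
      rw [hgfix] at h1
      exact h1.symm)
  obtain ⟨ns, hns, hae⟩ := (tendstoInMeasure_of_tendsto_Lp hlim).exists_seq_tendsto_ae
  have hcoe : ∀ N, (birkhoffAverage ℝ U.toContinuousLinearMap _root_.id N f : Lp ℝ 2 ν) =ᵐ[ν]
      birkhoffAverage ℝ T (Q.indicator fun _ => (1 : ℝ)) N := by
    intro N
    have h1 : ∀ k, ((U.toContinuousLinearMap)^[k] f : Lp ℝ 2 ν) =ᵐ[ν]
        fun x => Q.indicator (fun _ => (1 : ℝ)) (T^[k] x) := by
      intro k
      have h2 : (U.toContinuousLinearMap)^[k] f =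
          Lp.compMeasurePreserving T^[k] (hmp.iterate k) f := by
        rw [← Lp.compMeasurePreserving_iterate hmp k]; rfl
      rw [h2]
      refine (Lp.coeFn_compMeasurePreserving f (hmp.iterate k)).trans ?_
      exact (hmp.iterate k).quasiMeasurePreserving.ae_eq_comp indicatorConstLp_coeFn
    rw [birkhoffAverage, birkhoffSum]
    refine (Lp.coeFn_smul _ _).trans ?_
    have h3 := Lp.coeFn_fun_finsetSum (Finset.range N)
      fun k => _root_.id ((U.toContinuousLinearMap)^[k] f)
    have h4 : ∀ᵐ x ∂ν, ∀ k, ((U.toContinuousLinearMap)^[k] f : Lp ℝ 2 ν) x =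
        Q.indicator (fun _ => (1 : ℝ)) (T^[k] x) := ae_all_iff.2 h1
    filter_upwards [h3, h4] with x hx3 hx4
    rw [Pi.smul_apply, hx3, birkhoffAverage, birkhoffSum]
    congr 1
    exact Finset.sum_congr rfl fun k _ => hx4 k
  refine ⟨ns, hns, k, ?_⟩
  filter_upwards [hae, hk, ae_all_iff.2 hcoe] with x h1 h2 h3
  rw [h2] at h1
  exact h1.congr fun j => h3 _

/-- If the preimages of `Q` have measure at least `c` for some absolutely continuous finite measure,
then `Q` has a definite measure for the ergodic measure. -/
theorem Ergodic.le_measureReal_mul [IsProbabilityMeasure ν] [IsFiniteMeasure κ] (hT : Ergodic T ν)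
    (hκ : κ ≪ ν) (hQ : MeasurableSet Q) {c : ℝ} (hc : ∀ n, c ≤ κ.real (T^[n] ⁻¹' Q)) :
    c ≤ ν.real Q * κ.real univ := by
  have hTm := hT.measurable
  obtain ⟨ns, hns, k, hk⟩ := hT.exists_seq_tendsto_birkhoffAverage_indicator hQ
  -- Dominated convergence integrates the limit against any `m ≪ ν`. Taking `m = ν` identifies the
  -- constant as `ν Q`; taking `m = κ` gives the bound.
  have hint : ∀ (m : Measure X) [IsFiniteMeasure m], m ≪ ν →
      Tendsto (fun j => ∫ x, birkhoffAverage ℝ T (Q.indicator fun _ => (1 : ℝ)) (ns j) x ∂m)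
        atTop (𝓝 (k * m.real univ)) := by
    intro m _ hm
    have : k * m.real univ = ∫ _x, k ∂m := by rw [integral_const, smul_eq_mul, mul_comm]
    rw [this]
    refine tendsto_integral_of_dominated_convergence (fun _ => 1)
      (fun j => (measurable_birkhoffAverage_indicator hTm hQ _).aestronglyMeasurable)
      (integrable_const _) (fun j => Eventually.of_forall fun x => ?_) (hm hk)
    have := birkhoffAverage_indicator_mem_Icc T Q (ns j) x
    rw [Real.norm_eq_abs, abs_of_nonneg this.1]
    exact this.2
  have hpos : ∀ᶠ j in atTop, 0 < ns j :=
    (hns.tendsto_atTop.eventually_gt_atTop 0)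
  have h1 : ν.real Q = k := by
    have h2 := hint ν Measure.AbsolutelyContinuous.rfl
    rw [probReal_univ, mul_one] at h2
    refine tendsto_nhds_unique (tendsto_const_nhds.congr' ?_) h2
    filter_upwards [hpos] with j hj
    rw [integral_birkhoffAverage_indicator hTm hQ]
    have : ∀ i, ν.real (T^[i] ⁻¹' Q) = ν.real Q := fun i => by
      rw [measureReal_def, (hT.toMeasurePreserving.iterate i).measure_preimage hQ.nullMeasurableSet,
        measureReal_def]
    simp only [this, Finset.sum_const, Finset.card_range, nsmul_eq_mul]
    field_simp
  rw [h1]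
  refine ge_of_tendsto (hint κ hκ) ?_
  filter_upwards [hpos] with j hj
  rw [integral_birkhoffAverage_indicator hTm hQ, le_inv_mul_iff₀ (by exact_mod_cast hj)]
  calc (ns j : ℝ) * c = ∑ _i ∈ Finset.range (ns j), c := by simp
    _ ≤ _ := Finset.sum_le_sum fun i _ => hc i

end MeanErgodic

/-! ### Lower bounds for the density and eventual expansivity -/

namespace PiecewiseMobius

variable {ι : Type*} {S : PiecewiseMobius ι} {β γ : ι} {ν : Measure ℝ} {h : ℝ → ℝ} {C : ℝ}

theorem mem_I_of_mem_openCylinder {n : ℕ} {w : Fin n → ι} {x : ℝ} (hx : x ∈ S.openCylinder w) :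
    x ∈ S.I := interior_subset hx.1

theorem disjoint_openCylinder {n : ℕ} {w w' : Fin n → ι} (hw : w ≠ w') :
    Disjoint (S.openCylinder w) (S.openCylinder w') := by
  refine disjoint_left.2 fun x hx hx' => hw (funext fun i => ?_)
  exact eq_of_mem (interior_subset (hx.2 i)) (interior_subset (hx'.2 i))

theorem measurableSet_openCylinder [Countable ι] {n : ℕ} (w : Fin n → ι) :
    MeasurableSet (S.openCylinder w) := by
  have : S.openCylinder w = interior S.I ∩ ⋂ i : Fin n, S.map^[i] ⁻¹' interior (S.K (w i)) := by
    ext x; simp [openCylinder]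
  rw [this]
  exact isOpen_interior.measurableSet.inter (MeasurableSet.iInter fun i =>
    S.measurable_map.iterate _ isOpen_interior.measurableSet)

/-- One-sided bounded distortion on an avoided cylinder. -/
theorem volume_openCylinder_inter_mul_le [Countable ι] (hI : volume S.I < ⊤) (hγ : S.IsAvoided γ)
    {a b d R : ℝ} (hd : 0 < d) (hin : ∀ v ∈ Icc a b, Ioo (v - d) (v + d) ⊆ interior (S.K γ))
    (hR : ∀ x ∈ S.I, |x| ≤ R) {A : Set ℝ} (hA : MeasurableSet A) (hAγ : A ⊆ interior (S.K γ))
    {n : ℕ} (w : Fin n → ι) :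
    volume (S.openCylinder w ∩ S.map^[n] ⁻¹' Icc a b) * volume A ≤
      ENNReal.ofReal ((1 + (2 * R) / d) ^ 2) * volume (S.openCylinder w ∩ S.map^[n] ⁻¹' A) *
        volume (Icc a b) := by
  obtain ⟨B, hB, hE⟩ := exists_isBranch_openCylinder hI w
  have hIcc : Icc a b ⊆ interior (S.K γ) := fun v hv => hin v hv ⟨by linarith, by linarith⟩
  have hKI : ∀ v ∈ interior (S.K γ), |v| ≤ R := fun v hv => hR v (K_subset_I γ (interior_subset hv))
  rcases subset_or_disjoint_of_isAvoided hγ hB.isOpen_image hE with hsub | hdis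
  · rw [hB.inter_preimage_eq_image (hIcc.trans hsub), hB.inter_preimage_eq_image (hAγ.trans hsub)]
    refine volume_mobius_image_mul_le ?_ hd measurableSet_Icc hA
      (fun v hv u hu => hB.denom_adjugate_ne u (hsub (hin v hv hu)))
      (fun u hu => hB.denom_adjugate_ne u (hsub (hAγ hu))) fun v hv u hu => ?_
    · rw [det_adjugate_fin_two]; exact hB.det_ne
    · calc |u - v| ≤ |u| + |v| := abs_sub _ _
        _ ≤ 2 * R := by linarith [hKI v (hIcc hv), hKI u (hAγ hu)]
  · have : S.openCylinder w ∩ S.map^[n] ⁻¹' Icc a b = ∅ := by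
      rw [hB.inter_preimage_eq, (hdis.mono_left hIcc).symm.inter_eq, image_empty]
    rw [this, measure_empty, zero_mul]
    exact zero_le

namespace IsInvariantDensity

theorem restrict_absolutelyContinuous (H : S.IsInvariantDensity ν h C) :
    volume.restrict S.I ≪ ν := by
  refine Measure.AbsolutelyContinuous.mk fun A hA hA0 => ?_
  rw [Measure.restrict_apply hA]
  exact (H.apply_eq_zero inter_subset_right).1 (measure_mono_null inter_subset_left hA0)

/-- Distortion on each cylinder of rank `n + 1` compares the preimage of `A` with that of the fixed
interval `[a, b]`. The latter has `ν`-measure independent of `n`, so the lower bound for `A` is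
uniform in time. -/
theorem measure_mul_volume_le [Countable ι] (H : S.IsInvariantDensity ν h C) (hI : volume S.I < ⊤)
    (hγ : S.IsAvoided γ) {a b d R : ℝ} (hd : 0 < d)
    (hin : ∀ v ∈ Icc a b, Ioo (v - d) (v + d) ⊆ interior (S.K γ))
    (hR : ∀ x ∈ S.I, |x| ≤ R) {A : Set ℝ} (hA : MeasurableSet A) (hAγ : A ⊆ interior (S.K γ))
    (n : ℕ) :
    ν (S.map ⁻¹' Icc a b \ S.K γ) * volume A ≤
      ENNReal.ofReal C * (ENNReal.ofReal ((1 + (2 * R) / d) ^ 2) * volume (Icc a b)) *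
        volume.restrict S.I (S.map^[n] ⁻¹' (S.map ⁻¹' A \ S.K γ)) := by
  have hmeas : ∀ {B : Set ℝ}, MeasurableSet B →
      MeasurableSet (S.map^[n] ⁻¹' (S.map ⁻¹' B \ S.K γ)) := fun hB =>
    S.measurable_map.iterate n ((S.measurable_map hB).diff (measurableSet_K γ))
  -- The last letter records the cylinder containing `T^n x`, so these itineraries describe the
  -- orbits which are outside `K γ` at time `n`.
  let W := {w : Fin (n + 1) → ι // w (Fin.last n) ≠ γ}
  have h1 : ν (S.map ⁻¹' Icc a b \ S.K γ) ≤ ENNReal.ofReal C *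
      volume.restrict S.I (S.map^[n] ⁻¹' (S.map ⁻¹' Icc a b \ S.K γ)) := by
    rw [← (H.measurePreserving.iterate n).measure_preimage
      ((S.measurable_map measurableSet_Icc).diff (measurableSet_K γ)).nullMeasurableSet,
      Measure.restrict_apply (hmeas measurableSet_Icc)]
    refine le_trans ?_ (H.apply_le _)
    refine measure_mono_ae ?_
    filter_upwards [H.ae_mem] with x hx hx'
    exact ⟨hx', hx⟩
  have h2 : volume.restrict S.I (S.map^[n] ⁻¹' (S.map ⁻¹' Icc a b \ S.K γ)) ≤
      ∑' w : W, volume (S.openCylinder w.1 ∩ S.map^[n + 1] ⁻¹' Icc a b) := by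
    refine le_trans ?_ (measure_iUnion_le _)
    rw [Measure.restrict_apply (hmeas measurableSet_Icc)]
    refine measure_mono_ae ?_
    filter_upwards [H.ae_iff.1 (H.ae_iterate H.ae_mem_interior)] with x hx
    rintro ⟨hx1, hxI⟩
    choose w hw using hx hxI
    refine mem_iUnion.2 ⟨⟨fun i => w i, fun hγw => hx1.2 ?_⟩, ⟨?_, fun i => hw i⟩, ?_⟩
    · rw [← hγw]; exact interior_subset (hw n)
    · exact interior_mono (K_subset_I _) (hw 0)
    · rw [mem_preimage, Function.iterate_succ_apply']; exact hx1.1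
  have h3 : ∑' w : W, volume (S.openCylinder w.1 ∩ S.map^[n + 1] ⁻¹' A) ≤
      volume.restrict S.I (S.map^[n] ⁻¹' (S.map ⁻¹' A \ S.K γ)) := by
    rw [← measure_iUnion, Measure.restrict_apply (hmeas hA)]
    · refine measure_mono (iUnion_subset fun w => ?_)
      rintro x ⟨hx1, hx2⟩
      rw [mem_preimage, Function.iterate_succ_apply'] at hx2
      exact ⟨⟨hx2, fun hxγ => w.2 (eq_of_mem (interior_subset (hx1.2 (Fin.last n))) hxγ)⟩,
        mem_I_of_mem_openCylinder hx1⟩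
    · intro w w' hww'
      exact (disjoint_openCylinder (Subtype.coe_injective.ne hww')).mono inter_subset_left
        inter_subset_left
    · exact fun w => (measurableSet_openCylinder _).inter (S.measurable_map.iterate _ hA)
  calc ν (S.map ⁻¹' Icc a b \ S.K γ) * volume A
      ≤ ENNReal.ofReal C * (∑' w : W, volume (S.openCylinder w.1 ∩ S.map^[n + 1] ⁻¹' Icc a b)) *
          volume A := by gcongr; exact h1.trans (by gcongr)
    _ = ENNReal.ofReal C * ∑' w : W, volume (S.openCylinder w.1 ∩ S.map^[n + 1] ⁻¹' Icc a b) *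
          volume A := by rw [mul_assoc, ENNReal.tsum_mul_right]
    _ ≤ ENNReal.ofReal C * ∑' w : W, (ENNReal.ofReal ((1 + (2 * R) / d) ^ 2) * volume (Icc a b)) *
          volume (S.openCylinder w.1 ∩ S.map^[n + 1] ⁻¹' A) := by
        gcongr ENNReal.ofReal C * ?_
        refine ENNReal.tsum_le_tsum fun w => ?_
        refine (volume_openCylinder_inter_mul_le hI hγ hd hin hR hA hAγ w.1).trans_eq ?_
        ring
    _ ≤ _ := by
        rw [ENNReal.tsum_mul_left, mul_assoc (ENNReal.ofReal C)]
        gcongr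

/-- The preimages outside the avoided full cylinder of its subsets have definite measure. -/
theorem exists_le_measure_preimage_diff [Countable ι] (H : S.IsInvariantDensity ν h C)
    (hI : volume S.I < ⊤) (hfull : S.IsFull γ) (hγ : S.IsAvoided γ) :
    ∃ c : ℝ, 0 < c ∧ ∀ A, MeasurableSet A → A ⊆ interior (S.K γ) →
      c * volume.real A ≤ ν.real (S.map ⁻¹' A \ S.K γ) := by
  have := H.isProbabilityMeasure
  have : IsFiniteMeasure (volume.restrict S.I) := ⟨by simpa using hI⟩
  obtain ⟨R, hR0, hR⟩ := bounded_I hI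
  obtain ⟨x₀, hx₀⟩ := nonempty_interior_of_isFull hfull
  obtain ⟨ε, hε, hball⟩ := Metric.isOpen_iff.1 isOpen_interior x₀ hx₀
  rw [Real.ball_eq_Ioo] at hball
  set a := x₀ - ε / 2
  set b := x₀ + ε / 2
  have hab : a < b := by simp only [a, b]; linarith
  have hIcc : Icc a b ⊆ interior (S.K γ) := fun v hv => hball
    ⟨by simp only [a, b] at hv; linarith [hv.1], by simp only [a, b] at hv; linarith [hv.2]⟩
  obtain ⟨d, hd, hin⟩ := exists_thickening_Icc isOpen_interior hIcc
  set q := ν.real (S.map ⁻¹' Icc a b \ S.K γ) with hq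
  have hq0 : 0 < q := by
    refine ENNReal.toReal_pos ?_ (measure_ne_top _ _)
    exact H.preimage_diff_ne_zero γ _ measurableSet_Icc
      (hIcc.trans (interior_subset.trans (K_subset_I γ))) (by simpa using hab)
  set D := C * ((1 + (2 * R) / d) ^ 2 * (b - a)) with hD
  have hC := H.bound_pos
  have hba : 0 < b - a := sub_pos.2 hab
  have hD0 : 0 < D := by positivity
  have hV0 : 0 < volume.real S.I := by
    refine ENNReal.toReal_pos (fun h0 => ?_) hI.ne
    exact (isOpen_interior.measure_pos volume S.nondegenerate_I).ne'
      (measure_mono_null interior_subset h0)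
  refine ⟨q / D / volume.real S.I, by positivity, fun A hA hAγ => ?_⟩
  have hQ : MeasurableSet (S.map ⁻¹' A \ S.K γ) := (S.measurable_map hA).diff (measurableSet_K γ)
  have key : ∀ n, q / D * volume.real A ≤
      (volume.restrict S.I).real (S.map^[n] ⁻¹' (S.map ⁻¹' A \ S.K γ)) := by
    intro n
    have h1 := H.measure_mul_volume_le hI hγ hd hin hR hA hAγ n
    rw [Real.volume_Icc, ← ENNReal.ofReal_mul (by positivity), ← ENNReal.ofReal_mul hC.le] at h1
    have h2 := ENNReal.toReal_mono (ENNReal.mul_ne_top ENNReal.ofReal_ne_top (measure_ne_top _ _)) h1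
    rw [ENNReal.toReal_mul, ENNReal.toReal_mul, ENNReal.toReal_ofReal hD0.le] at h2
    rw [div_mul_eq_mul_div, div_le_iff₀ hD0, mul_comm _ D]
    exact h2
  -- The bound holds for Lebesgue measure on `I` at every time; ergodic averaging turns it into a
  -- bound for `ν`, although `h` is not yet known to be bounded below.
  have h3 := (H.ergodic hI hfull hγ).le_measureReal_mul H.restrict_absolutelyContinuous hQ key
  rw [measureReal_restrict_apply MeasurableSet.univ, univ_inter] at h3
  rw [div_mul_eq_mul_div, div_le_iff₀ hV0]
  exact h3

/-- The derivative is bounded on a cylinder. -/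
theorem exists_jac_le (hI : volume S.I < ⊤) (β : ι) : ∃ B : ℝ, 0 < B ∧ ∀ x ∈ S.K β, S.jac x ≤ B := by
  obtain ⟨R, hR0, hR⟩ := bounded_I hI
  set A := (S.M β).adjugate with hA
  have hD : 0 < |(S.M β).det| := abs_pos.2 (S.det_ne_zero β)
  refine ⟨((|A 1 0| * R + |A 1 1|) ^ 2 + 1) / |(S.M β).det|, by positivity, fun x hx => ?_⟩
  have hd := mobiusDenom_ne hx
  have h1 : mobiusDenom A (mobius (S.M β) x) ^ 2 ≤ (|A 1 0| * R + |A 1 1|) ^ 2 := by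
    rw [← sq_abs (mobiusDenom _ _)]
    gcongr
    calc |mobiusDenom A (mobius (S.M β) x)|
        ≤ |A 1 0| * |mobius (S.M β) x| + |A 1 1| := by
          rw [← abs_mul]; exact abs_add_le _ _
      _ ≤ _ := by
          gcongr
          exact hR _ (S.mapsTo_I β hx)
  rw [hA, mobiusDenom_adjugate hd, ← hA, div_pow, ← sq_abs (S.M β).det] at h1
  rw [jac_eq hx, mobiusJac, le_div_iff₀ hD]
  calc |(S.M β).det| / mobiusDenom (S.M β) x ^ 2 * |(S.M β).det|
      = |(S.M β).det| ^ 2 / mobiusDenom (S.M β) x ^ 2 := by ring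
    _ ≤ _ := by linarith

/-- The preimages in the avoided full cylinder have definite measure. -/
theorem exists_le_measure_preimage_inter [Countable ι] (H : S.IsInvariantDensity ν h C)
    (hI : volume S.I < ⊤) (hfull : S.IsFull γ) (hγ : S.IsAvoided γ) :
    ∃ c : ℝ, 0 < c ∧ ∀ A, MeasurableSet A → A ⊆ S.I →
      c * volume.real A ≤ ν.real (S.map ⁻¹' A ∩ S.K γ) := by
  have := H.isProbabilityMeasure
  obtain ⟨c, hc, hc'⟩ := H.exists_le_measure_preimage_diff hI hfull hγ
  obtain ⟨B, hB, hB'⟩ := exists_jac_le hI γ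
  refine ⟨c / B, by positivity, fun A hA hAI => ?_⟩
  -- `E` maps onto `A` up to endpoints, so `|A| ≤ B |E|`. Since `E` lies in the interior of `K γ`,
  -- the previous bound applies to `T⁻¹ E`, and `ν (T⁻¹ E) = ν E`.
  set E := S.map ⁻¹' A ∩ interior (S.K γ) with hE
  have hEK : E ⊆ S.K γ := inter_subset_right.trans interior_subset
  have hEm : MeasurableSet E := (S.measurable_map hA).inter isOpen_interior.measurableSet
  have hEt : volume E ≠ ⊤ := ((measure_mono (hEK.trans (K_subset_I γ))).trans_lt hI).ne
  have h1 : volume A ≤ volume (S.map '' E) := by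
    have h2 : S.map '' E = A ∩ interior S.I := by
      rw [hE, inter_comm, image_inter_preimage, image_interior_of_isFull hfull, inter_comm]
    rw [h2]
    refine measure_mono_ae ?_
    filter_upwards [measure_eq_zero_iff_ae_notMem.1 (volume_frontier_eq_zero S.ordConnected_I)]
      with x hx hxA
    refine ⟨hxA, by_contra fun hxI => hx ⟨subset_closure (hAI hxA), hxI⟩⟩
  have h2 : volume (S.map '' E) ≤ ENNReal.ofReal B * volume E := by
    have := lintegral_map_image hEK hEm fun _ => 1
    simp only [mul_one, setLIntegral_const, one_mul] at this
    rw [this, ← setLIntegral_const]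
    exact setLIntegral_mono measurable_const fun x hx => ENNReal.ofReal_le_ofReal (hB' x (hEK hx))
  have h3 : volume.real A ≤ B * volume.real E := by
    have := ENNReal.toReal_mono (ENNReal.mul_ne_top ENNReal.ofReal_ne_top hEt) (h1.trans h2)
    rwa [ENNReal.toReal_mul, ENNReal.toReal_ofReal hB.le] at this
  calc c / B * volume.real A ≤ c / B * (B * volume.real E) := by gcongr
    _ = c * volume.real E := by field_simp
    _ ≤ ν.real (S.map ⁻¹' E \ S.K γ) := hc' E hEm inter_subset_right
    _ ≤ ν.real (S.map ⁻¹' E) := measureReal_mono sdiff_subset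
    _ = ν.real E := by
        rw [measureReal_def, H.measurePreserving.measure_preimage hEm.nullMeasurableSet,
          measureReal_def]
    _ ≤ _ := measureReal_mono (inter_subset_inter_right _ interior_subset)

/-- As `ν A ≤ C |A|`, the part of the preimage outside `K β` carries at least the fraction `c / C`
of `ν A`. Giving away half of this fraction makes the inequality strict. -/
theorem ae_lt_mul_of_le_measure_diff [Countable ι] (H : S.IsInvariantDensity ν h C)
    (hI : volume S.I < ⊤) {D : Set ℝ} (hD : MeasurableSet D) {c : ℝ} (hc : 0 < c) (hcC : c ≤ C)
    (hA : ∀ A, MeasurableSet A → A ⊆ D → A ⊆ S.I →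
      c * volume.real A ≤ ν.real (S.map ⁻¹' A \ S.K β)) :
    ∀ᵐ x ∂ν, x ∈ S.K β → S.map x ∈ D → h x < (1 - c / (2 * C)) * (S.jac x * h (S.map x)) := by
  have := H.isProbabilityMeasure
  have hC := H.bound_pos
  have hτ : 0 < 1 - c / (2 * C) := by
    rw [sub_pos, div_lt_one (by positivity)]; linarith
  refine H.ae_lt_mul_of_preimage hD hτ.le fun A hAm hAD hAI hA0 => ?_
  have h1 := hA A hAm hAD hAI
  have h2 : ν.real A ≤ C * volume.real A := by
    have hAt : volume A ≠ ⊤ := ((measure_mono hAI).trans_lt hI).ne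
    have := ENNReal.toReal_mono (ENNReal.mul_ne_top ENNReal.ofReal_ne_top hAt) (H.apply_le A)
    rwa [ENNReal.toReal_mul, ENNReal.toReal_ofReal hC.le] at this
  have h3 : ν.real (S.map ⁻¹' A ∩ S.K β) + ν.real (S.map ⁻¹' A \ S.K β) = ν.real A := by
    rw [measureReal_def, measureReal_def, measureReal_def, ← H.preimage_inter_add_diff hAm β,
      ENNReal.toReal_add (measure_ne_top _ _) (measure_ne_top _ _)]
  have h4 : 0 < ν.real A := ENNReal.toReal_pos
    (by rwa [Ne, H.apply_eq_zero hAI]) (measure_ne_top _ _)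
  have h5 : c / C * ν.real A ≤ c * volume.real A := by
    calc c / C * ν.real A ≤ c / C * (C * volume.real A) := by gcongr
      _ = _ := by field_simp
  have h6 : c / (2 * C) * ν.real A < c / C * ν.real A := by
    gcongr
    linarith
  rw [← ENNReal.ofReal_toReal (measure_ne_top ν (S.map ⁻¹' A ∩ S.K β)),
    ← ENNReal.ofReal_toReal (measure_ne_top ν A), ← ENNReal.ofReal_mul hτ.le]
  refine (ENNReal.ofReal_lt_ofReal_iff (by positivity)).2 ?_
  change ν.real _ < _ * ν.real A
  linarith

/-- The density is bounded away from zero. -/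
theorem exists_ae_le [Countable ι] (H : S.IsInvariantDensity ν h C)
    (hI : volume S.I < ⊤) (hfull : S.IsFull γ) (hγ : S.IsAvoided γ) :
    ∃ c : ℝ, 0 < c ∧ ∀ᵐ x ∂ν, c ≤ h x := by
  have := H.isProbabilityMeasure
  obtain ⟨c, hc, hA⟩ := H.exists_le_measure_preimage_inter hI hfull hγ
  refine ⟨c / 2, by positivity, ?_⟩
  -- On `A` the density gives `ν A ≤ (c / 2) |A|`, whereas the preimage inside `K γ` alone forces `ν
  -- A ≥ c |A|`; so `A` is null.
  set A : Set ℝ := S.I ∩ {x | h x < c / 2} with hAdef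
  have hAm : MeasurableSet A := (measurableSet_I S).inter (measurableSet_lt H.measurable
    measurable_const)
  have hAt : volume A ≠ ⊤ := ((measure_mono inter_subset_left).trans_lt hI).ne
  have h1 : ν.real A ≤ c / 2 * volume.real A := by
    have : ν A ≤ ENNReal.ofReal (c / 2) * volume A := by
      rw [H.apply hAm, ← setLIntegral_const]
      exact setLIntegral_mono measurable_const fun x hx => ENNReal.ofReal_le_ofReal hx.2.le
    have := ENNReal.toReal_mono (ENNReal.mul_ne_top ENNReal.ofReal_ne_top hAt) this
    rwa [ENNReal.toReal_mul, ENNReal.toReal_ofReal (by positivity)] at this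
  have h2 : c * volume.real A ≤ ν.real A := by
    refine (hA A hAm inter_subset_left).trans ?_
    rw [measureReal_def, measureReal_def, ← H.measurePreserving.measure_preimage hAm.nullMeasurableSet]
    exact measureReal_mono inter_subset_left
  have h3 : volume.real A ≤ 0 := by
    by_contra! hpos
    have := mul_pos hc hpos
    linarith
  have h4 : volume A = 0 := by
    rcases (ENNReal.toReal_eq_zero_iff _).1 (le_antisymm h3 ENNReal.toReal_nonneg) with h | h
    exacts [h, absurd h hAt]
  rw [H.ae_iff]
  filter_upwards [measure_eq_zero_iff_ae_notMem.1 h4] with x hx hxI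
  by_contra! hlt
  exact hx ⟨hxI, hlt⟩

/-- Two steps of the map expand by a definite factor, relative to the density. -/
theorem exists_ae_le_mul_jacIter_two [Countable ι] (H : S.IsInvariantDensity ν h C)
    (hI : volume S.I < ⊤) (hfull : S.IsFull γ) (hγ : S.IsAvoided γ) :
    ∃ τ : ℝ, 0 < τ ∧ τ < 1 ∧ ∀ᵐ x ∂ν, h x ≤ τ * (S.jacIter 2 x * h (S.map^[2] x)) := by
  have := H.isProbabilityMeasure
  have hC := H.bound_pos
  obtain ⟨c₁, hc₁, hA₁⟩ := H.exists_le_measure_preimage_diff hI hfull hγ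
  obtain ⟨c₂, hc₂, hA₂⟩ := H.exists_le_measure_preimage_inter hI hfull hγ
  -- Including `C` in the minimum keeps `τ = 1 - c / (2 * C)` positive.
  set c := min C (min c₁ c₂) with hcdef
  have hc : 0 < c := lt_min hC (lt_min hc₁ hc₂)
  have hcC : c ≤ C := min_le_left _ _
  have hcc₁ : c ≤ c₁ := (min_le_right _ _).trans (min_le_left _ _)
  have hcc₂ : c ≤ c₂ := (min_le_right _ _).trans (min_le_right _ _)
  set τ := 1 - c / (2 * C) with hτdef
  have hτ0 : 0 < τ := by
    rw [hτdef, sub_pos, div_lt_one (by positivity)]; linarith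
  have hτ1 : τ < 1 := by
    rw [hτdef, sub_lt_self_iff]; positivity
  have e1 : ∀ᵐ x ∂ν, x ∈ S.K γ → S.map x ∈ interior (S.K γ) →
      h x < τ * (S.jac x * h (S.map x)) := by
    refine H.ae_lt_mul_of_le_measure_diff hI isOpen_interior.measurableSet hc hcC
      fun A hA hAD _ => le_trans ?_ (hA₁ A hA hAD)
    gcongr
  have e2 : ∀ᵐ x ∂ν, ∀ β, x ∈ S.K β → β ≠ γ → h x < τ * (S.jac x * h (S.map x)) := by
    refine ae_all_iff.2 fun β => ?_
    by_cases hβ : β = γ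
    · exact Eventually.of_forall fun x _ h => absurd hβ h
    · have := H.ae_lt_mul_of_le_measure_diff (β := β) hI MeasurableSet.univ hc hcC
        fun A hA _ hAI => by
          refine le_trans ?_ ((hA₂ A hA hAI).trans (measureReal_mono ?_))
          · gcongr
          · rintro x ⟨hx1, hx2⟩
            exact ⟨hx1, fun hx3 => hβ (eq_of_mem hx3 hx2)⟩
      filter_upwards [this] with x hx h1 _ using hx h1 (mem_univ _)
  refine ⟨τ, hτ0, hτ1, ?_⟩
  filter_upwards [H.ae_iterate (e1.and (e2.and (H.ae_lt_jac_mul.and H.ae_mem_interior)))] with x hx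
  have hx0 := hx 0
  have hx1 := hx 1
  simp only [Function.iterate_zero, id_eq, Function.iterate_one] at hx0 hx1
  have hj0 := jac_pos (S := S) x
  have hj1 := jac_pos (S := S) (S.map x)
  have hexp : S.jacIter 2 x * h (S.map^[2] x) =
      S.jac x * (S.jac (S.map x) * h (S.map (S.map x))) := by
    simp only [jacIter, Finset.prod_range_succ, Finset.range_zero, Finset.prod_empty,
      Function.iterate_succ_apply, Function.iterate_zero_apply]
    ring
  rw [hexp]
  have firstStep : h x < τ * (S.jac x * h (S.map x)) →
      h x ≤ τ * (S.jac x * (S.jac (S.map x) * h (S.map (S.map x)))) := fun hlt =>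
    hlt.le.trans (by gcongr; exact hx1.2.2.1.le)
  have secondStep : h (S.map x) < τ * (S.jac (S.map x) * h (S.map (S.map x))) →
      h x ≤ τ * (S.jac x * (S.jac (S.map x) * h (S.map (S.map x)))) := fun hlt => by
    calc h x ≤ S.jac x * h (S.map x) := hx0.2.2.1.le
      _ ≤ S.jac x * (τ * (S.jac (S.map x) * h (S.map (S.map x)))) := by gcongr
      _ = _ := by ring
  obtain ⟨β₀, hβ₀⟩ := hx0.2.2.2
  obtain ⟨β₁, hβ₁⟩ := hx1.2.2.2
  -- A definite gain occurs when leaving a point outside `K γ`, or when staying in `K γ` for one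
  -- step. If `x` is in `K γ` and `T x` is not, the gain occurs at the second step.
  by_cases h0 : β₀ = γ
  · by_cases h1 : β₁ = γ
    · exact firstStep (hx0.1 (h0 ▸ interior_subset hβ₀) (h1 ▸ hβ₁))
    · exact secondStep (hx1.2.1 β₁ (interior_subset hβ₁) h1)
  · exact firstStep (hx0.2.1 β₀ (interior_subset hβ₀) h0)

/-- Iterating the two-step estimate with `c ≤ h ≤ C` makes `jacIter (2 * k)` at least `c / (C * τ ^
k)`, which exceeds `2` for large `k`. -/
theorem exists_ae_two_le_jacIter [Countable ι] (H : S.IsInvariantDensity ν h C)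
    (hI : volume S.I < ⊤) (hfull : S.IsFull γ) (hγ : S.IsAvoided γ) :
    ∃ r : ℕ, 1 ≤ r ∧ ∀ᵐ x ∂ν, 2 ≤ S.jacIter r x := by
  have hC := H.bound_pos
  obtain ⟨τ, hτ0, hτ1, hτ⟩ := H.exists_ae_le_mul_jacIter_two hI hfull hγ
  obtain ⟨c, hc, hch⟩ := H.exists_ae_le hI hfull hγ
  have key : ∀ k : ℕ, ∀ᵐ x ∂ν, h x ≤ τ ^ k * (S.jacIter (2 * k) x * h (S.map^[2 * k] x)) := by
    intro k
    filter_upwards [H.ae_iterate hτ] with x hx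
    induction k with
    | zero => simp [jacIter]
    | succ k ih =>
      refine ih.trans ?_
      have hpos := (jacIter_pos (S := S) (2 * k) x).le
      calc τ ^ k * (S.jacIter (2 * k) x * h (S.map^[2 * k] x))
          ≤ τ ^ k * (S.jacIter (2 * k) x * (τ * (S.jacIter 2 (S.map^[2 * k] x) *
              h (S.map^[2] (S.map^[2 * k] x))))) := by gcongr; exact hx _
        _ = _ := by
            rw [mul_add, mul_one, jacIter_add, ← Function.iterate_add_apply, add_comm 2]
            ring
  obtain ⟨k, hk⟩ := exists_pow_lt_of_lt_one (show 0 < c / (2 * C) by positivity) hτ1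
  refine ⟨2 * (k + 1), by omega, ?_⟩
  filter_upwards [key (k + 1), hch] with x hx hcx
  have hpos := jacIter_pos (S := S) (2 * (k + 1)) x
  have hk' : τ ^ (k + 1) ≤ c / (2 * C) := by
    rw [pow_succ]
    exact (mul_le_of_le_one_right (by positivity) hτ1.le).trans hk.le
  have h1 : c ≤ c / (2 * C) * (S.jacIter (2 * (k + 1)) x * C) := by
    refine hcx.trans (hx.trans ?_)
    gcongr
    · exact mul_nonneg hpos.le (H.nonneg _)
    · exact H.le _
  have h2 : c / (2 * C) * (S.jacIter (2 * (k + 1)) x * C) = c * (S.jacIter (2 * (k + 1)) x / 2) := by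
    field_simp
  rw [h2] at h1
  have := le_of_mul_le_mul_left (by linarith : c * 1 ≤ c * (S.jacIter (2 * (k + 1)) x / 2)) hc
  linarith

theorem eventuallyExpansive [Countable ι] (H : S.IsInvariantDensity ν h C) (hI : volume S.I < ⊤)
    (hfull : S.IsFull γ) (hγ : S.IsAvoided γ) : S.EventuallyExpansive := by
  obtain ⟨r, hr, hae⟩ := H.exists_ae_two_le_jacIter hI hfull hγ
  refine ⟨r, hr, 2, one_lt_two, fun x hx => ?_⟩
  choose w hw using fun i : Fin r => hx i i.2
  obtain ⟨A, hA, -⟩ := exists_isBranch_openCylinder hI w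
  have hxJ : x ∈ S.openCylinder w := by
    refine ⟨?_, hw⟩
    exact interior_mono (K_subset_I _) (hw ⟨0, hr⟩)
  have hderiv : deriv (S.map^[r]) x = deriv (mobius A) x := by
    refine EventuallyEq.deriv_eq ?_
    filter_upwards [hA.isOpen.mem_nhds hxJ] with y hy using hA.iterate_eq y hy
  rw [hderiv, abs_deriv_mobius (hA.denom_ne x hxJ)]
  have hcont : ContinuousOn (mobiusJac A) (S.openCylinder w) :=
    continuousOn_const.div ((continuous_mobiusDenom A).pow 2).continuousOn
      fun y hy => pow_ne_zero 2 (hA.denom_ne y hy)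
  have hopen := hcont.isOpen_inter_preimage hA.isOpen (isOpen_Iio (a := (2 : ℝ)))
  -- The derivative is continuous on the open cylinder, so the set where it falls below `2` is open
  -- and null, hence empty. The bound thus holds everywhere.
  have hempty : S.openCylinder w ∩ mobiusJac A ⁻¹' Iio 2 = ∅ := by
    refine hopen.eq_empty_of_measure_zero (μ := volume) ?_
    rw [measure_eq_zero_iff_ae_notMem]
    filter_upwards [H.ae_iff.1 hae] with y hy
    rintro ⟨hyJ, hy2⟩
    have := hy (mem_I_of_mem_openCylinder hyJ)
    rw [hA.jacIter_eq y hyJ] at this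
    exact absurd hy2 (not_lt.2 this)
  by_contra! hlt
  exact (hempty ▸ (⟨hxJ, hlt⟩ : x ∈ S.openCylinder w ∩ mobiusJac A ⁻¹' Iio 2) : x ∈ (∅ : Set ℝ))

end IsInvariantDensity

end PiecewiseMobius

/-! ### Planar Möbius maps and their invariant measure -/

/-- The conjugate `R A R⁻¹`. -/
noncomputable def conjRot (A : Matrix (Fin 2) (Fin 2) ℝ) : Matrix (Fin 2) (Fin 2) ℝ :=
  rotMatrix * A * rotMatrix⁻¹

theorem conjRot_eq (A : Matrix (Fin 2) (Fin 2) ℝ) :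
    conjRot A = !![A 1 1, -A 1 0; -A 0 1, A 0 0] := by
  have h : rotMatrix⁻¹ = !![0, 1; -1, 0] := by
    refine Matrix.inv_eq_right_inv ?_
    ext i j; fin_cases i <;> fin_cases j <;> simp [rotMatrix, Matrix.mul_apply]
  rw [conjRot, h, Matrix.eta_fin_two A, rotMatrix, Matrix.mul_fin_two, Matrix.mul_fin_two]
  simp

theorem det_conjRot (A : Matrix (Fin 2) (Fin 2) ℝ) : (conjRot A).det = A.det := by
  rw [conjRot_eq, Matrix.det_fin_two, Matrix.det_fin_two]
  simp; ring

theorem planarMobius_eq (A : Matrix (Fin 2) (Fin 2) ℝ) (p : ℝ × ℝ) :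
    planarMobius A p = (mobius A p.1, mobius (conjRot A) p.2) := rfl

section

variable {A : Matrix (Fin 2) (Fin 2) ℝ} {x y : ℝ}

/-- `1 + x y` is the pairing of `(x, 1)` with `(y, 1)`, and `conjRot A` is the transpose of the
adjugate, so the pairing is multiplied by `det A` before the vectors are renormalized. -/
theorem one_add_mobius_mul (hx : mobiusDenom A x ≠ 0) (hy : mobiusDenom (conjRot A) y ≠ 0) :
    1 + mobius A x * mobius (conjRot A) y =
      A.det * (1 + x * y) / (mobiusDenom A x * mobiusDenom (conjRot A) y) := by
  rw [eq_div_iff (mul_ne_zero hx hy)]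
  have h1 := mobius_mul_denom hx
  have h2 := mobius_mul_denom hy
  have h3 : (1 + mobius A x * mobius (conjRot A) y) * (mobiusDenom A x * mobiusDenom (conjRot A) y)
      = mobiusDenom A x * mobiusDenom (conjRot A) y +
        (mobius A x * mobiusDenom A x) * (mobius (conjRot A) y * mobiusDenom (conjRot A) y) := by
    ring
  rw [h3, h1, h2, mobiusDenom, mobiusDenom, conjRot_eq, Matrix.det_fin_two]
  simp
  ring

/-- In the coordinate `z = y / (1 + x y)` the fiber maps are affine. -/
theorem fiberCoord_mobius (hA : A.det ≠ 0) (hx : mobiusDenom A x ≠ 0)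
    (hy : mobiusDenom (conjRot A) y ≠ 0) (hxy : 1 + x * y ≠ 0) :
    mobius (conjRot A) y / (1 + mobius A x * mobius (conjRot A) y) =
      mobiusDenom A x ^ 2 / A.det * (y / (1 + x * y)) - A 1 0 * mobiusDenom A x / A.det := by
  rw [one_add_mobius_mul hx hy]
  have h2 := mobius_mul_denom hy
  rw [div_div_eq_mul_div, div_eq_iff (mul_ne_zero hA hxy)]
  have h3 : mobius (conjRot A) y * (mobiusDenom A x * mobiusDenom (conjRot A) y) =
      (A 1 1 * y - A 1 0) * mobiusDenom A x := by
    rw [mul_left_comm, h2, conjRot_eq]; simp; ring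
  have h4 : (mobiusDenom A x ^ 2 / A.det * (y / (1 + x * y)) - A 1 0 * mobiusDenom A x / A.det) *
      (A.det * (1 + x * y)) = mobiusDenom A x ^ 2 * y - A 1 0 * mobiusDenom A x * (1 + x * y) := by
    generalize 1 + x * y = u at hxy ⊢
    field_simp
  rw [h3, h4, mobiusDenom]
  ring

theorem hasFDerivAt_planarMobius {p : ℝ × ℝ} (hx : mobiusDenom A p.1 ≠ 0)
    (hy : mobiusDenom (conjRot A) p.2 ≠ 0) :
    HasFDerivAt (planarMobius A)
      ((ContinuousLinearMap.toSpanSingleton ℝ (A.det / mobiusDenom A p.1 ^ 2)).prodMap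
        (ContinuousLinearMap.toSpanSingleton ℝ (A.det / mobiusDenom (conjRot A) p.2 ^ 2))) p := by
  have h1 := (hasDerivAt_mobius hx).hasFDerivAt
  have h2 := (hasDerivAt_mobius hy).hasFDerivAt
  rw [det_conjRot] at h2
  exact h1.prodMap p h2

theorem det_prodMap_toSpanSingleton (a b : ℝ) :
    ((ContinuousLinearMap.toSpanSingleton ℝ a).prodMap
      (ContinuousLinearMap.toSpanSingleton ℝ b)).det = a * b := by
  rw [ContinuousLinearMap.det]
  have : (((ContinuousLinearMap.toSpanSingleton ℝ a).prodMap
      (ContinuousLinearMap.toSpanSingleton ℝ b) : (ℝ × ℝ) →L[ℝ] ℝ × ℝ) : (ℝ × ℝ) →ₗ[ℝ] ℝ × ℝ) =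
      LinearMap.prodMap (LinearMap.toSpanSingleton ℝ ℝ a) (LinearMap.toSpanSingleton ℝ ℝ b) := rfl
  rw [this, LinearMap.det_prodMap, LinearMap.det_ring, LinearMap.det_ring]
  simp

theorem injOn_planarMobius {E : Set (ℝ × ℝ)} (hA : A.det ≠ 0)
    (hE : ∀ p ∈ E, mobiusDenom A p.1 ≠ 0 ∧ mobiusDenom (conjRot A) p.2 ≠ 0) :
    InjOn (planarMobius A) E := by
  intro p hp q hq h
  rw [planarMobius_eq, planarMobius_eq, Prod.mk.injEq] at h
  exact Prod.ext (mobius_injective_of_denom hA (hE p hp).1 (hE q hq).1 h.1)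
    (mobius_injective_of_denom (by rwa [det_conjRot]) (hE p hp).2 (hE q hq).2 h.2)

theorem measurable_planarDensity :
    Measurable fun p : ℝ × ℝ => ENNReal.ofReal (1 / (1 + p.1 * p.2) ^ 2) := by
  fun_prop

theorem planarMeasure_apply {E : Set (ℝ × ℝ)} (hE : MeasurableSet E) :
    planarMeasure E = ∫⁻ p in E, ENNReal.ofReal (1 / (1 + p.1 * p.2) ^ 2) := by
  rw [planarMeasure, withDensity_apply _ hE]

theorem planarMeasure_absolutelyContinuous : planarMeasure ≪ (volume : Measure (ℝ × ℝ)) :=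
  withDensity_absolutelyContinuous _ _

/-- The planar Möbius maps preserve the measure `dx dy / (1 + x y)²`. -/
theorem planarMeasure_image_planarMobius {E : Set (ℝ × ℝ)} (hA : A.det ≠ 0) (hEm : MeasurableSet E)
    (hE : ∀ p ∈ E, mobiusDenom A p.1 ≠ 0 ∧ mobiusDenom (conjRot A) p.2 ≠ 0) :
    planarMeasure (planarMobius A '' E) = planarMeasure E := by
  have hderiv : ∀ p ∈ E, HasFDerivWithinAt (planarMobius A)
      ((ContinuousLinearMap.toSpanSingleton ℝ (A.det / mobiusDenom A p.1 ^ 2)).prodMap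
        (ContinuousLinearMap.toSpanSingleton ℝ (A.det / mobiusDenom (conjRot A) p.2 ^ 2))) E p :=
    fun p hp => (hasFDerivAt_planarMobius (hE p hp).1 (hE p hp).2).hasFDerivWithinAt
  have hinj := injOn_planarMobius hA hE
  have himg : MeasurableSet (planarMobius A '' E) :=
    hEm.image_of_continuousOn_injOn (fun p hp => (hderiv p hp).continuousWithinAt) hinj
  rw [planarMeasure_apply himg, planarMeasure_apply hEm,
    lintegral_image_eq_lintegral_abs_det_fderiv_mul volume hEm hderiv hinj]
  refine setLIntegral_congr_fun hEm fun p hp => ?_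
  have hx := (hE p hp).1
  have hy := (hE p hp).2
  simp only [det_prodMap_toSpanSingleton, planarMobius_eq]
  rw [← ENNReal.ofReal_mul (abs_nonneg _), one_add_mobius_mul hx hy, div_mul_div_comm, abs_div,
    abs_of_nonneg (mul_self_nonneg A.det), abs_of_nonneg (by positivity)]
  congr 1
  -- On the curve both densities are `0` by the convention for division by zero.
  by_cases hxy : 1 + p.1 * p.2 = 0
  · simp [hxy]
  · field_simp

end

/-! ### Invariance of the planar measure on `Ω` -/

namespace PiecewiseMobius

variable {ι : Type*} {S : PiecewiseMobius ι} {β : ι}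

/-- The points at which the planar map has no pole. -/
def regularPoints (S : PiecewiseMobius ι) : Set (ℝ × ℝ) :=
  {p | ∀ β, p.1 ∈ S.K β → mobiusDenom (conjRot (S.M β)) p.2 ≠ 0}

theorem volume_pole_eq_zero {A : Matrix (Fin 2) (Fin 2) ℝ} (hA : A.det ≠ 0) :
    volume {p : ℝ × ℝ | mobiusDenom A p.2 = 0} = 0 := by
  have hsub : {y : ℝ | mobiusDenom A y = 0}.Subsingleton := by
    intro y hy z hz
    simp only [mem_ofPred_eq, mobiusDenom] at hy hz
    have hc : A 1 0 ≠ 0 := by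
      intro h0
      rw [h0, zero_mul, zero_add] at hy
      exact hA (by rw [Matrix.det_fin_two, h0, hy]; ring)
    exact mul_left_cancel₀ hc (by linarith)
  have h0 : volume {y : ℝ | mobiusDenom A y = 0} = 0 := hsub.measure_zero volume
  exact (Measure.quasiMeasurePreserving_snd (μ := (volume : Measure ℝ))
    (ν := (volume : Measure ℝ))).preimage_null h0

theorem volume_compl_regularPoints [Countable ι] (S : PiecewiseMobius ι) :
    volume (S.regularPoints)ᶜ = 0 := by
  refine measure_mono_null (t := ⋃ β, {p : ℝ × ℝ | mobiusDenom (conjRot (S.M β)) p.2 = 0}) ?_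
    (measure_iUnion_null fun β => volume_pole_eq_zero (by rw [det_conjRot]; exact S.det_ne_zero β))
  intro p hp
  simp only [regularPoints, mem_compl_iff, mem_ofPred_eq, not_forall, not_not] at hp
  obtain ⟨β, -, hβ⟩ := hp
  exact mem_iUnion.2 ⟨β, hβ⟩

theorem measurableSet_regularPoints [Countable ι] (S : PiecewiseMobius ι) :
    MeasurableSet S.regularPoints := by
  have : S.regularPoints = ⋂ β, ((Prod.fst ⁻¹' S.K β)ᶜ ∪
      (fun p : ℝ × ℝ => mobiusDenom (conjRot (S.M β)) p.2) ⁻¹' {0}ᶜ) := by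
    ext p
    simp only [regularPoints, mem_ofPred_eq, mem_iInter, mem_union, mem_compl_iff, mem_preimage,
      mem_singleton_iff, imp_iff_not_or, Ne]
  rw [this]
  refine MeasurableSet.iInter fun β => ?_
  refine (measurable_fst (measurableSet_K β)).compl.union ?_
  exact ((continuous_mobiusDenom _).measurable.comp measurable_snd)
    (measurableSet_singleton (0 : ℝ)).compl

theorem planarMap_image {E : Set (ℝ × ℝ)} (hE : E ⊆ Prod.fst ⁻¹' S.K β) :
    S.planarMap '' E = planarMobius (S.M β) '' E :=
  image_congr fun _ hp => planarMap_eq (hE hp)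

theorem planarMeasure_image_of_subset_cylinder {E : Set (ℝ × ℝ)} (hEm : MeasurableSet E)
    (hE : E ⊆ Prod.fst ⁻¹' S.K β) (hreg : E ⊆ S.regularPoints) :
    planarMeasure (S.planarMap '' E) = planarMeasure E := by
  rw [planarMap_image hE]
  exact planarMeasure_image_planarMobius (S.det_ne_zero β) hEm
    fun p hp => ⟨mobiusDenom_ne (hE hp), hreg hp β (hE hp)⟩

/-- At a pole the second coordinate of the image is `0` by the convention for division by zero, so
the image lies in a horizontal line. -/
theorem planarMeasure_image_diff_regularPoints (S : PiecewiseMobius ι) (E : Set (ℝ × ℝ)) :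
    planarMeasure (S.planarMap '' (E \ S.regularPoints)) = 0 := by
  refine planarMeasure_absolutelyContinuous ?_
  have h0 : volume {p : ℝ × ℝ | p.2 = 0} = 0 :=
    (Measure.quasiMeasurePreserving_snd (μ := (volume : Measure ℝ))
      (ν := (volume : Measure ℝ))).preimage_null (s := {0}) (measure_singleton 0)
  refine measure_mono_null ?_ h0
  rintro _ ⟨p, ⟨-, hp⟩, rfl⟩
  simp only [regularPoints, mem_ofPred_eq, not_forall, not_not] at hp
  obtain ⟨β, hβ, hden⟩ := hp
  rw [planarMap_eq hβ, planarMobius_eq, mem_ofPred_eq]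
  change mobius (conjRot (S.M β)) p.2 = 0
  rw [mobius_eq, hden, div_zero]

/-- The planar map sends null sets to null sets. -/
theorem planarMeasure_image_eq_zero [Countable ι] {E : Set (ℝ × ℝ)} (hE : E ⊆ Prod.fst ⁻¹' S.I)
    (h0 : planarMeasure E = 0) : planarMeasure (S.planarMap '' E) = 0 := by
  set N := toMeasurable planarMeasure E with hN
  have hN0 : planarMeasure N = 0 := by rw [hN, measure_toMeasurable, h0]
  have hNm : MeasurableSet N := measurableSet_toMeasurable _ _
  have hsub : S.planarMap '' E ⊆ S.planarMap '' (E \ S.regularPoints) ∪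
      ⋃ β, S.planarMap '' (N ∩ Prod.fst ⁻¹' S.K β ∩ S.regularPoints) := by
    rintro _ ⟨p, hp, rfl⟩
    by_cases hreg : p ∈ S.regularPoints
    · obtain ⟨β, hβ⟩ := exists_mem_K (hE hp)
      exact Or.inr (mem_iUnion.2 ⟨β, p, ⟨⟨subset_toMeasurable _ _ hp, hβ⟩, hreg⟩, rfl⟩)
    · exact Or.inl ⟨p, ⟨hp, hreg⟩, rfl⟩
  refine measure_mono_null hsub (measure_union_null (S.planarMeasure_image_diff_regularPoints E)
    (measure_iUnion_null fun β => ?_))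
  rw [planarMeasure_image_of_subset_cylinder (β := β)
    ((hNm.inter (measurable_fst (measurableSet_K β))).inter S.measurableSet_regularPoints)
    (fun p hp => hp.1.2) (fun p hp => hp.2)]
  exact measure_mono_null (fun p hp => hp.1.1) hN0

/-- The planar map preserves the measure of sets on which it is injective. -/
theorem planarMeasure_image_of_injOn [Countable ι] {E : Set (ℝ × ℝ)} (hEm : MeasurableSet E)
    (hE : E ⊆ Prod.fst ⁻¹' S.I) (hinj : InjOn S.planarMap E) :
    planarMeasure (S.planarMap '' E) = planarMeasure E := by
  set P : ι → Set (ℝ × ℝ) := fun β => E ∩ Prod.fst ⁻¹' S.K β ∩ S.regularPoints with hP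
  have hPm : ∀ β, MeasurableSet (P β) := fun β =>
    (hEm.inter (measurable_fst (measurableSet_K β))).inter S.measurableSet_regularPoints
  have hPE : ∀ β, P β ⊆ E := fun β p hp => hp.1.1
  have hPd : Pairwise (Function.onFun Disjoint P) := fun β γ hβγ =>
    disjoint_left.2 fun p hp hp' => hβγ (eq_of_mem hp.1.2 hp'.1.2)
  have hU : ⋃ β, P β = E ∩ S.regularPoints := by
    ext p
    simp only [hP, mem_iUnion, mem_inter_iff, mem_preimage]
    constructor
    · rintro ⟨β, ⟨h1, -⟩, h2⟩; exact ⟨h1, h2⟩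
    · rintro ⟨h1, h2⟩
      obtain ⟨β, hβ⟩ := exists_mem_K (hE h1)
      exact ⟨β, ⟨h1, hβ⟩, h2⟩
  have hregE : planarMeasure (E \ S.regularPoints) = 0 :=
    planarMeasure_absolutelyContinuous (measure_mono_null (fun p hp => hp.2)
      S.volume_compl_regularPoints)
  have h1 : planarMeasure (S.planarMap '' E) = planarMeasure (S.planarMap '' ⋃ β, P β) := by
    refine le_antisymm ?_ (measure_mono (image_mono (iUnion_subset hPE)))
    rw [hU]
    calc planarMeasure (S.planarMap '' E)
        = planarMeasure (S.planarMap '' (E ∩ S.regularPoints) ∪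
            S.planarMap '' (E \ S.regularPoints)) := by
          rw [← image_union, inter_union_sdiff]
      _ ≤ _ := measure_union_le _ _
      _ = _ := by rw [S.planarMeasure_image_diff_regularPoints E, add_zero]
  have h2 : planarMeasure E = planarMeasure (⋃ β, P β) := by
    rw [hU, ← measure_inter_add_sdiff E S.measurableSet_regularPoints, hregE, add_zero]
  rw [h1, h2, image_iUnion, measure_iUnion hPd hPm, measure_iUnion]
  · exact tsum_congr fun β => planarMeasure_image_of_subset_cylinder (hPm β)
      (fun p hp => hp.1.2) fun p hp => hp.2
  · exact fun β γ hβγ => by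
      refine disjoint_left.2 ?_
      rintro _ ⟨p, hp, rfl⟩ ⟨q, hq, hpq⟩
      rw [hinj (hPE γ hq) (hPE β hp) hpq] at hq
      exact disjoint_left.1 (hPd hβγ) hp hq
  · exact fun β => (hPm β).image_of_measurable_injOn S.measurable_planarMap (hinj.mono (hPE β))

namespace IsPlanarExtension

variable {Ω : Set (ℝ × ℝ)}

theorem fst_mem (hΩ : S.IsPlanarExtension Ω) {p : ℝ × ℝ} (hp : p ∈ Ω) : p.1 ∈ S.I := by
  rw [← hΩ.image_fst]; exact mem_image_of_mem _ hp

/-- A Borel set of full measure on which the planar map is injective with image of full measure. -/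
theorem exists_measurableSet [Countable ι] (hΩ : S.IsPlanarExtension Ω) :
    ∃ X, MeasurableSet X ∧ X ⊆ Ω ∧ planarMeasure (Ω \ X) = 0 ∧ InjOn S.planarMap X ∧
      S.planarMap '' X ⊆ Ω ∧ planarMeasure (Ω \ S.planarMap '' X) = 0 := by
  obtain ⟨Ω₀, Ω₁, h0, h1, h0', h1', hbij⟩ := hΩ.bijective
  -- `Ω₀` need not be measurable; removing a measurable null hull repairs this, and the image of the
  -- removed part is again null.
  set N := toMeasurable planarMeasure (Ω \ Ω₀) with hN
  have hN0 : planarMeasure N = 0 := by rw [hN, measure_toMeasurable, h0']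
  have hX0 : Ω \ N ⊆ Ω₀ := fun p hp => by_contra fun h =>
    hp.2 (subset_toMeasurable _ _ ⟨hp.1, h⟩)
  refine ⟨Ω \ N, hΩ.measurableSet.diff (measurableSet_toMeasurable _ _), sdiff_subset,
    measure_mono_null (fun p hp => by_contra fun h => hp.2 ⟨hp.1, h⟩) hN0, hbij.injOn.mono hX0,
    (image_mono hX0).trans (hbij.image_eq.subset.trans h1), ?_⟩
  have hsub : Ω \ S.planarMap '' (Ω \ N) ⊆ (Ω \ Ω₁) ∪ S.planarMap '' (Ω₀ ∩ N) := by
    rintro p ⟨hp, hp'⟩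
    by_cases hp1 : p ∈ Ω₁
    · right
      rw [← hbij.image_eq] at hp1
      obtain ⟨q, hq, rfl⟩ := hp1
      exact ⟨q, ⟨hq, by_contra fun hqN => hp' ⟨q, ⟨h0 hq, hqN⟩, rfl⟩⟩, rfl⟩
    · exact Or.inl ⟨hp, hp1⟩
  refine measure_mono_null hsub (measure_union_null h1' ?_)
  exact planarMeasure_image_eq_zero (fun p hp => hΩ.fst_mem (h0 hp.1))
    (measure_mono_null inter_subset_right hN0)

/-- Up to null sets, the preimage of `E` in `Ω` is its preimage in `X`. This is mapped injectively
onto the part of `E` in the image of `X`, that is, onto almost all of `E ∩ Ω`. -/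
theorem measurePreserving_restrict [Countable ι] (hΩ : S.IsPlanarExtension Ω) :
    MeasurePreserving S.planarMap (planarMeasure.restrict Ω) (planarMeasure.restrict Ω) := by
  obtain ⟨X, hXm, hXΩ, hX, hinj, himg, himg0⟩ := hΩ.exists_measurableSet
  refine ⟨S.measurable_planarMap, Measure.ext fun E hE => ?_⟩
  have hpre := S.measurable_planarMap hE
  rw [Measure.map_apply S.measurable_planarMap hE, Measure.restrict_apply hpre,
    Measure.restrict_apply hE]
  have h1 : planarMeasure (S.planarMap ⁻¹' E ∩ Ω) = planarMeasure (X ∩ S.planarMap ⁻¹' E) := by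
    refine le_antisymm ?_ (measure_mono fun p hp => ⟨hp.2, hXΩ hp.1⟩)
    calc _ ≤ planarMeasure ((X ∩ S.planarMap ⁻¹' E) ∪ (Ω \ X)) := measure_mono fun p hp => by
            by_cases h : p ∈ X
            exacts [Or.inl ⟨h, hp.1⟩, Or.inr ⟨hp.2, h⟩]
      _ ≤ _ := measure_union_le _ _
      _ = _ := by rw [hX, add_zero]
  have h2 : planarMeasure (E ∩ Ω) = planarMeasure (S.planarMap '' X ∩ E) := by
    refine le_antisymm ?_ (measure_mono fun p hp => ⟨hp.2, himg hp.1⟩)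
    calc _ ≤ planarMeasure ((S.planarMap '' X ∩ E) ∪ (Ω \ S.planarMap '' X)) :=
            measure_mono fun p hp => by
              by_cases h : p ∈ S.planarMap '' X
              exacts [Or.inl ⟨h, hp.1⟩, Or.inr ⟨hp.2, h⟩]
      _ ≤ _ := measure_union_le _ _
      _ = _ := by rw [himg0, add_zero]
  rw [h1, h2, ← image_inter_preimage]
  exact (planarMeasure_image_of_injOn (hXm.inter hpre) (fun p hp => hΩ.fst_mem (hXΩ hp.1))
    (hinj.mono inter_subset_left)).symm

end IsPlanarExtension

end PiecewiseMobius

/-! ### Distance from the curve and densities on fibers -/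

section

variable {Ω : Set (ℝ × ℝ)} {δ : ℝ}

/-- Compare `p` with the point of the curve at the same height; the horizontal gap is `|1 + x y| /
|y|`. This later bounds the fiber coordinate `y / (1 + x y)`. -/
theorem mul_abs_snd_le {p : ℝ × ℝ} (hp : ∀ x : ℝ, x ≠ 0 → δ ≤ dist p (x, -1 / x)) :
    δ * |p.2| ≤ |1 + p.1 * p.2| := by
  by_cases hy : p.2 = 0
  · rw [hy]; simp
  · have h := hp (-1 / p.2) (div_ne_zero (by norm_num) hy)
    have h1 : -1 / (-1 / p.2) = p.2 := by field_simp
    rw [h1, Prod.dist_eq, dist_self, Real.dist_eq, max_eq_left (abs_nonneg _)] at h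
    have h2 : p.1 - -1 / p.2 = (1 + p.1 * p.2) / p.2 := by field_simp; ring
    rwa [h2, abs_div, le_div_iff₀ (abs_pos.2 hy)] at h

theorem mul_abs_fst_le {p : ℝ × ℝ} (hp : ∀ x : ℝ, x ≠ 0 → δ ≤ dist p (x, -1 / x)) :
    δ * |p.1| ≤ |1 + p.1 * p.2| := by
  by_cases hx : p.1 = 0
  · rw [hx]; simp
  · have h := hp p.1 hx
    rw [Prod.dist_eq, dist_self, Real.dist_eq, max_eq_right (abs_nonneg _)] at h
    have h2 : p.2 - -1 / p.1 = (1 + p.1 * p.2) / p.1 := by field_simp; ring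
    rwa [h2, abs_div, le_div_iff₀ (abs_pos.2 hx)] at h

/-- Away from the curve `y = -1 / x` the density of the planar measure is bounded. -/
theorem min_le_one_add_mul_sq {p : ℝ × ℝ} (hδ : 0 < δ)
    (hp : ∀ x : ℝ, x ≠ 0 → δ ≤ dist p (x, -1 / x)) :
    min (1 / 4) (δ ^ 2 / 2) ≤ (1 + p.1 * p.2) ^ 2 := by
  by_cases hxy : |p.1 * p.2| ≤ 1 / 2
  -- For `|x y| ≤ 1/2` one has `1 + x y ≥ 1/2`. Otherwise the horizontal and vertical estimates
  -- multiply to `δ² |x y| ≤ (1 + x y)²`.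
  · refine (min_le_left _ _).trans ?_
    rw [abs_le] at hxy
    nlinarith [hxy.1]
  · refine (min_le_right _ _).trans ?_
    have h1 := mul_le_mul (mul_abs_fst_le hp) (mul_abs_snd_le hp) (by positivity) (abs_nonneg _)
    rw [abs_mul_abs_self, mul_mul_mul_comm, ← abs_mul] at h1
    rw [pow_two (1 + _)]
    nlinarith [not_le.1 hxy, mul_pos hδ hδ]

theorem one_add_mul_ne_zero {p : ℝ × ℝ} (hδ : 0 < δ)
    (hp : ∀ x : ℝ, x ≠ 0 → δ ≤ dist p (x, -1 / x)) : 1 + p.1 * p.2 ≠ 0 := fun h => by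
  have := min_le_one_add_mul_sq hδ hp
  rw [h] at this
  have h2 : 0 < min (1 / 4) (δ ^ 2 / 2) := lt_min (by norm_num) (by positivity)
  rw [zero_pow two_ne_zero] at this
  exact absurd this (not_le.2 h2)

/-- The density of the marginal of the planar measure on `Ω`. -/
noncomputable def fiberDensity (Ω : Set (ℝ × ℝ)) (x : ℝ) : ℝ≥0∞ :=
  ∫⁻ y in verticalFiber Ω x, ENNReal.ofReal (1 / (1 + x * y) ^ 2)

theorem measurableSet_verticalFiber (hΩ : MeasurableSet Ω) (x : ℝ) :
    MeasurableSet (verticalFiber Ω x) := measurable_prodMk_left hΩ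

theorem fiberDensity_eq_lintegral_indicator (hΩ : MeasurableSet Ω) (x : ℝ) :
    fiberDensity Ω x = ∫⁻ y, Ω.indicator
      (fun p => ENNReal.ofReal (1 / (1 + p.1 * p.2) ^ 2)) (x, y) := by
  rw [fiberDensity, ← lintegral_indicator (measurableSet_verticalFiber hΩ x)]
  rfl

theorem measurable_fiberDensity (hΩ : MeasurableSet Ω) : Measurable (fiberDensity Ω) := by
  have : fiberDensity Ω = fun x => ∫⁻ y, Ω.indicator
      (fun p => ENNReal.ofReal (1 / (1 + p.1 * p.2) ^ 2)) (x, y) :=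
    funext fun x => fiberDensity_eq_lintegral_indicator hΩ x
  rw [this]
  exact (measurable_planarDensity.indicator hΩ).lintegral_prod_right'

theorem planarMeasure_inter_preimage (hΩ : MeasurableSet Ω) {A : Set ℝ} (hA : MeasurableSet A) :
    planarMeasure (Ω ∩ Prod.fst ⁻¹' A) = ∫⁻ x in A, fiberDensity Ω x := by
  have hm : MeasurableSet (Ω ∩ Prod.fst ⁻¹' A) := hΩ.inter (measurable_fst hA)
  rw [planarMeasure_apply hm, ← lintegral_indicator hm, Measure.volume_eq_prod,
    lintegral_prod _ (measurable_planarDensity.indicator hm).aemeasurable, ← lintegral_indicator hA]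
  refine lintegral_congr fun x => ?_
  by_cases hx : x ∈ A
  · rw [indicator_of_mem hx, fiberDensity_eq_lintegral_indicator hΩ]
    refine lintegral_congr fun y => ?_
    by_cases hy : (x, y) ∈ Ω
    · rw [indicator_of_mem (show (x, y) ∈ Ω ∩ Prod.fst ⁻¹' A from ⟨hy, hx⟩), indicator_of_mem hy]
    · rw [indicator_of_notMem (fun h => hy h.1), indicator_of_notMem hy]
  · rw [indicator_of_notMem hx, ← lintegral_zero (μ := (volume : Measure ℝ))]
    exact lintegral_congr fun y => indicator_of_notMem (fun h => hx h.2) _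

theorem normalizedMeasure_apply {Ω E : Set (ℝ × ℝ)} (hE : MeasurableSet E) :
    normalizedMeasure Ω E = (planarMeasure Ω)⁻¹ * planarMeasure (E ∩ Ω) := by
  rw [normalizedMeasure, Measure.smul_apply, Measure.restrict_apply hE, smul_eq_mul]

theorem marginalMeasure_apply (hΩ : MeasurableSet Ω) {A : Set ℝ} (hA : MeasurableSet A) :
    marginalMeasure Ω A = (planarMeasure Ω)⁻¹ * ∫⁻ x in A, fiberDensity Ω x := by
  rw [marginalMeasure, Measure.map_apply measurable_fst hA,
    normalizedMeasure_apply (measurable_fst hA), inter_comm, planarMeasure_inter_preimage hΩ hA]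

end

/-! ### The marginal as an invariant density -/

namespace PiecewiseMobius

namespace IsPlanarExtension

variable {ι : Type*} {S : PiecewiseMobius ι} {Ω : Set (ℝ × ℝ)} {a b : ℝ≥0∞} {δ : ℝ}

theorem fiberDensity_le (hΩ : S.IsPlanarExtension Ω) (hb : ∀ x ∈ S.I, volume (verticalFiber Ω x) ≤ b)
    (hδ : 0 < δ) (hdist : ∀ p ∈ Ω, ∀ x : ℝ, x ≠ 0 → δ ≤ dist p (x, -1 / x)) {x : ℝ}
    (hx : x ∈ S.I) :
    fiberDensity Ω x ≤ ENNReal.ofReal (1 / min (1 / 4) (δ ^ 2 / 2)) * b := by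
  have hmin : 0 < min (1 / 4) (δ ^ 2 / 2) := lt_min (by norm_num) (by positivity)
  calc fiberDensity Ω x
      ≤ ∫⁻ y in verticalFiber Ω x, ENNReal.ofReal (1 / min (1 / 4) (δ ^ 2 / 2)) := by
        refine setLIntegral_mono' (measurableSet_verticalFiber hΩ.measurableSet x) fun y hy => ?_
        exact ENNReal.ofReal_le_ofReal (one_div_le_one_div_of_le hmin
          (min_le_one_add_mul_sq hδ (hdist (x, y) hy)))
    _ = ENNReal.ofReal (1 / min (1 / 4) (δ ^ 2 / 2)) * volume (verticalFiber Ω x) :=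
        setLIntegral_const _ _
    _ ≤ _ := by gcongr; exact hb x hx

theorem fiberDensity_pos (hΩ : S.IsPlanarExtension Ω)
    (ha : ∀ x ∈ S.I, volume (verticalFiber Ω x) ≠ 0)
    (hδ : 0 < δ) (hdist : ∀ p ∈ Ω, ∀ x : ℝ, x ≠ 0 → δ ≤ dist p (x, -1 / x)) {x : ℝ}
    (hx : x ∈ S.I) : fiberDensity Ω x ≠ 0 := by
  have hm := measurableSet_verticalFiber hΩ.measurableSet x
  rw [fiberDensity, Ne, setLIntegral_eq_zero_iff hm (by fun_prop)]
  intro h0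
  refine ha x hx (measure_eq_zero_iff_ae_notMem.2 ?_)
  filter_upwards [h0] with y hy hyΩ
  have h1 := hy hyΩ
  have h2 := one_add_mul_ne_zero hδ (hdist (x, y) hyΩ)
  rw [ENNReal.ofReal_eq_zero] at h1
  exact absurd h1 (not_le.2 (by positivity))

theorem fiberDensity_eq_zero (hΩ : S.IsPlanarExtension Ω) {x : ℝ} (hx : x ∉ S.I) :
    fiberDensity Ω x = 0 := by
  have : verticalFiber Ω x = ∅ := eq_empty_of_forall_notMem fun y hy => hx (hΩ.fst_mem hy)
  rw [fiberDensity, this, Measure.restrict_empty, lintegral_zero_measure]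

/-- The formal density vanishes only on the curve `1 + x y = 0`, which `Ω` avoids. -/
theorem volume_null_of_planarMeasure_null
    (hδ : 0 < δ) (hdist : ∀ p ∈ Ω, ∀ x : ℝ, x ≠ 0 → δ ≤ dist p (x, -1 / x)) {E : Set (ℝ × ℝ)}
    (hE : E ⊆ Ω) (h0 : planarMeasure E = 0) : volume E = 0 := by
  rw [planarMeasure, withDensity_apply_eq_zero measurable_planarDensity] at h0
  refine measure_mono_null (fun p hp => mem_inter ?_ hp) h0
  have h2 := one_add_mul_ne_zero hδ (hdist p (hE hp))
  rw [mem_ofPred_eq, Ne, ENNReal.ofReal_eq_zero, not_le]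
  positivity

theorem planarMeasure_eq (hΩ : S.IsPlanarExtension Ω) :
    planarMeasure Ω = ∫⁻ x in S.I, fiberDensity Ω x := by
  rw [← planarMeasure_inter_preimage hΩ.measurableSet (measurableSet_I S), inter_eq_left.2]
  exact fun p hp => hΩ.fst_mem hp

theorem planarMeasure_lt_top (hΩ : S.IsPlanarExtension Ω) (hI : volume S.I < ⊤) (hb0 : b < ⊤)
    (hb : ∀ x ∈ S.I, volume (verticalFiber Ω x) ≤ b)
    (hδ : 0 < δ) (hdist : ∀ p ∈ Ω, ∀ x : ℝ, x ≠ 0 → δ ≤ dist p (x, -1 / x)) :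
    planarMeasure Ω < ⊤ := by
  rw [hΩ.planarMeasure_eq]
  refine (setLIntegral_mono measurable_const fun x hx =>
    hΩ.fiberDensity_le hb hδ hdist hx).trans_lt ?_
  rw [setLIntegral_const]
  exact ENNReal.mul_lt_top (ENNReal.mul_lt_top ENNReal.ofReal_lt_top hb0) hI

theorem planarMeasure_pos (hΩ : S.IsPlanarExtension Ω)
    (ha : ∀ x ∈ S.I, volume (verticalFiber Ω x) ≠ 0)
    (hδ : 0 < δ) (hdist : ∀ p ∈ Ω, ∀ x : ℝ, x ≠ 0 → δ ≤ dist p (x, -1 / x)) :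
    0 < planarMeasure Ω := by
  rw [hΩ.planarMeasure_eq, pos_iff_ne_zero, Ne, setLIntegral_eq_zero_iff (measurableSet_I S)
    (measurable_fiberDensity hΩ.measurableSet)]
  intro h0
  refine (isOpen_interior.measure_pos volume S.nondegenerate_I).ne'
    (measure_mono_null interior_subset (measure_eq_zero_iff_ae_notMem.2 ?_))
  filter_upwards [h0] with x hx hxI
  exact hΩ.fiberDensity_pos ha hδ hdist hxI (hx hxI)

theorem isProbabilityMeasure_normalizedMeasure (h0 : 0 < planarMeasure Ω)
    (h1 : planarMeasure Ω < ⊤) : IsProbabilityMeasure (normalizedMeasure Ω) :=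
  ⟨by rw [normalizedMeasure_apply MeasurableSet.univ, univ_inter,
    ENNReal.inv_mul_cancel h0.ne' h1.ne]⟩

theorem measurePreserving_normalizedMeasure [Countable ι] (hΩ : S.IsPlanarExtension Ω) :
    MeasurePreserving S.planarMap (normalizedMeasure Ω) (normalizedMeasure Ω) :=
  hΩ.measurePreserving_restrict.smul_measure _

theorem measurePreserving_fst (Ω : Set (ℝ × ℝ)) :
    MeasurePreserving Prod.fst (normalizedMeasure Ω) (marginalMeasure Ω) :=
  ⟨measurable_fst, rfl⟩

theorem measurePreserving_map [Countable ι] (hΩ : S.IsPlanarExtension Ω) :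
    MeasurePreserving S.map (marginalMeasure Ω) (marginalMeasure Ω) := by
  refine ⟨S.measurable_map, ?_⟩
  rw [marginalMeasure, Measure.map_map S.measurable_map measurable_fst]
  have : S.map ∘ Prod.fst = Prod.fst ∘ S.planarMap := funext fun p => (fst_planarMap p).symm
  rw [this, ← Measure.map_map measurable_fst S.measurable_planarMap,
    hΩ.measurePreserving_normalizedMeasure.map_eq]

/-- No single cylinder carries the whole preimage of a set of positive measure: case of a cylinder
on which the fiber maps contract. -/
theorem marginalMeasure_preimage_diff_ne_zero [Countable ι] (hΩ : S.IsPlanarExtension Ω)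
    (hfin : planarMeasure Ω < ⊤) (ha : ∀ x ∈ S.I, volume (verticalFiber Ω x) ≠ 0)
    (hδ : 0 < δ) (hdist : ∀ p ∈ Ω, ∀ x : ℝ, x ≠ 0 → δ ≤ dist p (x, -1 / x)) {β : ι}
    (hb : ∀ x ∈ S.K β, volume ((fun y => (S.planarMap (x, y)).2) '' verticalFiber Ω x) <
      volume (verticalFiber Ω (S.map x)))
    {A : Set ℝ} (hA : MeasurableSet A) (hAI : A ⊆ S.I) (hA0 : volume A ≠ 0) :
    marginalMeasure Ω (S.map ⁻¹' A \ S.K β) ≠ 0 := by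
  intro h0
  obtain ⟨X, hXm, hXΩ, hX, hinj, himg, -⟩ := hΩ.exists_measurableSet
  have hBm : MeasurableSet (S.map ⁻¹' A \ S.K β) :=
    (S.measurable_map hA).diff (measurableSet_K β)
  have h1 : planarMeasure ((Prod.fst ⁻¹' (S.map ⁻¹' A \ S.K β)) ∩ Ω) = 0 := by
    rw [marginalMeasure, Measure.map_apply measurable_fst hBm,
      normalizedMeasure_apply (measurable_fst hBm)] at h0
    exact (mul_eq_zero.1 h0).resolve_left (ENNReal.inv_ne_zero.2 hfin.ne)
  set F := Ω ∩ Prod.fst ⁻¹' A with hF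
  have hFm : MeasurableSet F := hΩ.measurableSet.inter (measurable_fst hA)
  set Z := X ∩ Prod.fst ⁻¹' S.K β ∩ S.planarMap ⁻¹' F with hZ
  have hZm : MeasurableSet Z :=
    (hXm.inter (measurable_fst (measurableSet_K β))).inter (S.measurable_planarMap hFm)
  have hZX : Z ⊆ X := fun p hp => hp.1.1
  have hZF : S.planarMap '' Z ⊆ F := by rintro _ ⟨p, hp, rfl⟩; exact hp.2
  have hYm : MeasurableSet (S.planarMap '' Z) :=
    hZm.image_of_measurable_injOn S.measurable_planarMap (hinj.mono hZX)
  -- If almost all of `T⁻¹ A` lay in `K β`, then by invariance the image of the part of `Ω` over `K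
  -- β` would cover almost all of `F`.
  have h2 : planarMeasure F ≤ planarMeasure (S.planarMap '' Z) := by
    rw [planarMeasure_image_of_injOn hZm (fun p hp => hΩ.fst_mem (hXΩ (hZX hp))) (hinj.mono hZX)]
    have h3 := hΩ.measurePreserving_restrict.measure_preimage hFm.nullMeasurableSet
    rw [Measure.restrict_apply hFm, Measure.restrict_apply (S.measurable_planarMap hFm),
      inter_eq_left.2 (inter_subset_left : F ⊆ Ω)] at h3
    rw [← h3]
    calc planarMeasure (S.planarMap ⁻¹' F ∩ Ω)
        ≤ planarMeasure (Z ∪ ((Ω \ X) ∪ (Prod.fst ⁻¹' (S.map ⁻¹' A \ S.K β)) ∩ Ω)) := by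
          refine measure_mono fun p hp => ?_
          by_cases hpX : p ∈ X
          · by_cases hpK : p.1 ∈ S.K β
            · exact Or.inl ⟨⟨hpX, hpK⟩, hp.1⟩
            · refine Or.inr (Or.inr ⟨⟨?_, hpK⟩, hp.2⟩)
              rw [mem_preimage, ← fst_planarMap]
              exact hp.1.2
          · exact Or.inr (Or.inl ⟨hp.2, hpX⟩)
      _ ≤ planarMeasure Z + planarMeasure ((Ω \ X) ∪
            (Prod.fst ⁻¹' (S.map ⁻¹' A \ S.K β)) ∩ Ω) := measure_union_le _ _
      _ = planarMeasure Z := by rw [measure_union_null hX h1, add_zero]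
  have hFt : planarMeasure F ≠ ⊤ := ((measure_mono inter_subset_left).trans_lt hfin).ne
  have h3 : planarMeasure (F \ S.planarMap '' Z) = 0 := by
    rw [measure_sdiff hZF hYm.nullMeasurableSet ((measure_mono hZF).trans_lt hFt.lt_top).ne]
    exact tsub_eq_zero_of_le h2
  have h4 := volume_null_of_planarMeasure_null hδ hdist
    (sdiff_subset.trans inter_subset_left : F \ S.planarMap '' Z ⊆ Ω) h3
  -- By Fubini some fiber over `A` is covered almost everywhere. As `T` is injective on `K β`, the
  -- cover comes from a single fiber, whose image is too short.
  rw [Measure.volume_eq_prod, Measure.measure_prod_null (hFm.diff hYm)] at h4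
  obtain ⟨x, hxA, hx⟩ := ((frequently_ae_mem_iff.2 hA0).and_eventually h4).exists
  have hxI := hAI hxA
  have h5 : verticalFiber Ω x \ Prod.mk x ⁻¹' (S.planarMap '' Z) ⊆
      Prod.mk x ⁻¹' (F \ S.planarMap '' Z) := fun y hy => ⟨⟨hy.1, hxA⟩, hy.2⟩
  have h6 : volume (verticalFiber Ω x \ Prod.mk x ⁻¹' (S.planarMap '' Z)) = 0 :=
    measure_mono_null h5 hx
  have h7 : volume (verticalFiber Ω x) ≤ volume (Prod.mk x ⁻¹' (S.planarMap '' Z)) := by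
    have := measure_le_inter_add_sdiff volume (verticalFiber Ω x)
      (Prod.mk x ⁻¹' (S.planarMap '' Z))
    rw [h6, add_zero] at this
    exact this.trans (measure_mono inter_subset_right)
  obtain ⟨y, hy⟩ : (Prod.mk x ⁻¹' (S.planarMap '' Z)).Nonempty := by
    rw [nonempty_iff_ne_empty]
    intro h
    rw [h, measure_empty, nonpos_iff_eq_zero] at h7
    exact ha x hxI h7
  obtain ⟨p, hpZ, hp⟩ := hy
  have hpK : p.1 ∈ S.K β := hpZ.1.2
  have hpx : S.map p.1 = x := by rw [← fst_planarMap, hp]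
  have h8 : Prod.mk x ⁻¹' (S.planarMap '' Z) ⊆
      (fun y => (S.planarMap (p.1, y)).2) '' verticalFiber Ω p.1 := by
    rintro v ⟨q, hqZ, hq⟩
    have hqx : S.map q.1 = x := by rw [← fst_planarMap, hq]
    have hqp : q.1 = p.1 := injOn_map β hqZ.1.2 hpK (hqx.trans hpx.symm)
    refine ⟨q.2, ?_, ?_⟩
    · change (p.1, q.2) ∈ Ω
      rw [← hqp]; exact hXΩ hqZ.1.1
    · change (S.planarMap (p.1, q.2)).2 = v
      rw [← hqp, Prod.mk.eta, hq]
  have h9 := (h7.trans (measure_mono h8)).trans_lt (hb p.1 hpK)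
  rw [hpx] at h9
  exact lt_irrefl _ h9

/-- The marginal of the planar measure is an invariant density for the interval map. -/
theorem exists_isInvariantDensity [Countable ι] (hΩ : S.IsPlanarExtension Ω) (hI : volume S.I < ⊤)
    (ha0 : 0 < a) (hb0 : b < ⊤)
    (hab : ∀ x ∈ S.I, a ≤ volume (verticalFiber Ω x) ∧ volume (verticalFiber Ω x) ≤ b)
    (hδ : 0 < δ) (hdist : ∀ p ∈ Ω, ∀ x : ℝ, x ≠ 0 → δ ≤ dist p (x, -1 / x)) {β : ι}
    (hfull : S.IsFull β)
    (hc : ∀ x ∈ S.K β, volume ((fun y => (S.planarMap (x, y)).2) '' verticalFiber Ω x) <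
      volume (verticalFiber Ω (S.map x))) :
    ∃ h C, S.IsInvariantDensity (marginalMeasure Ω) h C := by
  have ha : ∀ x ∈ S.I, volume (verticalFiber Ω x) ≠ 0 := fun x hx => (ha0.trans_le (hab x hx).1).ne'
  have hb : ∀ x ∈ S.I, volume (verticalFiber Ω x) ≤ b := fun x hx => (hab x hx).2
  have hpos := hΩ.planarMeasure_pos ha hδ hdist
  have hfin := hΩ.planarMeasure_lt_top hI hb0 hb hδ hdist
  have hprob := isProbabilityMeasure_normalizedMeasure hpos hfin
  set D := ENNReal.ofReal (1 / min (1 / 4) (δ ^ 2 / 2)) * b with hD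
  have hDt : D < ⊤ := ENNReal.mul_lt_top ENNReal.ofReal_lt_top hb0
  set κ := (planarMeasure Ω)⁻¹ with hκ
  have hκt : κ ≠ ⊤ := ENNReal.inv_ne_top.2 hpos.ne'
  have hκ0 : κ ≠ 0 := ENNReal.inv_ne_zero.2 hfin.ne
  have hle : ∀ x, fiberDensity Ω x ≤ D := fun x => by
    by_cases hx : x ∈ S.I
    · exact hΩ.fiberDensity_le hb hδ hdist hx
    · rw [hΩ.fiberDensity_eq_zero hx]; exact zero_le
  have hne : ∀ x, κ * fiberDensity Ω x ≠ ⊤ := fun x =>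
    ENNReal.mul_ne_top hκt ((hle x).trans_lt hDt).ne
  have hmeas := measurable_fiberDensity hΩ.measurableSet
  have heq : marginalMeasure Ω = volume.withDensity fun x => κ * fiberDensity Ω x := by
    ext A hA
    rw [marginalMeasure_apply hΩ.measurableSet hA, withDensity_apply _ hA,
      lintegral_const_mul _ hmeas]
  have hnull : ∀ E ⊆ S.I, marginalMeasure Ω E = 0 → volume E = 0 := by
    intro E hE h0
    rw [heq, withDensity_apply_eq_zero (hmeas.const_mul κ)] at h0
    refine measure_mono_null (fun x hx => mem_inter ?_ hx) h0
    exact mul_ne_zero hκ0 (hΩ.fiberDensity_pos ha hδ hdist (hE hx))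
  refine ⟨fun x => (κ * fiberDensity Ω x).toReal, (κ * D).toReal, ?_, ?_, ?_, ?_, ?_, ?_, ?_, ?_⟩
  · exact Measure.isProbabilityMeasure_map measurable_fst.aemeasurable
  · exact (hmeas.const_mul κ).ennreal_toReal
  · exact fun x hx => ENNReal.toReal_pos
      (mul_ne_zero hκ0 (hΩ.fiberDensity_pos ha hδ hdist hx)) (hne x)
  · intro x hx
    rw [hΩ.fiberDensity_eq_zero hx, mul_zero, ENNReal.toReal_zero]
  · intro x
    refine ENNReal.toReal_mono (ENNReal.mul_ne_top hκt hDt.ne) ?_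
    gcongr
    exact hle x
  · rw [heq]
    congr 1
    ext x
    rw [ENNReal.ofReal_toReal (hne x)]
  · exact hΩ.measurePreserving_map
  · intro β' A hA hAI hA0
    by_cases hβ : β' = β
    · rw [hβ]
      exact hΩ.marginalMeasure_preimage_diff_ne_zero hfin ha hδ hdist hc hA hAI hA0
    · intro h0
      -- For another cylinder the full `K β` supplies the missing preimage: `E` maps onto `A` up to
      -- endpoints of `I`.
      set E := S.map ⁻¹' A ∩ S.K β with hE
      have hEm : MeasurableSet E := (S.measurable_map hA).inter (measurableSet_K β)
      have h1 : volume E = 0 := by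
        refine hnull E (inter_subset_right.trans (K_subset_I β)) (measure_mono_null ?_ h0)
        exact fun x hx => ⟨hx.1, fun hx' => hβ (eq_of_mem hx' hx.2)⟩
      rw [← volume_map_image_eq_zero inter_subset_right hEm] at h1
      refine hA0 (measure_mono_null (t := S.map '' E ∪ frontier S.I) (fun x hx => ?_)
        (measure_union_null h1 (volume_frontier_eq_zero S.ordConnected_I)))
      by_cases hxI : x ∈ interior S.I
      · obtain ⟨t, ht, rfl⟩ := hfull hxI
        exact Or.inl ⟨t, ⟨hx, ht⟩, rfl⟩
      · exact Or.inr ⟨subset_closure (hAI hx), hxI⟩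

end IsPlanarExtension

end PiecewiseMobius

/-! ### Measurable inverses and natural extensions -/

/-- An almost everywhere injective measure preserving map has a measurable inverse. -/
theorem MeasureTheory.MeasurePreserving.exists_ae_inverse {X Y : Type*} [MeasurableSpace X]
    [StandardBorelSpace X] [MeasurableSpace Y] [StandardBorelSpace Y] [Nonempty X]
    {μ : Measure X} {m : Measure Y} {f : X → Y} (hf : MeasurePreserving f μ m) {s : Set X}
    (hs : MeasurableSet s) (hs0 : ∀ᵐ x ∂μ, x ∈ s) (hinj : InjOn f s) :
    ∃ g : Y → X, MeasurePreserving g m μ ∧ (∀ᵐ x ∂μ, g (f x) = x) ∧ ∀ᵐ y ∂m, f (g y) = y := by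
  have := hs.standardBorel
  -- By the Lusin–Souslin theorem, an injective Borel map between standard Borel spaces is a
  -- measurable embedding.
  have hemb : MeasurableEmbedding (s.domRestrict f) :=
    (hf.measurable.comp measurable_subtype_coe).measurableEmbedding (injOn_iff_injective.1 hinj)
  obtain ⟨g, hgm, hg⟩ := hemb.exists_measurable_extend measurable_subtype_coe fun _ => ‹Nonempty X›
  have hgf : ∀ x ∈ s, g (f x) = x := fun x hx => congr_fun hg ⟨x, hx⟩
  have h1 : ∀ᵐ x ∂μ, g (f x) = x := hs0.mono hgf
  refine ⟨g, ⟨hgm, ?_⟩, h1, ?_⟩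
  · rw [← hf.map_eq, Measure.map_map hgm hf.measurable,
      Measure.map_congr (show g ∘ f =ᵐ[μ] id from h1), Measure.map_id]
  · have hrange : MeasurableSet (range (s.domRestrict f)) := hemb.measurableSet_range
    have h2 : ∀ᵐ y ∂m, y ∈ range (s.domRestrict f) := by
      rw [← hf.map_eq]
      exact (ae_map_iff hf.aemeasurable hrange).2 (hs0.mono fun x hx => ⟨⟨x, hx⟩, rfl⟩)
    filter_upwards [h2] with y hy
    obtain ⟨⟨x, hx⟩, rfl⟩ := hy
    exact congr_arg f (hgf x hx)

section NaturalExtension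

variable {X Y : Type*} [MeasurableSpace X] [MeasurableSpace Y] {μ : Measure X} {ν : Measure Y}
  {F G : X → X} {π : X → Y} {T : Y → Y}

/-- The history `n ↦ π (G ^ n x)` of a point, where `G` is the inverse of the dynamics. -/
def history (G : X → X) (π : X → Y) (x : X) (n : ℕ) : Y := π (G^[n] x)

theorem measurable_history (hG : Measurable G) (hπ : Measurable π) : Measurable (history G π) :=
  measurable_pi_lambda _ fun n => hπ.comp (hG.iterate n)

theorem ae_iterate_rightInverse (hG : MeasurePreserving G μ μ) (hFG : ∀ᵐ x ∂μ, F (G x) = x) :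
    ∀ᵐ x ∂μ, ∀ n, F (G^[n + 1] x) = G^[n] x := by
  refine ae_all_iff.2 fun n => ?_
  filter_upwards [(hG.iterate n).quasiMeasurePreserving.ae hFG] with x hx
  rw [Function.iterate_succ_apply', hx]

theorem ae_iterate_leftInverse (hF : MeasurePreserving F μ μ) (hGF : ∀ᵐ x ∂μ, G (F x) = x) :
    ∀ᵐ x ∂μ, ∀ n k, k ≤ n → G^[k] (F^[n] x) = F^[n - k] x := by
  have h : ∀ᵐ x ∂μ, ∀ n, G (F (F^[n] x)) = F^[n] x :=
    ae_all_iff.2 fun n => (hF.iterate n).quasiMeasurePreserving.ae hGF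
  filter_upwards [h] with x hx n k hk
  induction k with
  | zero => rfl
  | succ k ih =>
    rw [Function.iterate_succ_apply', ih (by omega), show n - k = (n - (k + 1)) + 1 by omega,
      Function.iterate_succ_apply', hx]

/-- A system with almost everywhere defined inverse, whose points are determined by their histories
in the factor, is the natural extension of the factor. -/
theorem isNaturalExtension_of_history (hπ : MeasurePreserving π μ ν)
    (hG : MeasurePreserving G μ μ) (hFG : ∀ᵐ x ∂μ, F (G x) = x) (hGF : ∀ᵐ x ∂μ, G (F x) = x)
    (hT : Measurable T) [MeasurableEq Y] (hsemi : ∀ x, π (F x) = T (π x)) {ψ : (ℕ → Y) → X}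
    (hψ : MeasurePreserving ψ (μ.map (history G π)) μ)
    (h1 : ∀ᵐ x ∂μ, ψ (history G π x) = x)
    (h2 : ∀ᵐ s ∂μ.map (history G π), history G π (ψ s) = s) :
    IsNaturalExtension F μ π T ν := by
  have hm := measurable_history hG.measurable hπ.measurable
  refine ⟨μ.map (history G π), ⟨?_, ?_⟩, history G π, ψ, ⟨hm, rfl⟩, hψ, h1, h2, ?_, ?_⟩
  · rw [ae_map_iff hm.aemeasurable]
    · filter_upwards [ae_iterate_rightInverse hG hFG] with x hx n
      rw [history, ← hsemi, hx, history]
    · have : {s : ℕ → Y | ∀ n, T (s (n + 1)) = s n} = ⋂ n, {s | T (s (n + 1)) = s n} := by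
        ext s; simp
      rw [this]
      exact MeasurableSet.iInter fun n => measurableSet_eq_fun
        (hT.comp (measurable_pi_apply _)) (measurable_pi_apply _)
  · intro n
    rw [Measure.map_map (measurable_pi_apply n) hm]
    exact (hπ.comp (hG.iterate n)).map_eq
  · filter_upwards [hGF] with x hx
    funext n
    cases n with
    | zero => exact hsemi x
    | succ n => rw [history, Function.iterate_succ_apply, hx]; rfl
  · exact Eventually.of_forall fun x => rfl

/-- Invariant sets of the extension are approximated by sets coming from the factor. -/
theorem exists_measure_symmDiff_lt_of_history [IsProbabilityMeasure μ]
    (hπ : Measurable π) (hF : MeasurePreserving F μ μ) (hG : MeasurePreserving G μ μ)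
    (hGF : ∀ᵐ x ∂μ, G (F x) = x) (hT : Measurable T) (hsemi : ∀ x, π (F x) = T (π x))
    {ψ : (ℕ → Y) → X} (hψ : Measurable ψ) (h1 : ∀ᵐ x ∂μ, ψ (history G π x) = x) {E : Set X}
    (hE : MeasurableSet E) (hinv : F ⁻¹' E = E) {ε : ℝ} (hε : 0 < ε) :
    ∃ B : Set Y, MeasurableSet B ∧ μ (symmDiff E (π ⁻¹' B)) < ENNReal.ofReal ε := by
  have hm := measurable_history hG.measurable hπ
  have : IsProbabilityMeasure (μ.map (history G π)) := Measure.isProbabilityMeasure_map hm.aemeasurable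
  have hdense := Measure.MeasureDense.of_generateFrom_isSetAlgebra_finite (μ.map (history G π))
    (isSetAlgebra_measurableCylinders (α := fun _ : ℕ => Y))
    (generateFrom_measurableCylinders (α := fun _ : ℕ => Y)).symm
  obtain ⟨t, ht, hlt⟩ := hdense.approx (ψ ⁻¹' E) (hψ hE) (measure_ne_top _ _) ε hε
  have htm := hdense.measurable t ht
  obtain ⟨s, D, hD, rfl⟩ := (mem_measurableCylinders t).1 ht
  have hsemi' : ∀ n x, π (F^[n] x) = T^[n] (π x) := fun n x => by
    induction n with
    | zero => rfl
    | succ n ih => rw [Function.iterate_succ_apply', hsemi, ih, Function.iterate_succ_apply']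
  set N := s.sup id with hN
  have hsN : ∀ i ∈ s, i ≤ N := fun i hi => Finset.le_sup (f := id) hi
  -- Moved forward by `F^N`, the coordinates `i ≤ N` of the history become `T^(N - i) (π x)`, so a
  -- cylinder condition depends on `π x` alone, while `E` is unchanged.
  let q : Y → (∀ i : s, Y) := fun y i => T^[N - i] y
  have hq : Measurable q := measurable_pi_lambda _ fun i => hT.iterate _
  refine ⟨q ⁻¹' D, hq hD, ?_⟩
  rw [Measure.map_apply hm ((hψ hE).symmDiff htm)] at hlt
  refine lt_of_eq_of_lt ?_ hlt
  have hFN := (hF.iterate N).measure_preimage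
    (hm ((hψ hE).symmDiff htm)).nullMeasurableSet
  rw [← hFN]
  refine measure_congr ?_
  have hinvN : ∀ n x, F^[n] x ∈ E ↔ x ∈ E := fun n x => by
    induction n with
    | zero => rfl
    | succ n ih => rw [Function.iterate_succ_apply', ← mem_preimage, hinv, ih]
  filter_upwards [(hF.iterate N).quasiMeasurePreserving.ae h1, ae_iterate_leftInverse hF hGF]
    with x hx1 hx2
  have e1 : ψ (history G π (F^[N] x)) ∈ E ↔ x ∈ E := by rw [hx1, hinvN]
  have e2 : history G π (F^[N] x) ∈ cylinder s D ↔ q (π x) ∈ D := by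
    rw [mem_cylinder]
    have : s.restrict (history G π (F^[N] x)) = q (π x) := by
      funext i
      change π (G^[(i : ℕ)] (F^[N] x)) = T^[N - i] (π x)
      rw [hx2 N i (hsN i i.2), hsemi']
    rw [this]
  have : (x ∈ symmDiff E (π ⁻¹' (q ⁻¹' D))) =
      (x ∈ F^[N] ⁻¹' (history G π ⁻¹' symmDiff (ψ ⁻¹' E) (cylinder s D))) := by
    rw [eq_iff_iff]
    simp only [mem_preimage, mem_symmDiff, e1, e2]
  exact this

/-- The natural extension of an ergodic system is ergodic. -/
theorem ergodic_of_history [IsProbabilityMeasure μ]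
    (hπ : MeasurePreserving π μ ν) (hF : MeasurePreserving F μ μ) (hG : MeasurePreserving G μ μ)
    (hGF : ∀ᵐ x ∂μ, G (F x) = x) (hT : Ergodic T ν) (hsemi : ∀ x, π (F x) = T (π x))
    {ψ : (ℕ → Y) → X} (hψ : Measurable ψ) (h1 : ∀ᵐ x ∂μ, ψ (history G π x) = x) :
    Ergodic F μ := by
  refine ⟨hF, ⟨fun E hE hinv => ?_⟩⟩
  choose B hBm hB using fun k : ℕ => exists_measure_symmDiff_lt_of_history hπ.measurable hF hG hGF
    hT.measurable hsemi hψ h1 hE hinv (show (0 : ℝ) < (1 / 2) ^ k by positivity)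
  have hsum : ∑' k, μ (symmDiff E (π ⁻¹' B k)) ≠ ⊤ := by
    refine ne_top_of_le_ne_top ?_ (ENNReal.tsum_le_tsum fun k => (hB k).le)
    rw [← ENNReal.ofReal_tsum_of_nonneg (fun k => by positivity)
      (summable_geometric_of_lt_one (by norm_num) (by norm_num))]
    exact ENNReal.ofReal_ne_top
  -- The errors `(1/2)^k` are summable, so by Borel–Cantelli `E` agrees almost everywhere with `π
  -- ⁻¹' L`, and `L` inherits invariance modulo null sets.
  set L := limsup B atTop with hL
  have hLm : MeasurableSet L := MeasurableSet.measurableSet_limsup hBm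
  have hae : ∀ᵐ x ∂μ, x ∈ E ↔ π x ∈ L := by
    filter_upwards [ae_eventually_notMem hsum] with x hx
    have hx' : ∀ᶠ k in atTop, (x ∈ E ↔ π x ∈ B k) := by
      filter_upwards [hx] with k hk
      rw [mem_symmDiff, mem_preimage] at hk
      tauto
    rw [hL, mem_limsup_iff_frequently_mem]
    constructor
    · intro hxE
      exact (hx'.mono fun k hk => hk.1 hxE).frequently
    · intro hfr
      obtain ⟨k, hk1, hk2⟩ := (hfr.and_eventually hx').exists
      exact hk2.2 hk1
  have hTL : T ⁻¹' L =ᵐ[ν] L := by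
    rw [← hπ.map_eq, eventuallyEq_set, ae_map_iff hπ.aemeasurable]
    · filter_upwards [hae, hF.quasiMeasurePreserving.ae hae] with x h2 h3
      rw [mem_preimage, ← hsemi, ← h3, ← h2, ← mem_preimage, hinv]
    · have : {y | y ∈ T ⁻¹' L ↔ y ∈ L} = (symmDiff (T ⁻¹' L) L)ᶜ := by
        ext y; simp only [mem_ofPred_eq, mem_compl_iff, mem_symmDiff]; tauto
      rw [this]
      exact ((hT.measurable hLm).symmDiff hLm).compl
  rw [eventuallyConst_set']
  rcases hT.quasiErgodic.ae_empty_or_univ₀ hLm.nullMeasurableSet hTL with h | h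
  · refine Or.inl (ae_eq_empty.2 (measure_eq_zero_iff_ae_notMem.2 ?_))
    filter_upwards [hae, hπ.quasiMeasurePreserving.ae
      (measure_eq_zero_iff_ae_notMem.1 (ae_eq_empty.1 h))] with x h2 h3
    rwa [h2]
  · refine Or.inr (ae_eq_univ.2 (measure_eq_zero_iff_ae_notMem.2 ?_))
    filter_upwards [hae, hπ.quasiMeasurePreserving.ae
      (measure_eq_zero_iff_ae_notMem.1 (ae_eq_univ.1 h))] with x h2 h3
    rw [mem_compl_iff, h2]
    exact h3

end NaturalExtension

/-! ### Points of `Ω` are determined by their histories -/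

namespace PiecewiseMobius

variable {ι : Type*} {S : PiecewiseMobius ι} {Ω : Set (ℝ × ℝ)} {δ : ℝ}

/-- The planar map contracts the differences of the coordinates `y / (1 + x y)` by the derivative. -/
theorem abs_fiberCoord_sub_mul_jac {p q : ℝ × ℝ} (hpI : p.1 ∈ S.I) (hpq : p.1 = q.1)
    (hp : p ∈ S.regularPoints) (hq : q ∈ S.regularPoints) (hp1 : 1 + p.1 * p.2 ≠ 0)
    (hq1 : 1 + q.1 * q.2 ≠ 0) :
    |(S.planarMap p).2 / (1 + (S.planarMap p).1 * (S.planarMap p).2) -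
      (S.planarMap q).2 / (1 + (S.planarMap q).1 * (S.planarMap q).2)| * S.jac p.1 =
      |p.2 / (1 + p.1 * p.2) - q.2 / (1 + q.1 * q.2)| := by
  obtain ⟨β, hβ⟩ := exists_mem_K hpI
  have hβ' : q.1 ∈ S.K β := hpq ▸ hβ
  have hdet := S.det_ne_zero β
  have hd := mobiusDenom_ne hβ
  rw [planarMap_eq hβ, planarMap_eq hβ', jac_eq hβ, planarMobius_eq, planarMobius_eq]
  simp only
  rw [fiberCoord_mobius hdet hd (hp β hβ) hp1,
    fiberCoord_mobius hdet (mobiusDenom_ne hβ') (hq β hβ') hq1, ← hpq, sub_sub_sub_cancel_right,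
    ← mul_sub, abs_mul, abs_div, abs_of_nonneg (sq_nonneg (mobiusDenom (S.M β) p.1)), mobiusJac]
  have : |(S.M β).det| ≠ 0 := abs_ne_zero.2 hdet
  field_simp

theorem eq_zero_of_two_mul_le {D : ℕ → ℝ} {B : ℝ} {r : ℕ} (h0 : ∀ n, 0 ≤ D n) (hB : ∀ n, D n ≤ B)
    (h2 : ∀ n, 2 * D n ≤ D (n + r)) : D 0 = 0 := by
  have key : ∀ k : ℕ, 2 ^ k * D 0 ≤ D (r * k) := by
    intro k
    induction k with
    | zero => simp
    | succ k ih =>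
      calc 2 ^ (k + 1) * D 0 = 2 * (2 ^ k * D 0) := by ring
        _ ≤ 2 * D (r * k) := by gcongr
        _ ≤ D (r * k + r) := h2 _
        _ = _ := by rw [mul_add, mul_one]
  by_contra hne
  have hpos : 0 < D 0 := lt_of_le_of_ne (h0 0) (Ne.symm hne)
  obtain ⟨k, hk⟩ := pow_unbounded_of_one_lt (B / D 0) (one_lt_two (α := ℝ))
  rw [div_lt_iff₀ hpos] at hk
  linarith [key k, hB (r * k)]

/-- Two points of `Ω` with the same history under the inverse `G` of the planar map are equal. -/
theorem eq_of_history_eq {G : ℝ × ℝ → ℝ × ℝ} {r : ℕ} (hΩ : S.IsPlanarExtension Ω) (hδ : 0 < δ)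
    (hdist : ∀ p ∈ Ω, ∀ x : ℝ, x ≠ 0 → δ ≤ dist p (x, -1 / x)) {p q : ℝ × ℝ}
    (hp : ∀ n, G^[n] p ∈ Ω ∧ G^[n] p ∈ S.regularPoints ∧ S.planarMap (G^[n + 1] p) = G^[n] p ∧
      2 ≤ S.jacIter r (G^[n] p).1)
    (hq : ∀ n, G^[n] q ∈ Ω ∧ G^[n] q ∈ S.regularPoints ∧ S.planarMap (G^[n + 1] q) = G^[n] q ∧
      2 ≤ S.jacIter r (G^[n] q).1)
    (hpq : ∀ n, (G^[n] p).1 = (G^[n] q).1) : p = q := by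
  set z : ℝ × ℝ → ℝ := fun p => p.2 / (1 + p.1 * p.2) with hz
  set D : ℕ → ℝ := fun n => |z (G^[n] p) - z (G^[n] q)| with hD
  have hne : ∀ p ∈ Ω, 1 + p.1 * p.2 ≠ 0 := fun p hp => one_add_mul_ne_zero hδ (hdist p hp)
  have hzle : ∀ p ∈ Ω, |z p| ≤ 1 / δ := fun p hp => by
    rw [hz, abs_div, div_le_div_iff₀ (abs_pos.2 (hne p hp)) hδ, one_mul, mul_comm]
    exact mul_abs_snd_le (hdist p hp)
  -- One step into the past multiplies the distance in the coordinate `z` by the derivative of `T`;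
  -- over `r` steps it at least doubles, while `D` stays below `2 / δ`.
  have hstep : ∀ n, D n * S.jac (G^[n + 1] p).1 = D (n + 1) := fun n => by
    have := abs_fiberCoord_sub_mul_jac (hΩ.fst_mem (hp (n + 1)).1) (hpq (n + 1)) (hp (n + 1)).2.1
      (hq (n + 1)).2.1 (hne _ (hp (n + 1)).1) (hne _ (hq (n + 1)).1)
    rwa [(hp n).2.2.1, (hq n).2.2.1] at this
  have hmap : ∀ n, S.map (G^[n + 1] p).1 = (G^[n] p).1 := fun n => by
    rw [← fst_planarMap, (hp n).2.2.1]
  have hsteps : ∀ k n, D n * S.jacIter k (G^[n + k] p).1 = D (n + k) := by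
    intro k
    induction k with
    | zero => intro n; simp [jacIter]
    | succ k ih =>
      intro n
      have h1 : S.jacIter (k + 1) (G^[n + (k + 1)] p).1 =
          S.jac (G^[n + k + 1] p).1 * S.jacIter k (G^[n + k] p).1 := by
        rw [add_comm k 1, jacIter_add, Function.iterate_one, add_comm 1 k, ← add_assoc, hmap]
        simp [jacIter]
      rw [h1, ← add_assoc, ← hstep, ← ih n]
      ring
  have h0 : D 0 = 0 := by
    refine eq_zero_of_two_mul_le (B := 2 / δ) (r := r) (fun n => abs_nonneg _) (fun n => ?_)
      fun n => ?_
    · calc D n ≤ |z (G^[n] p)| + |z (G^[n] q)| := abs_sub _ _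
        _ ≤ 1 / δ + 1 / δ := add_le_add (hzle _ (hp n).1) (hzle _ (hq n).1)
        _ = 2 / δ := by ring
    · rw [← hsteps r n, mul_comm]
      exact mul_le_mul_of_nonneg_left (hp _).2.2.2 (abs_nonneg _)
  have hx : p.1 = q.1 := hpq 0
  have hzz : z p = z q := sub_eq_zero.1 (abs_eq_zero.1 h0)
  have hp1 := hne p (hp 0).1
  have hq1 := hne q (hq 0).1
  refine Prod.ext hx ?_
  rw [hz] at hzz
  simp only at hzz
  rw [div_eq_div_iff hp1 hq1, hx] at hzz
  linear_combination hzz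

end PiecewiseMobius

/-! ### The theorem -/

theorem theoremt {ι : Type*} [Countable ι] (S : PiecewiseMobius ι)
    (hI : volume S.I < ⊤)
    (Ω : Set (ℝ × ℝ)) (hΩ : S.IsPlanarExtension Ω)
    (ha : ∃ a b : ℝ≥0∞, 0 < a ∧ b < ⊤ ∧
      ∀ x ∈ S.I, a ≤ volume (verticalFiber Ω x) ∧ volume (verticalFiber Ω x) ≤ b)
    (hb : ∃ δ : ℝ, 0 < δ ∧ ∀ p ∈ Ω, ∀ x : ℝ, x ≠ 0 → δ ≤ dist p (x, -1 / x))
    (hc : ∃ β, S.IsFull β ∧ ∃ a b : ℝ≥0∞, 0 < a ∧ b < 1 ∧ ∀ x ∈ S.K β,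
      a ≤ volume ((fun y => (S.planarMap (x, y)).2) '' verticalFiber Ω x) /
          volume (verticalFiber Ω (S.map x)) ∧
      volume ((fun y => (S.planarMap (x, y)).2) '' verticalFiber Ω x) /
          volume (verticalFiber Ω (S.map x)) ≤ b)
    (hd : S.BoundedNonFullRange) :
    (0 < planarMeasure Ω ∧ planarMeasure Ω < ⊤) ∧
    S.EventuallyExpansive ∧
    Ergodic S.map (marginalMeasure Ω) ∧
    IsNaturalExtension S.planarMap (normalizedMeasure Ω) Prod.fst S.map (marginalMeasure Ω) ∧
    Ergodic S.planarMap (normalizedMeasure Ω) := by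
  obtain ⟨a, b, ha0, hb0, hab⟩ := ha
  obtain ⟨δ, hδ, hdist⟩ := hb
  obtain ⟨β, hβ, _, b', _, hb1, hratio⟩ := hc
  obtain ⟨γ, hγfull, hγ⟩ := hd.exists_isAvoided
  have hne : ∀ x ∈ S.I, volume (verticalFiber Ω x) ≠ 0 := fun x hx =>
    (ha0.trans_le (hab x hx).1).ne'
  have hpos := hΩ.planarMeasure_pos hne hδ hdist
  have hfin := hΩ.planarMeasure_lt_top hI hb0 (fun x hx => (hab x hx).2) hδ hdist
  have hprob := PiecewiseMobius.IsPlanarExtension.isProbabilityMeasure_normalizedMeasure hpos hfin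
  have hcontr : ∀ x ∈ S.K β, volume ((fun y => (S.planarMap (x, y)).2) '' verticalFiber Ω x) <
      volume (verticalFiber Ω (S.map x)) := by
    intro x hx
    have hxI := PiecewiseMobius.map_mem_I (PiecewiseMobius.K_subset_I β hx)
    have h1 := (hratio x hx).2.trans_lt hb1
    rwa [ENNReal.div_lt_iff (Or.inl (hne _ hxI))
      (Or.inl ((hab _ hxI).2.trans_lt hb0).ne), one_mul] at h1
  obtain ⟨h, C, H⟩ := hΩ.exists_isInvariantDensity hI ha0 hb0 hab hδ hdist hβ hcontr
  have herg := H.ergodic hI hγfull hγ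
  have hmp := hΩ.measurePreserving_normalizedMeasure
  have hπ := PiecewiseMobius.IsPlanarExtension.measurePreserving_fst Ω
  have hac : normalizedMeasure Ω ≪ planarMeasure :=
    (Measure.smul_absolutelyContinuous).trans Measure.absolutelyContinuous_restrict
  have haeΩ : ∀ᵐ p ∂normalizedMeasure Ω, p ∈ Ω :=
    Measure.smul_absolutelyContinuous (ae_restrict_mem hΩ.measurableSet)
  obtain ⟨X, hXm, hXΩ, hX, hinj, -, -⟩ := hΩ.exists_measurableSet
  -- `G` is a globally defined measurable map that inverts `𝒯` almost everywhere.
  obtain ⟨G, hG, hGF, hFG⟩ := hmp.exists_ae_inverse hXm (by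
    filter_upwards [haeΩ, hac (measure_eq_zero_iff_ae_notMem.1 hX)] with p hp hp'
    exact by_contra fun hpX => hp' ⟨hp, hpX⟩) hinj
  obtain ⟨r, -, hr⟩ := H.exists_ae_two_le_jacIter hI hγfull hγ
  have hgood : ∀ᵐ p ∂normalizedMeasure Ω, ∀ n, G^[n] p ∈ Ω ∧ G^[n] p ∈ S.regularPoints ∧
      S.planarMap (G^[n + 1] p) = G^[n] p ∧ 2 ≤ S.jacIter r (G^[n] p).1 := by
    have hreg : ∀ᵐ p ∂normalizedMeasure Ω, p ∈ S.regularPoints := by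
      have := hac (planarMeasure_absolutelyContinuous
        (measure_eq_zero_iff_ae_notMem.1 S.volume_compl_regularPoints))
      filter_upwards [this] with p hp using not_not.1 hp
    have hall := haeΩ.and (hreg.and (hπ.quasiMeasurePreserving.ae hr))
    have hiter : ∀ᵐ p ∂normalizedMeasure Ω, ∀ n, G^[n] p ∈ Ω ∧ G^[n] p ∈ S.regularPoints ∧
        2 ≤ S.jacIter r (G^[n] p).1 :=
      ae_all_iff.2 fun n => (hG.iterate n).quasiMeasurePreserving.ae hall
    filter_upwards [hiter, ae_iterate_rightInverse hG hFG] with p h1 h2 n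
    exact ⟨(h1 n).1, (h1 n).2.1, h2 n, (h1 n).2.2⟩
  -- Off the measurable null set `Z` every backward orbit is well behaved, so the history map is
  -- injective there.
  obtain ⟨Z, hZsub, hZm, hZ⟩ := exists_measurable_superset_of_null hgood
  have hφ : MeasurePreserving (history G Prod.fst) (normalizedMeasure Ω)
      ((normalizedMeasure Ω).map (history G Prod.fst)) :=
    ⟨measurable_history hG.measurable measurable_fst, rfl⟩
  obtain ⟨ψ, hψ, h1, h2⟩ := hφ.exists_ae_inverse hZm.compl
    (measure_eq_zero_iff_ae_notMem.1 hZ) (by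
      intro p hp q hq hpq
      have hgood' : ∀ p ∈ Zᶜ, _ := fun p hp => not_not.1 fun h => hp (hZsub h)
      exact PiecewiseMobius.eq_of_history_eq hΩ hδ hdist (hgood' p hp) (hgood' q hq)
        fun n => congr_fun hpq n)
  exact ⟨⟨hpos, hfin⟩, H.eventuallyExpansive hI hγfull hγ, herg,
    isNaturalExtension_of_history hπ hG hFG hGF S.measurable_map PiecewiseMobius.fst_planarMap
      hψ h1 h2,
    ergodic_of_history hπ hmp hG hGF herg PiecewiseMobius.fst_planarMap hψ.measurable h1⟩
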